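/- **Setting.** Let $X,Y$ (states) and $A,B$ (actions) be finite sets and $L\ge 1$. The state spaces are layered, $X=X_0\sqcup\dots\sqcup X_L$, $Y=Y_0\sqcup\dots\sqcup Y_L$, with $X_0=\{x_0\}$, $X_L=\{x_L\}$, $Y_0=\{y_0\}$, $Y_L=\{y_L\}$, and the transitions $P_1(\cdot\mid x,a)$, $P_2(\cdot\mid y,b)$ are probability distributions that lead from each layer only to the next one. An occupancy measure under $P$ is the function $q(x,a,x')=\mathrm{Prob}(x_\ell=x,a_\ell=a,x_{\ell+1}=x')$ ($x\in X_\ell$) of some policy; $\Delta(P)$ is the set of these, $q(x,a)=\sum_{x'}q(x,a,x')$, $\langle q_1,g\rangle=\sum_{\ell<L}\sum_{x\in X_\ell,a}q_1(x,a)g(x,a)$ (likewise $\langle q_2,h\rangle$), and $\langle q_1\cdot q_2,r\rangle=\sum_{\ell<L}\sum_{x\in X_\ell,y\in Y_\ell}\sum_{a,b}q_1(x,a)q_2(y,b)r(x,y,a,b)$. Rewards $r^t:X\times Y\times A\times B\to[0,1]$, $t\ge1$, are arbitrary but fixed in advance; the utilities $g^t:X\times A\to[0,1]$, $h^t:Y\times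 B\to[0,1]$ are random with means $\mathbb E g^t=g$, $\mathbb E h^t=h$, and $(g^t,h^t)$ is independent of everything that happened in earlier episodes and of the moves in episode $t$. By convention $r^0,g^0,h^0$ are zero. Let $b_1,b_2\in(0,L]$. The players $q_1$ (min) and $q_2$ (max) play $\sum_{t=0}^{T-1}\langle q_1\cdot q_2,r^t\rangle$ over $\Delta(P_1)\times\Delta(P_2)$ subject to $\langle q_1,g\rangle\le b_1$ and $\langle q_2,h\rangle\le b_2$. Let $(q_1^\star,q_2^\star)$ be a Nash equilibrium of this constrained game: both are feasible, and no feasible unilateral deviation improves the objective of the deviating player. Strict feasibility: for some $\xi>0$ there are policies with occupancy measures $\bar q_1,\bar q_2$ under $P_1,P_2$ such that $\langle\bar q_1,g\rangle+\xi\le b_1$ and $\langle\bar q_2,h\rangle+\xi\le b_2$. **Algorithm** (with parameters $T,V,\eta,\theta,\delta$). Let $\hat q_1^{\,0}(x,a,x')=1/(|X_\ell||A||X_{\ell+1}|)$ on $X_\ell\times A\times X_{\ell+1}$, similarly $\hat q_2^{\,0}$, and $\lambda_1^0=\lambda_2^0=0$. In episode $t=1,\dots,T$ the pair $(\hat q_1^{\,t},\hat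 q_2^{\,t})$ is a minimax (saddle) point over $q_1\in\Delta_1^t$ (min), $q_2\in\Delta_2^t$ (max) of $$V\langle q_1\cdot\hat q_2^{\,t-1}+\hat q_1^{\,t-1}\cdot q_2,r^{t-1}\rangle+\lambda_1^{t-1}\langle q_1,g^{t-1}\rangle-\lambda_2^{t-1}\langle q_2,h^{t-1}\rangle+\eta^{-1}\big(D(q_1\mid\tilde q_1^{\,t-1})-D(q_2\mid\tilde q_2^{\,t-1})\big),$$ where $D$ is the unnormalized Kullback–Leibler divergence $D(u\mid v)=\sum_i u_i\ln(u_i/v_i)-\sum_i(u_i-v_i)$ of the functions $q(x,a)$ on non-terminal state-action pairs, and $\tilde q_1^{\,t-1}(x,a)=(1-\theta)\hat q_1^{\,t-1}(x,a)+\theta/(|X_\ell||A|)$ for $x\in X_\ell$, similarly $\tilde q_2^{\,t-1}$. Then $\lambda_1^t=\max(\lambda_1^{t-1}+\langle\hat q_1^{\,t},g^{t-1}\rangle-b_1,0)$ and $\lambda_2^t=\max(\lambda_2^{t-1}+\langle\hat q_2^{\,t},h^{t-1}\rangle-b_2,0)$. The players execute, independently of each other, the policies $\pi^t(a\mid x)=\hat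 q_1^{\,t}(x,a)/\sum_{a'}\hat q_1^{\,t}(x,a')$ and $\mu^t(b\mid y)=\hat q_2^{\,t}(y,b)/\sum_{b'}\hat q_2^{\,t}(y,b')$ for $L$ steps under $P_1,P_2$, and observe their trajectories and $r^t,g^t,h^t$. Here $\Delta_1^t$ is the set of occupancy measures under all layered transitions $\hat P$ with $\|\hat P(\cdot\mid x,a)-M(x,a,\cdot)/\max(1,N(x,a))\|_1\le\sqrt{2|X_{\ell+1}|\log(T|X||A|/\delta)/\max(1,N(x,a))}$ for all $x\in X_\ell$, $\ell<L$, $a\in A$, where $N(x,a)$ and $M(x,a,x')$ count the visits before the current epoch; a new epoch of a player begins after an episode at whose end the number $n(x,a)$ of visits in the current epoch satisfies $n(x,a)\ge N(x,a)$ for some $(x,a)$ (this condition may be read either for all pairs or only for pairs with $n(x,a)\ge1$; the result holds for both). $\Delta_2^t$ is defined in the same way from $Y,B$. **Theorem 2.** There are a universal integer $k$ and, for each $\xi>0$, a constant $C>0$ that depends only on $\xi$, such that the following holds for every game as above that is strictly feasible with slack $\xi$, every $p\in(0,1)$ and every $T\ge\max(|X||A|,|B||Y|)$. Run the algorithm with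 $V=L\sqrt T$, $\eta=1/(TL)$, $\theta=1/T$ and $\delta=p/(2T)$, and let $q_1^t,q_2^t$ be the occupancy measures of $\pi^t,\mu^t$ under $P_1,P_2$ ($\pi^0,\mu^0$ being the policies of $\hat q_1^{\,0},\hat q_2^{\,0}$). Then, with probability at least $1-p$, the three quantities $$\mathrm{Regret}(T)=\sum_{t=0}^{T-1}\big(\langle q_1^t\cdot q_2^\star,r^t\rangle-\langle q_1^\star\cdot q_2^t,r^t\rangle\big),$$ $$\mathrm{Violation}_1(T)=\Big[\sum_{t=0}^{T-1}(\langle q_1^t,g^t\rangle-b_1)\Big]_+,\qquad \mathrm{Violation}_2(T)=\Big[\sum_{t=0}^{T-1}(\langle q_2^t,h^t\rangle-b_2)\Big]_+$$ are all at most $$C\,\Big(\log\frac{T|X||Y||A||B|}{p}\Big)^{k}\,(|X|+|Y|)\,L\sqrt{T(|A|+|B|)}.$$ -/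

import Mathlib

open MeasureTheory ProbabilityTheory

noncomputable section

namespace ConstrainedMG

/-! ## Layered (loop-free) decision processes and occupancy measures -/

/-- A loop-free layering of the state space: `X = X_0 ∪ ⋯ ∪ X_L` (disjoint), where `X_0` and `X_L`
are singletons.  `layer x` is the index of the layer of `x`. -/
structure Layering (X : Type*) (L : ℕ) where
  layer : X → ℕ
  layer_le : ∀ x, layer x ≤ L
  first : X
  last : X
  layer_eq_zero_iff : ∀ x, layer x = 0 ↔ x = first
  layer_eq_last_iff : ∀ x, layer x = L ↔ x = last

section Player

variable {X A : Type*} [Fintype X] [Fintype A] {L : ℕ}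

/-- The layer `X_ℓ`. -/
def Layering.level (S : Layering X L) (l : ℕ) : Finset X :=
  Finset.univ.filter (fun x => S.layer x = l)

/-- `P` is a loop-free transition: at every non-terminal state `P (· | x, a)` is a probability
distribution, and transitions only lead from a layer to the next one. -/
structure IsTransition (S : Layering X L) (P : X → A → X → ℝ) : Prop where
  nonneg : ∀ x a x', 0 ≤ P x a x'
  sum_eq_one : ∀ x a, S.layer x < L → ∑ x', P x a x' = 1
  loop_free : ∀ x a x', 0 < P x a x' → S.layer x' = S.layer x + 1

/-- `π x a` is the probability of the action `a` in the state `x`. -/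
structure IsPolicy (π : X → A → ℝ) : Prop where
  nonneg : ∀ x a, 0 ≤ π x a
  sum_eq_one : ∀ x, ∑ a, π x a = 1

/-- `q (x, a) = ∑_{x'} q (x, a, x')`. -/
def marg (q : X → A → X → ℝ) (x : X) (a : A) : ℝ := ∑ x', q x a x'

/-- The set `Δ(P)` of valid occupancy measures under the transition `P`.  (If `P` is a transition,
the last condition also forces `q (x, a, x') = 0` unless `x'` is in the layer after that of `x`.) -/
def occSet (S : Layering X L) (P : X → A → X → ℝ) : Set (X → A → X → ℝ) :=
  {q | (∀ x a x', q x a x' ∈ Set.Icc (0 : ℝ) 1) ∧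
    (∀ l, l < L → ∑ x ∈ S.level l, ∑ a, ∑ x' ∈ S.level (l + 1), q x a x' = 1) ∧
    (∀ l, 1 ≤ l → l < L → ∀ x' ∈ S.level l,
      ∑ x ∈ S.level (l - 1), ∑ a, q x a x' = ∑ a, ∑ x'' ∈ S.level (l + 1), q x' a x'') ∧
    (∀ x a x', q x a x' = marg q x a * P x a x')}

open Classical in
/-- The distribution of the state at step `ℓ` when following `π` under `P`. -/
def stateDist (S : Layering X L) (P : X → A → X → ℝ) (π : X → A → ℝ) : ℕ → X → ℝ
  | 0 => fun x => if x = S.first then 1 else 0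
  | l + 1 => fun x' => ∑ x, ∑ a, stateDist S P π l x * π x a * P x a x'

/-- The occupancy measure of the policy `π` under `P`:
`q (x, a, x') = Prob (x_ℓ = x, a_ℓ = a, x_{ℓ+1} = x')`, where `ℓ` is the layer of `x`. -/
def occ (S : Layering X L) (P : X → A → X → ℝ) (π : X → A → ℝ) : X → A → X → ℝ :=
  fun x a x' => stateDist S P π (S.layer x) x * π x a * P x a x'

/-- The expected total utility `⟨q, g⟩`. -/
def utility (S : Layering X L) (q : X → A → X → ℝ) (g : X → A → ℝ) : ℝ :=
  ∑ l ∈ Finset.range L, ∑ x ∈ S.level l, ∑ a, marg q x a * g x a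

/-- The policy proposed by an occupancy measure. -/
def policyOf (q : X → A → X → ℝ) (x : X) (a : A) : ℝ := marg q x a / ∑ a', marg q x a'

/-- The uniform occupancy measure, by which the algorithm is initialized. -/
def uniformOcc (S : Layering X L) : X → A → X → ℝ := fun x _ x' =>
  if S.layer x' = S.layer x + 1 then
    1 / ((S.level (S.layer x)).card * Fintype.card A * (S.level (S.layer x + 1)).card)
  else 0

/-- The mixing `q̃ (x, a) = (1 - θ) q (x, a) + θ / (|X_ℓ| |A|)`, where `ℓ` is the layer of `x`. -/
def mix (S : Layering X L) (θ : ℝ) (q : X → A → X → ℝ) (x : X) (a : A) : ℝ :=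
  (1 - θ) * marg q x a + θ * (1 / ((S.level (S.layer x)).card * Fintype.card A))

/-- The unnormalized Kullback-Leibler divergence on non-terminal state-action pairs. -/
def kl (S : Layering X L) (u v : X → A → ℝ) : ℝ :=
  (∑ l ∈ Finset.range L, ∑ x ∈ S.level l, ∑ a, u x a * Real.log (u x a / v x a)) -
    ∑ l ∈ Finset.range L, ∑ x ∈ S.level l, ∑ a, (u x a - v x a)

/-! ## Trajectories, visitation counters and confidence sets -/

/-- The trajectory `x_0, a_0, x_1, …, a_{L-1}, x_L` of one player in one episode. -/
abbrev Traj (X A : Type*) (L : ℕ) : Type _ := (Fin (L + 1) → X) × (Fin L → A)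

open Classical in
/-- The probability of a trajectory when following `π` under `P` from the initial state. -/
def trajProb (S : Layering X L) (P : X → A → X → ℝ) (π : X → A → ℝ) (τ : Traj X A L) : ℝ :=
  (if τ.1 0 = S.first then 1 else 0) *
    ∏ l : Fin L, π (τ.1 l.castSucc) (τ.2 l) * P (τ.1 l.castSucc) (τ.2 l) (τ.1 l.succ)

open Classical in
/-- The number of visits of a trajectory to `(x, a)`. -/
def visits (τ : Traj X A L) (x : X) (a : A) : ℕ :=
  (Finset.univ.filter (fun l : Fin L => τ.1 l.castSucc = x ∧ τ.2 l = a)).card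

open Classical in
/-- The number of visits of a trajectory to `(x, a, x')`. -/
def visits₃ (τ : Traj X A L) (x : X) (a : A) (x' : X) : ℕ :=
  (Finset.univ.filter
    (fun l : Fin L => τ.1 l.castSucc = x ∧ τ.2 l = a ∧ τ.1 l.succ = x')).card

/-- The counters of a player: `n`, `m` count the visits to `(x, a)` and `(x, a, x')` within the
current epoch, and `N`, `M` those before the current epoch. -/
structure Counters (X A : Type*) where
  n : X → A → ℕ
  m : X → A → X → ℕ
  N : X → A → ℕ
  M : X → A → X → ℕ

open Classical in
/-- The update of the counters at the end of an episode.  A new epoch begins when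
`n (x, a) ≥ max (κ, N (x, a))` for some `(x, a)`.  For `κ = 0` this is the rule
`n (x, a) ≥ N (x, a)`; for `κ = 1` it is the same rule restricted to the pairs that have been
visited in the current epoch. -/
def Counters.step (κ : ℕ) (c : Counters X A) (τ : Traj X A L) : Counters X A :=
  if ∃ x a, max κ (c.N x a) ≤ c.n x a + visits τ x a then
    { n := fun _ _ => 0
      m := fun _ _ _ => 0
      N := fun x a => c.N x a + (c.n x a + visits τ x a)
      M := fun x a x' => c.M x a x' + (c.m x a x' + visits₃ τ x a x') }
  else
    { n := fun x a => c.n x a + visits τ x a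
      m := fun x a x' => c.m x a x' + visits₃ τ x a x'
      N := c.N
      M := c.M }

/-- The counters after the episodes `1, …, t` with the trajectories `τ 1, …, τ t`. -/
def counters (κ : ℕ) (τ : ℕ → Traj X A L) : ℕ → Counters X A
  | 0 => { n := fun _ _ => 0, m := fun _ _ _ => 0, N := fun _ _ => 0, M := fun _ _ _ => 0 }
  | t + 1 => (counters κ τ t).step κ (τ (t + 1))

/-- The empirical transition of the current epoch. -/
def Counters.empirical (c : Counters X A) (x : X) (a : A) (x' : X) : ℝ :=
  (c.M x a x' : ℝ) / max 1 (c.N x a : ℝ)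

/-- The confidence radius `ε (x, a)` of the current epoch. -/
def Counters.radius (S : Layering X L) (T : ℕ) (δ : ℝ) (c : Counters X A) (x : X) (a : A) : ℝ :=
  √(2 * (S.level (S.layer x + 1)).card *
      Real.log (T * Fintype.card A * Fintype.card X / δ) / max 1 (c.N x a : ℝ))

/-- The confidence set of the current epoch: the transitions that are `ε`-close in `ℓ¹` to the
empirical one. -/
def Counters.transitions (S : Layering X L) (T : ℕ) (δ : ℝ) (c : Counters X A) :
    Set (X → A → X → ℝ) :=
  {P | IsTransition S P ∧ ∀ x a, S.layer x < L →
    ∑ x', |P x a x' - c.empirical x a x'| ≤ c.radius S T δ x a}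

/-- The set `Δ(k)` of all occupancy measures under the transitions in the confidence set of the
current epoch. -/
def Counters.domain (S : Layering X L) (T : ℕ) (δ : ℝ) (c : Counters X A) :
    Set (X → A → X → ℝ) :=
  {q | ∃ P ∈ c.transitions S T δ, q ∈ occSet S P}

end Player

/-! ## The constrained Markov game with side constraints -/

variable {X Y A B : Type*} [Fintype X] [Fintype Y] [Fintype A] [Fintype B] {L : ℕ}

/-- The expected total reward `⟨q₁ · q₂, r⟩`. -/
def reward (SX : Layering X L) (SY : Layering Y L) (q₁ : X → A → X → ℝ) (q₂ : Y → B → Y → ℝ)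
    (r : X → Y → A → B → ℝ) : ℝ :=
  ∑ l ∈ Finset.range L, ∑ x ∈ SX.level l, ∑ y ∈ SY.level l, ∑ a, ∑ b,
    marg q₁ x a * marg q₂ y b * r x y a b

/-- An episodic zero-sum Markov game with one side constraint for each player.  The rewards `r t`
are arbitrary (adversarial, chosen obliviously), with the convention that `r 0 = 0`; `g` and `h`
are the mean utility functions and `b₁`, `b₂` the constraint levels. -/
structure Game (X Y A B : Type*) [Fintype X] [Fintype Y] [Fintype A] [Fintype B] (L : ℕ) where
  SX : Layering X L
  SY : Layering Y L
  P₁ : X → A → X → ℝ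
  P₂ : Y → B → Y → ℝ
  isTransition₁ : IsTransition SX P₁
  isTransition₂ : IsTransition SY P₂
  r : ℕ → X → Y → A → B → ℝ
  r_zero : ∀ x y a b, r 0 x y a b = 0
  r_mem : ∀ t x y a b, r t x y a b ∈ Set.Icc (0 : ℝ) 1
  g : X → A → ℝ
  h : Y → B → ℝ
  b₁ : ℝ
  b₂ : ℝ
  b₁_mem : b₁ ∈ Set.Ioc (0 : ℝ) L
  b₂_mem : b₂ ∈ Set.Ioc (0 : ℝ) L

/-- Strict feasibility with slack `ξ`. -/
def Game.StrictlyFeasible (G : Game X Y A B L) (ξ : ℝ) : Prop :=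
  ∃ (π : X → A → ℝ) (ν : Y → B → ℝ), IsPolicy π ∧ IsPolicy ν ∧
    utility G.SX (occ G.SX G.P₁ π) G.g + ξ ≤ G.b₁ ∧
    utility G.SY (occ G.SY G.P₂ ν) G.h + ξ ≤ G.b₂

/-- `∑_{t=0}^{T-1} ⟨q₁ · q₂, r^t⟩`. -/
def Game.totalReward (G : Game X Y A B L) (T : ℕ) (q₁ : X → A → X → ℝ) (q₂ : Y → B → Y → ℝ) : ℝ :=
  ∑ t ∈ Finset.range T, reward G.SX G.SY q₁ q₂ (G.r t)

/-- `(q₁, q₂)` is a Nash equilibrium in hindsight of the game with side constraints. -/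
structure Game.IsNash (G : Game X Y A B L) (T : ℕ) (q₁ : X → A → X → ℝ)
    (q₂ : Y → B → Y → ℝ) : Prop where
  mem₁ : q₁ ∈ occSet G.SX G.P₁
  mem₂ : q₂ ∈ occSet G.SY G.P₂
  feasible₁ : utility G.SX q₁ G.g ≤ G.b₁
  feasible₂ : utility G.SY q₂ G.h ≤ G.b₂
  min_player : ∀ q ∈ occSet G.SX G.P₁, utility G.SX q G.g ≤ G.b₁ →
    G.totalReward T q₁ q₂ ≤ G.totalReward T q q₂
  max_player : ∀ q ∈ occSet G.SY G.P₂, utility G.SY q G.h ≤ G.b₂ →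
    G.totalReward T q₁ q ≤ G.totalReward T q₁ q₂

/-! ## The algorithm -/

/-- The objective of the primal update, to be minimized over `q₁` and maximized over `q₂`.  Here
`p₁`, `p₂` are the previous iterates, `l₁`, `l₂` the previous dual variables, and `r`, `g`, `h` the
functions revealed in the previous episode. -/
def primalObjective (SX : Layering X L) (SY : Layering Y L) (V η θ : ℝ)
    (p₁ : X → A → X → ℝ) (p₂ : Y → B → Y → ℝ) (l₁ l₂ : ℝ)
    (r : X → Y → A → B → ℝ) (g : X → A → ℝ) (h : Y → B → ℝ)
    (q₁ : X → A → X → ℝ) (q₂ : Y → B → Y → ℝ) : ℝ :=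
  V * (reward SX SY q₁ p₂ r + reward SX SY p₁ q₂ r) +
    l₁ * utility SX q₁ g - l₂ * utility SY q₂ h +
    η⁻¹ * (kl SX (marg q₁) (mix SX θ p₁) - kl SY (marg q₂) (mix SY θ p₂))

/-- The information generated by the episodes `1, …, t`: the trajectories of both players and the
revealed utility functions. -/
@[reducible] def history {Ω : Type*} (τ₁ : ℕ → Ω → Traj X A L) (τ₂ : ℕ → Ω → Traj Y B L)
    (g : ℕ → Ω → X → A → ℝ) (h : ℕ → Ω → Y → B → ℝ) (t : ℕ) : MeasurableSpace Ω :=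
  ⨆ s ∈ Finset.Icc 1 t,
    MeasurableSpace.comap (τ₁ s) ⊤ ⊔ MeasurableSpace.comap (τ₂ s) ⊤ ⊔
      MeasurableSpace.comap (g s) inferInstance ⊔ MeasurableSpace.comap (h s) inferInstance

/-- A run of the UCB-CSAPO algorithm with separate dual variables, for `T` episodes, on the
probability space `(Ω, μ)`. -/
structure Run (G : Game X Y A B L) (T κ : ℕ) (V η θ δ : ℝ)
    {Ω : Type*} [MeasurableSpace Ω] (μ : Measure Ω) where
  /-- The utility functions `g^t`, `h^t` of the environment. -/
  g : ℕ → Ω → X → A → ℝ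
  h : ℕ → Ω → Y → B → ℝ
  /-- The trajectories of the two players in episode `t`. -/
  τ₁ : ℕ → Ω → Traj X A L
  τ₂ : ℕ → Ω → Traj Y B L
  /-- The primal iterates. -/
  q₁ : ℕ → Ω → X → A → X → ℝ
  q₂ : ℕ → Ω → Y → B → Y → ℝ
  /-- The dual iterates. -/
  l₁ : ℕ → Ω → ℝ
  l₂ : ℕ → Ω → ℝ
  -- the utility functions: stochastic with means `G.g`, `G.h`, and zero by convention at time `0`
  g_measurable : ∀ t, Measurable (g t)
  h_measurable : ∀ t, Measurable (h t)
  g_mem : ∀ t ω x a, g t ω x a ∈ Set.Icc (0 : ℝ) 1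
  h_mem : ∀ t ω y b, h t ω y b ∈ Set.Icc (0 : ℝ) 1
  g_zero : ∀ ω x a, g 0 ω x a = 0
  h_zero : ∀ ω y b, h 0 ω y b = 0
  g_mean : ∀ t, 1 ≤ t → t ≤ T → ∀ x a, ∫ ω, g t ω x a ∂μ = G.g x a
  h_mean : ∀ t, 1 ≤ t → t ≤ T → ∀ y b, ∫ ω, h t ω y b ∂μ = G.h y b
  -- the utilities of an episode are independent of the past and of the moves in this episode
  utility_indep : ∀ t, t < T →
    Indep (MeasurableSpace.comap (g (t + 1)) inferInstance ⊔
        MeasurableSpace.comap (h (t + 1)) inferInstance)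
      (history τ₁ τ₂ g h t ⊔ MeasurableSpace.comap (τ₁ (t + 1)) ⊤ ⊔
        MeasurableSpace.comap (τ₂ (t + 1)) ⊤) μ
  -- in episode `t + 1`, given the past, the players execute their current policies under the true
  -- transitions, independently of each other
  τ₁_measurable : ∀ t τ, MeasurableSet {ω | τ₁ t ω = τ}
  τ₂_measurable : ∀ t τ, MeasurableSet {ω | τ₂ t ω = τ}
  trajectory_law : ∀ t, t < T → ∀ (σ₁ : Traj X A L) (σ₂ : Traj Y B L),
    μ[Set.indicator {ω | τ₁ (t + 1) ω = σ₁ ∧ τ₂ (t + 1) ω = σ₂} (fun _ => (1 : ℝ)) |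
        history τ₁ τ₂ g h t] =ᵐ[μ]
      fun ω => trajProb G.SX G.P₁ (policyOf (q₁ (t + 1) ω)) σ₁ *
        trajProb G.SY G.P₂ (policyOf (q₂ (t + 1) ω)) σ₂
  -- initialization
  q₁_zero : ∀ ω, q₁ 0 ω = uniformOcc G.SX
  q₂_zero : ∀ ω, q₂ 0 ω = uniformOcc G.SY
  l₁_zero : ∀ ω, l₁ 0 ω = 0
  l₂_zero : ∀ ω, l₂ 0 ω = 0
  -- primal update: a saddle point over the current confidence domains, computed from the past
  q₁_adapted : ∀ t, t < T → Measurable[history τ₁ τ₂ g h t] (q₁ (t + 1))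
  q₂_adapted : ∀ t, t < T → Measurable[history τ₁ τ₂ g h t] (q₂ (t + 1))
  q₁_mem : ∀ t, t < T → ∀ᵐ ω ∂μ,
    q₁ (t + 1) ω ∈ (counters κ (fun s => τ₁ s ω) t).domain G.SX T δ
  q₂_mem : ∀ t, t < T → ∀ᵐ ω ∂μ,
    q₂ (t + 1) ω ∈ (counters κ (fun s => τ₂ s ω) t).domain G.SY T δ
  primal : ∀ t, t < T → ∀ᵐ ω ∂μ,
    IsSaddlePointOn ((counters κ (fun s => τ₁ s ω) t).domain G.SX T δ)
      ((counters κ (fun s => τ₂ s ω) t).domain G.SY T δ)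
      (primalObjective G.SX G.SY V η θ (q₁ t ω) (q₂ t ω) (l₁ t ω) (l₂ t ω)
        (G.r t) (g t ω) (h t ω))
      (q₁ (t + 1) ω) (q₂ (t + 1) ω)
  -- dual update
  dual₁ : ∀ t, t < T → ∀ ω,
    l₁ (t + 1) ω = max (l₁ t ω + (utility G.SX (q₁ (t + 1) ω) (g t ω) - G.b₁)) 0
  dual₂ : ∀ t, t < T → ∀ ω,
    l₂ (t + 1) ω = max (l₂ t ω + (utility G.SY (q₂ (t + 1) ω) (h t ω) - G.b₂)) 0

section Run

variable {G : Game X Y A B L} {T κ : ℕ} {V η θ δ : ℝ} {Ω : Type*} [MeasurableSpace Ω]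
  {μ : Measure Ω}

/-- The occupancy measure of the min-policy of episode `t` under the true transition. -/
def Run.trueOcc₁ (R : Run G T κ V η θ δ μ) (t : ℕ) (ω : Ω) : X → A → X → ℝ :=
  occ G.SX G.P₁ (policyOf (R.q₁ t ω))

/-- The occupancy measure of the max-policy of episode `t` under the true transition. -/
def Run.trueOcc₂ (R : Run G T κ V η θ δ μ) (t : ℕ) (ω : Ω) : Y → B → Y → ℝ :=
  occ G.SY G.P₂ (policyOf (R.q₂ t ω))

/-- The regret with respect to `(q₁, q₂)`. -/
def Run.regret (R : Run G T κ V η θ δ μ) (q₁ : X → A → X → ℝ) (q₂ : Y → B → Y → ℝ) (ω : Ω) : ℝ :=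
  ∑ t ∈ Finset.range T,
    (reward G.SX G.SY (R.trueOcc₁ t ω) q₂ (G.r t) - reward G.SX G.SY q₁ (R.trueOcc₂ t ω) (G.r t))

/-- The constraint violation of the min-player. -/
def Run.violation₁ (R : Run G T κ V η θ δ μ) (ω : Ω) : ℝ :=
  max (∑ t ∈ Finset.range T, (utility G.SX (R.trueOcc₁ t ω) (R.g t ω) - G.b₁)) 0

/-- The constraint violation of the max-player. -/
def Run.violation₂ (R : Run G T κ V η θ δ μ) (ω : Ω) : ℝ :=
  max (∑ t ∈ Finset.range T, (utility G.SY (R.trueOcc₂ t ω) (R.h t ω) - G.b₂)) 0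

end Run

end ConstrainedMG

end

open ConstrainedMG

/-!
The game separates. At a saddle point of the primal objective each iterate minimizes its own part,
and the opponent enters that part only through the reward averaged over the opponent's previous
occupancy measure. So each player runs online mirror descent with a dual variable against losses in
`[-1, 1]` that may depend on the past (`PlayerPath` for one realization, `PlayerRun` for the random
run), and it is enough to bound regret, violation and estimation error of one such player. The Nash
pair serves only as a pair of feasible comparators; the regret of the game is at most the sum of the
two players' regrets and of the errors `‖q^t - q̂^t‖₁` (`Run.regret_le`).

*Primal step.* The confidence domains are convex (`Counters.domain_convex`), and comparing the
minimizer with its mixture with the comparator gives the three-point inequality without derivatives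
(`mirror_step`). The mixing with the uniform distribution keeps the relative entropies below `L J`,
where `J` is the logarithmic factor.

*Dual variable.* Strict feasibility gives `λ² / 2` a drift of `-ξ λ` per episode. The noise
`λ (⟨q̄, g^t⟩ - ⟨q̄, g⟩)`, truncated at the threshold `Λ` of order `(1 + 1/ξ) L² √T J`, is controlled
on all windows of episodes at once by the inequality of Azuma; a linear term `ξ Λ / 4` per episode is
affordable there, as the drift absorbs it. Hence `λ` never exceeds `Λ` (`PlayerPath.lam_le`), which
bounds the violation of the iterates and, together with the potential of the fixed comparator, the
regret of `q̂^{t+1}` on the functions of episode `t` (`PlayerPath.regret_succ_le`).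

*Stability.* Passing from `q̂^{t+1}` to `q̂^t` costs `∑ ‖q̂^{t+1} - q̂^t‖₁`. The domains change with the
epochs, but each transition of the old confidence set can be moved into the new one at a cost equal
to the relative growth of the counters, and these costs have a logarithmic sum; a Pinsker inequality
and Cauchy-Schwarz then give a square root (`PlayerPath.sum_occDist_succ_le`). This does not use that
epochs are rare, so that both readings of the epoch condition are covered.

*Estimation.* The true transition stays in all confidence sets with high probability
(`PlayerRun.exists_confidence_event`), by an exponential supermartingale for each sign vector on the
next layer. The `ℓ¹` error of the executed policy is at most `L` times the confidence radii at the
visited pairs, up to a martingale, and the radii add up to order `|X| √(T |A|)`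
(`PlayerPath.sum_occDist_occ_le`).
-/

namespace ConstrainedMG

set_option linter.unusedSectionVars false

/-! ### Relative entropy of finite sums -/

/-- The unnormalized relative entropy `∑ u log (u / v) - ∑ (u - v)` over a finite index set. -/
noncomputable def relEnt {ι : Type*} (s : Finset ι) (u v : ι → ℝ) : ℝ :=
  ∑ i ∈ s, u i * Real.log (u i / v i) - ∑ i ∈ s, (u i - v i)

section RelEnt

variable {ι : Type*} {s : Finset ι}

/-- One term of the relative entropy dominates the squared Hellinger distance. -/
lemma sq_sqrt_sub_sqrt_le {u v : ℝ} (hu : 0 ≤ u) (hv : 0 ≤ v) (huv : v = 0 → u = 0) :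
    (√u - √v) ^ 2 ≤ u * Real.log (u / v) - (u - v) := by
  rcases hu.eq_or_lt with rfl | hu'
  · simp [Real.sq_sqrt hv]
  have hv' : 0 < v := lt_of_le_of_ne hv fun h => hu'.ne' (huv h.symm)
  have hsu := Real.sqrt_pos.2 hu'
  have hsv := Real.sqrt_pos.2 hv'
  have h1 : Real.log (u / v) = -(2 * Real.log (√v / √u)) := by
    rw [Real.log_div hu'.ne' hv'.ne', Real.log_div hsv.ne' hsu.ne', Real.log_sqrt hu, Real.log_sqrt hv]
    ring
  have h2 : Real.log (√v / √u) ≤ √v / √u - 1 := Real.log_le_sub_one_of_pos (by positivity)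
  have h3 : u * (√v / √u) = √u * √v := by
    nth_rewrite 1 [← Real.mul_self_sqrt hu]; field_simp
  have h4 : u * Real.log (√v / √u) ≤ √u * √v - u := by
    calc _ ≤ u * (√v / √u - 1) := by gcongr
      _ = _ := by rw [mul_sub, h3, mul_one]
  rw [h1]
  nlinarith [Real.sq_sqrt hu, Real.sq_sqrt hv]

/-- A Pinsker-type inequality for unnormalized measures. -/
lemma sq_sum_abs_sub_le_relEnt {u v : ι → ℝ} (hu : ∀ i ∈ s, 0 ≤ u i) (hv : ∀ i ∈ s, 0 ≤ v i)
    (huv : ∀ i ∈ s, v i = 0 → u i = 0) :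
    (∑ i ∈ s, |u i - v i|) ^ 2 ≤ 2 * (∑ i ∈ s, (u i + v i)) * relEnt s u v := by
  have h1 : ∀ i ∈ s, |u i - v i| = |√(u i) - √(v i)| * (√(u i) + √(v i)) := fun i hi => by
    rw [← abs_of_nonneg (a := √(u i) + √(v i)) (by positivity), ← abs_mul]
    congr 1
    nlinarith [Real.sq_sqrt (hu i hi), Real.sq_sqrt (hv i hi)]
  rw [Finset.sum_congr rfl h1]
  have h2 := Finset.sum_mul_sq_le_sq_mul_sq s (fun i => |√(u i) - √(v i)|)
    (fun i => √(u i) + √(v i))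
  have h3 : ∑ i ∈ s, |√(u i) - √(v i)| ^ 2 ≤ relEnt s u v := by
    rw [relEnt, ← Finset.sum_sub_distrib]
    refine Finset.sum_le_sum fun i hi => ?_
    rw [sq_abs]
    exact sq_sqrt_sub_sqrt_le (hu i hi) (hv i hi) (huv i hi)
  have h4 : ∑ i ∈ s, (√(u i) + √(v i)) ^ 2 ≤ 2 * ∑ i ∈ s, (u i + v i) := by
    rw [Finset.mul_sum]
    refine Finset.sum_le_sum fun i hi => ?_
    nlinarith [Real.sq_sqrt (hu i hi), Real.sq_sqrt (hv i hi), sq_nonneg (√(u i) - √(v i))]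
  have h5 : 0 ≤ ∑ i ∈ s, |√(u i) - √(v i)| ^ 2 := Finset.sum_nonneg fun i _ => by positivity
  have h6 : 0 ≤ ∑ i ∈ s, (√(u i) + √(v i)) ^ 2 := Finset.sum_nonneg fun i _ => by positivity
  calc _ ≤ _ := h2
    _ ≤ relEnt s u v * (2 * ∑ i ∈ s, (u i + v i)) := mul_le_mul h3 h4 h6 (h5.trans h3)
    _ = _ := by ring

lemma relEnt_nonneg {u v : ι → ℝ} (hu : ∀ i ∈ s, 0 ≤ u i) (hv : ∀ i ∈ s, 0 ≤ v i)
    (huv : ∀ i ∈ s, v i = 0 → u i = 0) : 0 ≤ relEnt s u v := by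
  rw [relEnt, ← Finset.sum_sub_distrib]
  exact Finset.sum_nonneg fun i hi =>
    (sq_nonneg _).trans (sq_sqrt_sub_sqrt_le (hu i hi) (hv i hi) (huv i hi))

lemma mul_log_div_eq {w v z : ℝ} (hz : w ≠ 0 → z ≠ 0) (hv : v ≠ 0) :
    w * Real.log (w / v) = w * Real.log (w / z) + w * Real.log (z / v) := by
  by_cases hw : w = 0
  · simp [hw]
  · rw [Real.log_div hw hv, Real.log_div hw (hz hw), Real.log_div (hz hw) hv]; ring

/-- The compensation identity: the entropy of a mixture is the mixture of the entropies, minus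
the entropies relative to the mixture. -/
lemma relEnt_mixture {w q v : ι → ℝ} {a : ℝ} (ha : 0 < a) (ha' : a < 1)
    (hw : ∀ i ∈ s, 0 ≤ w i) (hq : ∀ i ∈ s, 0 ≤ q i) (hv : ∀ i ∈ s, 0 < v i) :
    relEnt s (fun i => (1 - a) * w i + a * q i) v =
      (1 - a) * (relEnt s w v - relEnt s w (fun i => (1 - a) * w i + a * q i)) +
      a * (relEnt s q v - relEnt s q (fun i => (1 - a) * w i + a * q i)) := by
  simp only [relEnt, ← Finset.sum_sub_distrib, Finset.mul_sum, ← Finset.sum_add_distrib]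
  refine Finset.sum_congr rfl fun i hi => ?_
  have h1 : 0 < 1 - a := by linarith
  have hz : w i ≠ 0 → (1 - a) * w i + a * q i ≠ 0 := fun h => by
    have := lt_of_le_of_ne (hw i hi) (Ne.symm h)
    have := hq i hi
    positivity
  have hz' : q i ≠ 0 → (1 - a) * w i + a * q i ≠ 0 := fun h => by
    have := lt_of_le_of_ne (hq i hi) (Ne.symm h)
    have := hw i hi
    positivity
  rw [mul_log_div_eq hz (hv i hi).ne', mul_log_div_eq hz' (hv i hi).ne']
  ring

/-- The three-point inequality of mirror descent: if `w` is no worse than its mixture `z` with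
`q`, then the linear cost of `w` exceeds that of `q` by at most a difference of entropies.  Using
the mixture `z` in place of `w` in the last entropy avoids differentiating at the minimizer. -/
lemma mirror_step {w q v l : ι → ℝ} {a e : ℝ} (ha : 0 < a) (ha' : a < 1) (he : 0 < e)
    (hw : ∀ i ∈ s, 0 ≤ w i) (hq : ∀ i ∈ s, 0 ≤ q i) (hv : ∀ i ∈ s, 0 < v i)
    (hmin : ∑ i ∈ s, l i * w i + e * relEnt s w v ≤
      ∑ i ∈ s, l i * ((1 - a) * w i + a * q i) +
        e * relEnt s (fun i => (1 - a) * w i + a * q i) v) :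
    ∑ i ∈ s, l i * (w i - q i) ≤
      e * (relEnt s q v - relEnt s w v - relEnt s q (fun i => (1 - a) * w i + a * q i)) := by
  rw [relEnt_mixture ha ha' hw hq hv] at hmin
  have h0 : 0 ≤ relEnt s w (fun i => (1 - a) * w i + a * q i) := by
    refine relEnt_nonneg hw (fun i hi => ?_) (fun i hi h => ?_)
    · have := hw i hi; have := hq i hi; have : 0 < 1 - a := by linarith
      positivity
    · have h1 := hw i hi; have h2 := hq i hi
      nlinarith [mul_nonneg ha.le h2]
  have h1 : ∑ i ∈ s, l i * ((1 - a) * w i + a * q i) =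
      ∑ i ∈ s, l i * w i - a * ∑ i ∈ s, l i * (w i - q i) := by
    rw [Finset.mul_sum, ← Finset.sum_sub_distrib]
    exact Finset.sum_congr rfl fun i _ => by ring
  rw [h1] at hmin
  have h2 : 0 ≤ e * ((1 - a) * relEnt s w (fun i => (1 - a) * w i + a * q i)) :=
    mul_nonneg he.le (mul_nonneg (by linarith) h0)
  have h3 : a * ∑ i ∈ s, l i * (w i - q i) ≤
      a * (e * (relEnt s q v - relEnt s w v - relEnt s q (fun i => (1 - a) * w i + a * q i))) := by
    nlinarith
  exact le_of_mul_le_mul_left h3 ha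

/-- Replacing the second argument by a larger multiple changes the entropy by little. -/
lemma relEnt_le_of_le_mul {q z v : ι → ℝ} {c : ℝ} (hq : ∀ i ∈ s, 0 ≤ q i)
    (hz : ∀ i ∈ s, q i ≠ 0 → 0 < z i) (hv : ∀ i ∈ s, 0 < v i)
    (hzv : ∀ i ∈ s, z i ≤ (1 + c) * v i) (hsum : ∑ i ∈ s, z i = ∑ i ∈ s, v i) :
    relEnt s q v ≤ relEnt s q z + c * ∑ i ∈ s, q i := by
  have h1 : ∀ i ∈ s, q i * Real.log (q i / v i) ≤ q i * Real.log (q i / z i) + c * q i :=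
      fun i hi => by
    rw [mul_log_div_eq (fun h => (hz i hi h).ne') (hv i hi).ne']
    by_cases h : q i = 0
    · simp [h]
    have hzi := hz i hi h
    have h2 : Real.log (z i / v i) ≤ c := by
      have h3 := Real.log_le_sub_one_of_pos (div_pos hzi (hv i hi))
      have h4 : z i / v i ≤ 1 + c := by rw [div_le_iff₀ (hv i hi)]; exact hzv i hi
      linarith
    have := mul_le_mul_of_nonneg_left h2 (hq i hi)
    linarith
  have h2 := Finset.sum_le_sum h1
  rw [Finset.sum_add_distrib, ← Finset.mul_sum] at h2
  simp only [relEnt, Finset.sum_sub_distrib]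
  linarith

lemma relEnt_le_mass {q v : ι → ℝ} {K m : ℝ} (hq : ∀ i ∈ s, 0 ≤ q i)
    (hv : ∀ i ∈ s, 0 < v i) (hle : ∀ i ∈ s, q i ≤ Real.exp K * v i)
    (hsum : ∑ i ∈ s, q i = m) (hsum' : ∑ i ∈ s, v i = m) :
    relEnt s q v ≤ m * K := by
  have h1 : ∀ i ∈ s, q i * Real.log (q i / v i) ≤ q i * K := fun i hi => by
    by_cases h : q i = 0
    · simp [h]
    have hqi := lt_of_le_of_ne (hq i hi) (Ne.symm h)
    refine mul_le_mul_of_nonneg_left ?_ hqi.le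
    rw [Real.log_le_iff_le_exp (div_pos hqi (hv i hi)), div_le_iff₀ (hv i hi)]
    exact hle i hi
  have h2 := Finset.sum_le_sum h1
  rw [← Finset.sum_mul, hsum] at h2
  simp only [relEnt, Finset.sum_sub_distrib, hsum, hsum']
  linarith

/-- If `q ≤ e ^ K v`, the relative entropy is at most linear in the `ℓ¹` distance. -/
lemma relEnt_le_dist {q v : ι → ℝ} {K : ℝ} (hK : 0 ≤ K) (hq : ∀ i ∈ s, 0 ≤ q i)
    (hv : ∀ i ∈ s, 0 < v i) (hle : ∀ i ∈ s, q i ≤ Real.exp K * v i) :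
    relEnt s q v ≤ (K + 2) * ∑ i ∈ s, |q i - v i| := by
  rw [relEnt, ← Finset.sum_sub_distrib, Finset.mul_sum]
  refine Finset.sum_le_sum fun i hi => ?_
  have hvi := hv i hi
  have habs := abs_nonneg (q i - v i)
  rcases le_or_gt (q i) (v i) with h | h
  · have h1 : q i * Real.log (q i / v i) ≤ 0 := by
      refine mul_nonpos_of_nonneg_of_nonpos (hq i hi) (Real.log_nonpos ?_ ?_)
      · exact div_nonneg (hq i hi) hvi.le
      · rw [div_le_one hvi]; exact h
    have := neg_abs_le (q i - v i)
    nlinarith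
  · have hqi : 0 < q i := hvi.trans h
    have h1 : Real.log (q i / v i) ≤ K := by
      rw [Real.log_le_iff_le_exp (div_pos hqi hvi), div_le_iff₀ hvi]
      exact hle i hi
    have h2 : v i * Real.log (q i / v i) ≤ q i - v i := by
      have h3 := Real.log_le_sub_one_of_pos (div_pos hqi hvi)
      calc _ ≤ v i * (q i / v i - 1) := by gcongr
        _ = _ := by field_simp
    rw [abs_of_pos (sub_pos.2 h)]
    have h3 := mul_le_mul_of_nonneg_left h1 (sub_pos.2 h).le
    nlinarith

end RelEnt

/-! ### Layers and occupancy measures -/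

section Layers

variable {X A : Type*} [Fintype X] [Fintype A] {L : ℕ}

/-- The non-terminal state-action pairs. -/
def pairs (S : Layering X L) (A : Type*) [Fintype A] : Finset (X × A) :=
  Finset.univ.filter (fun i => S.layer i.1 < L)

lemma mem_pairs {S : Layering X L} {i : X × A} : i ∈ pairs S A ↔ S.layer i.1 < L := by
  simp [pairs]

lemma mem_level {S : Layering X L} {l : ℕ} {x : X} : x ∈ S.level l ↔ S.layer x = l := by
  simp [Layering.level]

lemma sum_level_eq {M : Type*} [AddCommMonoid M] (S : Layering X L) (f : X → M) :
    ∑ l ∈ Finset.range L, ∑ x ∈ S.level l, f x =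
      ∑ x ∈ Finset.univ.filter (fun x => S.layer x < L), f x := by
  classical
  rw [← Finset.sum_fiberwise_of_maps_to (s := Finset.univ.filter (fun x => S.layer x < L))
    (t := Finset.range L) (g := S.layer) (fun x hx => by simpa using hx)]
  refine Finset.sum_congr rfl fun l hl => Finset.sum_congr ?_ fun _ _ => rfl
  ext x
  have := Finset.mem_range.1 hl
  simp only [mem_level, Finset.mem_filter, Finset.mem_univ, true_and]
  constructor
  · rintro rfl; exact ⟨this, rfl⟩
  · exact fun h => h.2

lemma sum_levels_eq (S : Layering X L) (f : X → A → ℝ) :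
    ∑ l ∈ Finset.range L, ∑ x ∈ S.level l, ∑ a, f x a = ∑ i ∈ pairs S A, f i.1 i.2 := by
  rw [sum_level_eq]
  have : pairs S A = (Finset.univ.filter (fun x => S.layer x < L)) ×ˢ Finset.univ := by
    ext i; simp [pairs]
  rw [this, Finset.sum_product]

lemma utility_eq (S : Layering X L) (q : X → A → X → ℝ) (g : X → A → ℝ) :
    utility S q g = ∑ i ∈ pairs S A, marg q i.1 i.2 * g i.1 i.2 :=
  sum_levels_eq S fun x a => marg q x a * g x a

lemma kl_eq (S : Layering X L) (u v : X → A → ℝ) :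
    kl S u v = relEnt (pairs S A) (fun i => u i.1 i.2) (fun i => v i.1 i.2) := by
  rw [kl, sum_levels_eq S fun x a => u x a * Real.log (u x a / v x a),
    sum_levels_eq S fun x a => u x a - v x a, relEnt]

/-- The `ℓ¹` distance of the state-action marginals over the non-terminal pairs. -/
noncomputable def occDist (S : Layering X L) (q q' : X → A → X → ℝ) : ℝ :=
  ∑ i ∈ pairs S A, |marg q i.1 i.2 - marg q' i.1 i.2|

lemma occDist_nonneg (S : Layering X L) (q q' : X → A → X → ℝ) : 0 ≤ occDist S q q' :=
  Finset.sum_nonneg fun _ _ => abs_nonneg _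

lemma occDist_comm (S : Layering X L) (q q' : X → A → X → ℝ) :
    occDist S q q' = occDist S q' q := by
  simp only [occDist, abs_sub_comm]

lemma occDist_triangle (S : Layering X L) (q q' q'' : X → A → X → ℝ) :
    occDist S q q'' ≤ occDist S q q' + occDist S q' q'' := by
  rw [occDist, occDist, occDist, ← Finset.sum_add_distrib]
  exact Finset.sum_le_sum fun i _ => abs_sub_le _ _ _

/-- Utilities of functions bounded by one are Lipschitz in the occupancy measure. -/
lemma utility_sub_le_occDist (S : Layering X L) (q q' : X → A → X → ℝ) {g : X → A → ℝ}
    (hg : ∀ x a, |g x a| ≤ 1) : utility S q g - utility S q' g ≤ occDist S q q' := by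
  rw [utility_eq, utility_eq, occDist, ← Finset.sum_sub_distrib]
  refine Finset.sum_le_sum fun i _ => ?_
  rw [← sub_mul]
  calc _ ≤ |(marg q i.1 i.2 - marg q' i.1 i.2) * g i.1 i.2| := le_abs_self _
    _ = |marg q i.1 i.2 - marg q' i.1 i.2| * |g i.1 i.2| := abs_mul _ _
    _ ≤ _ := mul_le_of_le_one_right (abs_nonneg _) (hg _ _)

lemma IsTransition.eq_zero {S : Layering X L} {P : X → A → X → ℝ} (hP : IsTransition S P)
    {x : X} {a : A} {x' : X} (h : S.layer x' ≠ S.layer x + 1) : P x a x' = 0 := by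
  by_contra h0
  exact h (hP.loop_free x a x' (lt_of_le_of_ne (hP.nonneg x a x') (Ne.symm h0)))

lemma IsTransition.sum_level {S : Layering X L} {P : X → A → X → ℝ} (hP : IsTransition S P)
    (x : X) (a : A) (f : X → ℝ) :
    ∑ x' ∈ S.level (S.layer x + 1), P x a x' * f x' = ∑ x', P x a x' * f x' := by
  refine Finset.sum_subset (Finset.subset_univ _) fun x' _ hx' => ?_
  rw [hP.eq_zero (fun h => hx' (mem_level.2 h)), zero_mul]

lemma IsTransition.sum_le_one {S : Layering X L} {P : X → A → X → ℝ} (hP : IsTransition S P)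
    (x : X) (a : A) : ∑ x', P x a x' ≤ 1 := by
  by_cases h : S.layer x < L
  · exact (hP.sum_eq_one x a h).le
  · rw [Finset.sum_eq_zero fun x' _ => hP.eq_zero (fun h' => ?_)]
    · exact zero_le_one
    · have := S.layer_le x'; omega

lemma IsTransition.le_one {S : Layering X L} {P : X → A → X → ℝ} (hP : IsTransition S P)
    (x : X) (a : A) (x' : X) : P x a x' ≤ 1 :=
  (Finset.single_le_sum (fun x' _ => hP.nonneg x a x') (Finset.mem_univ x')).trans
    (hP.sum_le_one x a)

/-- The state-action marginals of an occupancy measure: nonnegative, with mass one on each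
non-terminal layer. -/
structure IsMarg (S : Layering X L) (q : X → A → X → ℝ) : Prop where
  nonneg : ∀ x a, 0 ≤ marg q x a
  level : ∀ l, l < L → ∑ x ∈ S.level l, ∑ a, marg q x a = 1

variable {S : Layering X L} {P : X → A → X → ℝ} {q : X → A → X → ℝ}

lemma sum_level_occ (hP : IsTransition S P) (hq : q ∈ occSet S P) (x : X) (a : A) :
    ∑ x' ∈ S.level (S.layer x + 1), q x a x' = marg q x a := by
  refine Finset.sum_subset (Finset.subset_univ _) fun x' _ hx' => ?_
  rw [hq.2.2.2, hP.eq_zero (fun h => hx' (mem_level.2 h)), mul_zero]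

lemma isMarg_of_mem_occSet (hP : IsTransition S P) (hq : q ∈ occSet S P) : IsMarg S q where
  nonneg x a := Finset.sum_nonneg fun x' _ => (hq.1 x a x').1
  level l hl := by
    rw [← hq.2.1 l hl]
    refine Finset.sum_congr rfl fun x hx => Finset.sum_congr rfl fun a _ => ?_
    rw [← mem_level.1 hx, sum_level_occ hP hq]

lemma IsMarg.le_one (hq : IsMarg S q) {x : X} (a : A) (hx : S.layer x < L) :
    marg q x a ≤ 1 := by
  rw [← hq.level _ hx]
  refine (Finset.single_le_sum (f := fun a => marg q x a) (fun a _ => hq.nonneg x a)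
    (Finset.mem_univ a)).trans ?_
  exact Finset.single_le_sum (f := fun x => ∑ a, marg q x a)
    (fun x _ => Finset.sum_nonneg fun a _ => hq.nonneg x a) (mem_level.2 rfl)

lemma IsMarg.sum_pairs (hq : IsMarg S q) : ∑ i ∈ pairs S A, marg q i.1 i.2 = L := by
  rw [← sum_levels_eq S fun x a => marg q x a,
    Finset.sum_congr rfl fun l hl => hq.level l (Finset.mem_range.1 hl)]
  simp

lemma IsMarg.level_nonempty (hq : IsMarg S q) {l : ℕ} (hl : l ≤ L) : (S.level l).Nonempty := by
  rcases hl.lt_or_eq with h | rfl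
  · by_contra h0
    have := hq.level l h
    rw [Finset.not_nonempty_iff_eq_empty.1 h0] at this
    simp at this
  · exact ⟨S.last, mem_level.2 ((S.layer_eq_last_iff _).2 rfl)⟩

lemma IsMarg.nonempty_action (hq : IsMarg S q) (hL : 0 < L) : Nonempty A := by
  by_contra h0
  have := hq.level 0 hL
  rw [not_nonempty_iff] at h0
  simp at this

/-- The layers are disjoint and nonempty, so there are at least `L + 1` states. -/
lemma IsMarg.succ_le_card (hq : IsMarg S q) : L + 1 ≤ Fintype.card X := by
  classical
  have h : Finset.range (L + 1) ⊆ Finset.univ.image S.layer := fun l hl => by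
    obtain ⟨x, hx⟩ := hq.level_nonempty (Nat.lt_succ_iff.1 (Finset.mem_range.1 hl))
    exact Finset.mem_image.2 ⟨x, Finset.mem_univ _, mem_level.1 hx⟩
  calc L + 1 = (Finset.range (L + 1)).card := by simp
    _ ≤ _ := Finset.card_le_card h
    _ ≤ _ := Finset.card_image_le

lemma IsMarg.occDist_le {q' : X → A → X → ℝ} (hq : IsMarg S q) (hq' : IsMarg S q') :
    occDist S q q' ≤ 2 * L := by
  calc occDist S q q' ≤ ∑ i ∈ pairs S A, (marg q i.1 i.2 + marg q' i.1 i.2) := by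
        refine Finset.sum_le_sum fun i _ => ?_
        have h1 := hq.nonneg i.1 i.2
        have h2 := hq'.nonneg i.1 i.2
        rw [abs_le]; constructor <;> linarith
    _ = _ := by rw [Finset.sum_add_distrib, hq.sum_pairs, hq'.sum_pairs]; ring

lemma IsMarg.utility_nonneg (hq : IsMarg S q) {g : X → A → ℝ} (hg : ∀ x a, 0 ≤ g x a) :
    0 ≤ utility S q g := by
  rw [utility_eq]
  exact Finset.sum_nonneg fun i _ => mul_nonneg (hq.nonneg _ _) (hg _ _)

lemma IsMarg.utility_le (hq : IsMarg S q) {g : X → A → ℝ} (hg : ∀ x a, g x a ≤ 1) :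
    utility S q g ≤ L := by
  rw [utility_eq, ← hq.sum_pairs]
  exact Finset.sum_le_sum fun i _ => mul_le_of_le_one_right (hq.nonneg _ _) (hg _ _)

lemma marg_add_smul (a : ℝ) (q q' : X → A → X → ℝ) (x : X) (b : A) :
    marg (fun x b x' => (1 - a) * q x b x' + a * q' x b x') x b =
      (1 - a) * marg q x b + a * marg q' x b := by
  simp only [marg, Finset.sum_add_distrib, Finset.mul_sum]

lemma abs_convex_sub_le {w p p' e : ℝ} (hw : 0 ≤ w) (hw' : 0 ≤ 1 - w) :
    |w * p + (1 - w) * p' - e| ≤ w * |p - e| + (1 - w) * |p' - e| := by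
  calc _ = |w * (p - e) + (1 - w) * (p' - e)| := by congr 1; ring
    _ ≤ _ := abs_add_le _ _
    _ = _ := by rw [abs_mul, abs_mul, abs_of_nonneg hw, abs_of_nonneg hw']

/-- The domain of the primal update is convex: a mixture of two occupancy measures is one under
the transition that mixes the two transitions proportionally to the masses. -/
lemma Counters.domain_convex {T : ℕ} {δ : ℝ} {c : Counters X A} {q' : X → A → X → ℝ}
    (hq : q ∈ c.domain S T δ) (hq' : q' ∈ c.domain S T δ) {a : ℝ} (ha : 0 ≤ a) (ha' : a ≤ 1) :
    (fun x b x' => (1 - a) * q x b x' + a * q' x b x') ∈ c.domain S T δ := by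
  classical
  obtain ⟨P, ⟨hP, hPc⟩, hqP⟩ := hq
  obtain ⟨P', ⟨hP', hPc'⟩, hqP'⟩ := hq'
  have ha1 : 0 ≤ 1 - a := by linarith
  have hm : ∀ x b, 0 ≤ marg q x b := fun x b => Finset.sum_nonneg fun x' _ => (hqP.1 x b x').1
  have hm' : ∀ x b, 0 ≤ marg q' x b := fun x b => Finset.sum_nonneg fun x' _ => (hqP'.1 x b x').1
  set m : X → A → ℝ := fun x b => (1 - a) * marg q x b + a * marg q' x b with hmdef
  set w : X → A → ℝ := fun x b => if m x b = 0 then 1 else (1 - a) * marg q x b / m x b with hw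
  have hm0 : ∀ x b, 0 ≤ m x b := fun x b =>
    add_nonneg (mul_nonneg ha1 (hm x b)) (mul_nonneg ha (hm' x b))
  have hw0 : ∀ x b, 0 ≤ w x b := fun x b => by
    simp only [hw]; split_ifs
    · exact zero_le_one
    · exact div_nonneg (mul_nonneg ha1 (hm x b)) (hm0 x b)
  have hw1 : ∀ x b, 0 ≤ 1 - w x b := fun x b => by
    simp only [hw]; split_ifs with h
    · simp
    · rw [sub_nonneg, div_le_one (lt_of_le_of_ne (hm0 x b) (Ne.symm h))]
      exact le_add_of_nonneg_right (mul_nonneg ha (hm' x b))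
  have hmw : ∀ x b, m x b * w x b = (1 - a) * marg q x b := fun x b => by
    simp only [hw]; split_ifs with h
    · rw [h, zero_mul]
      have h1 := mul_nonneg ha1 (hm x b)
      have h2 := mul_nonneg ha (hm' x b)
      simp only [hmdef] at h
      linarith
    · field_simp
  refine ⟨fun x b x' => w x b * P x b x' + (1 - w x b) * P' x b x', ⟨⟨?_, ?_, ?_⟩, ?_⟩,
    ?_, ?_, ?_, ?_⟩
  · exact fun x b x' => add_nonneg (mul_nonneg (hw0 _ _) (hP.nonneg _ _ _))
      (mul_nonneg (hw1 _ _) (hP'.nonneg _ _ _))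
  · intro x b hx
    rw [Finset.sum_add_distrib, ← Finset.mul_sum, ← Finset.mul_sum, hP.sum_eq_one x b hx,
      hP'.sum_eq_one x b hx]
    ring
  · intro x b x' h
    by_contra h0
    rw [hP.eq_zero h0, hP'.eq_zero h0] at h
    simp at h
  · intro x b hx
    calc _ ≤ ∑ x', (w x b * |P x b x' - c.empirical x b x'| +
          (1 - w x b) * |P' x b x' - c.empirical x b x'|) := by
          exact Finset.sum_le_sum fun x' _ => abs_convex_sub_le (hw0 x b) (hw1 x b)
      _ = w x b * ∑ x', |P x b x' - c.empirical x b x'| +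
          (1 - w x b) * ∑ x', |P' x b x' - c.empirical x b x'| := by
          rw [Finset.sum_add_distrib, Finset.mul_sum, Finset.mul_sum]
      _ ≤ w x b * c.radius S T δ x b + (1 - w x b) * c.radius S T δ x b :=
          add_le_add (mul_le_mul_of_nonneg_left (hPc x b hx) (hw0 _ _))
            (mul_le_mul_of_nonneg_left (hPc' x b hx) (hw1 _ _))
      _ = _ := by ring
  · intro x b x'
    have h1 := hqP.1 x b x'
    have h2 := hqP'.1 x b x'
    refine ⟨add_nonneg (mul_nonneg ha1 h1.1) (mul_nonneg ha h2.1), ?_⟩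
    nlinarith [mul_le_mul_of_nonneg_left h1.2 ha1, mul_le_mul_of_nonneg_left h2.2 ha]
  · intro l hl
    have h1 := hqP.2.1 l hl
    have h2 := hqP'.2.1 l hl
    simp only [Finset.sum_add_distrib, ← Finset.mul_sum, h1, h2]
    ring
  · intro l hl hl' x' hx'
    have h1 := hqP.2.2.1 l hl hl' x' hx'
    have h2 := hqP'.2.2.1 l hl hl' x' hx'
    simp only [Finset.sum_add_distrib, ← Finset.mul_sum, h1, h2]
  · intro x b x'
    rw [marg_add_smul]
    change (1 - a) * q x b x' + a * q' x b x' = m x b * _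
    rw [mul_add, ← mul_assoc, hmw, ← mul_assoc, mul_sub, hmw, hqP.2.2.2 x b x',
      hqP'.2.2.2 x b x']
    simp only [hmdef]; ring

lemma Counters.isMarg_of_mem_domain {T : ℕ} {δ : ℝ} {c : Counters X A}
    (hq : q ∈ c.domain S T δ) : IsMarg S q := by
  obtain ⟨P, hP, hqP⟩ := hq
  exact isMarg_of_mem_occSet hP.1 hqP

/-! ### The mixing with the uniform distribution -/

lemma card_level_pos (x : X) : 0 < (S.level (S.layer x)).card :=
  Finset.card_pos.2 ⟨x, mem_level.2 rfl⟩

lemma sum_uniform [Nonempty A] {l : ℕ} (hl : (S.level l).Nonempty) :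
    ∑ x ∈ S.level l, ∑ _a : A, (1 / ((S.level (S.layer x)).card * Fintype.card A : ℝ)) = 1 := by
  have h1 : ∀ x ∈ S.level l, ∑ _a : A, (1 / ((S.level (S.layer x)).card * Fintype.card A : ℝ)) =
      1 / (S.level l).card := fun x hx => by
    rw [mem_level.1 hx, Finset.sum_const, nsmul_eq_mul, Finset.card_univ]
    have : (Fintype.card A : ℝ) ≠ 0 := by exact_mod_cast Fintype.card_ne_zero
    field_simp
  rw [Finset.sum_congr rfl h1, Finset.sum_const, nsmul_eq_mul]
  have : ((S.level l).card : ℝ) ≠ 0 := by exact_mod_cast (Finset.card_pos.2 hl).ne'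
  field_simp

lemma marg_uniformOcc {x : X} (hx : (S.level (S.layer x + 1)).Nonempty) (a : A) :
    marg (uniformOcc (A := A) S) x a = 1 / ((S.level (S.layer x)).card * Fintype.card A) := by
  simp only [marg, uniformOcc]
  rw [← Finset.sum_filter]
  change ∑ _x' ∈ S.level (S.layer x + 1), _ = _
  rw [Finset.sum_const, nsmul_eq_mul]
  have : ((S.level (S.layer x + 1)).card : ℝ) ≠ 0 := by
    exact_mod_cast (Finset.card_pos.2 hx).ne'
  field_simp

lemma isMarg_uniformOcc [Nonempty A] (hS : ∀ l ≤ L, (S.level l).Nonempty) :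
    IsMarg S (uniformOcc (A := A) S) where
  nonneg x a := Finset.sum_nonneg fun x' _ => by
    unfold uniformOcc; split_ifs <;> positivity
  level l hl := by
    rw [← sum_uniform (A := A) (hS l hl.le)]
    refine Finset.sum_congr rfl fun x hx => Finset.sum_congr rfl fun a _ => ?_
    refine marg_uniformOcc ?_ a
    rw [mem_level.1 hx]; exact hS _ hl

lemma sum_mix [Nonempty A] (hS : ∀ l ≤ L, (S.level l).Nonempty) (hq : IsMarg S q) (θ : ℝ) :
    ∑ i ∈ pairs S A, mix S θ q i.1 i.2 = L := by
  have h : ∑ i ∈ pairs S A, (1 / ((S.level (S.layer i.1)).card * Fintype.card A : ℝ)) = L := by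
    rw [← sum_levels_eq S fun x (_ : A) => 1 / ((S.level (S.layer x)).card * Fintype.card A : ℝ),
      Finset.sum_congr rfl fun l hl => sum_uniform (hS l (Finset.mem_range.1 hl).le)]
    simp
  simp only [mix, Finset.sum_add_distrib, ← Finset.mul_sum, h, hq.sum_pairs]
  ring

lemma le_mix [Nonempty A] {θ : ℝ} (h0 : 0 ≤ θ) (h1 : θ ≤ 1) (hq : IsMarg S q) (x : X) (a : A) :
    θ / (Fintype.card X * Fintype.card A) ≤ mix S θ q x a := by
  have hc : (0 : ℝ) < (S.level (S.layer x)).card := by exact_mod_cast card_level_pos x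
  have hA : (0 : ℝ) < Fintype.card A := by exact_mod_cast Fintype.card_pos
  have hle : ((S.level (S.layer x)).card : ℝ) ≤ Fintype.card X := by
    exact_mod_cast Finset.card_le_univ _
  have h2 : (1 : ℝ) / (Fintype.card X * Fintype.card A) ≤
      1 / ((S.level (S.layer x)).card * Fintype.card A) := by gcongr
  have h3 := mul_nonneg (sub_nonneg.2 h1) (hq.nonneg x a)
  rw [mix, div_eq_mul_one_div]
  nlinarith [mul_le_mul_of_nonneg_left h2 h0]

lemma mix_pos [Nonempty A] {θ : ℝ} (h0 : 0 < θ) (h1 : θ ≤ 1) (hq : IsMarg S q) (x : X) (a : A) :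
    0 < mix S θ q x a := by
  refine lt_of_lt_of_le ?_ (le_mix h0.le h1 hq x a)
  have : Nonempty X := ⟨x⟩
  have h2 : (0 : ℝ) < Fintype.card A := by exact_mod_cast Fintype.card_pos
  have h3 : (0 : ℝ) < Fintype.card X := by exact_mod_cast Fintype.card_pos
  positivity

lemma le_mix' [Nonempty A] {θ : ℝ} (h0 : 0 ≤ θ) (x : X) (a : A) :
    (1 - θ) * marg q x a ≤ mix S θ q x a := by
  rw [mix]
  have : 0 ≤ θ * (1 / ((S.level (S.layer x)).card * Fintype.card A : ℝ)) := by positivity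
  linarith

lemma sum_abs_sub_mix_le [Nonempty A] (hS : ∀ l ≤ L, (S.level l).Nonempty) (hq : IsMarg S q)
    {θ : ℝ} (h0 : 0 ≤ θ) :
    ∑ i ∈ pairs S A, |marg q i.1 i.2 - mix S θ q i.1 i.2| ≤ 2 * θ * L := by
  have h := sum_mix hS hq 1
  calc _ ≤ ∑ i ∈ pairs S A, θ * (marg q i.1 i.2 + mix S 1 q i.1 i.2) := by
        refine Finset.sum_le_sum fun i _ => ?_
        have h1 := hq.nonneg i.1 i.2
        have h2 : 0 ≤ 1 / ((S.level (S.layer i.1)).card * Fintype.card A : ℝ) := by positivity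
        have e : marg q i.1 i.2 - mix S θ q i.1 i.2 = θ * (marg q i.1 i.2 -
          1 / ((S.level (S.layer i.1)).card * Fintype.card A : ℝ)) := by rw [mix]; ring
        rw [e, abs_mul, abs_of_nonneg h0]
        refine mul_le_mul_of_nonneg_left ?_ h0
        simp only [mix, sub_self, zero_mul, one_mul, zero_add]
        rw [abs_le]; constructor <;> linarith
    _ = _ := by rw [← Finset.mul_sum, Finset.sum_add_distrib, h, hq.sum_pairs]; ring

end Layers

/-! ### Occupancy measures of policies -/

section Occ

variable {X A : Type*} [Fintype X] [Fintype A] {L : ℕ}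

/-- A policy that may stop: in every state the probabilities of the actions sum to at most one.
The policy proposed by an occupancy measure is of this kind, since it vanishes in the states that
the occupancy measure does not visit. -/
structure IsSubPolicy (π : X → A → ℝ) : Prop where
  nonneg : ∀ x a, 0 ≤ π x a
  sum_le_one : ∀ x, ∑ a, π x a ≤ 1

lemma IsPolicy.isSubPolicy {π : X → A → ℝ} (hπ : IsPolicy π) : IsSubPolicy π :=
  ⟨hπ.nonneg, fun x => (hπ.sum_eq_one x).le⟩

lemma IsSubPolicy.le_one {π : X → A → ℝ} (hπ : IsSubPolicy π) (x : X) (a : A) : π x a ≤ 1 :=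
  (Finset.single_le_sum (fun a _ => hπ.nonneg x a) (Finset.mem_univ a)).trans (hπ.sum_le_one x)

variable {S : Layering X L} {P : X → A → X → ℝ} {π : X → A → ℝ}

lemma isSubPolicy_policyOf {q : X → A → X → ℝ} (hq : IsMarg S q) : IsSubPolicy (policyOf q) where
  nonneg x a := div_nonneg (hq.nonneg x a) (Finset.sum_nonneg fun a _ => hq.nonneg x a)
  sum_le_one x := by
    simp only [policyOf]
    rw [← Finset.sum_div]
    exact div_self_le_one _

lemma stateDist_nonneg (hP : IsTransition S P) (hπ : IsSubPolicy π) (l : ℕ) (x : X) :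
    0 ≤ stateDist S P π l x := by
  induction l generalizing x with
  | zero => simp only [stateDist]; split_ifs <;> norm_num
  | succ l ih =>
    exact Finset.sum_nonneg fun y _ => Finset.sum_nonneg fun a _ =>
      mul_nonneg (mul_nonneg (ih y) (hπ.nonneg y a)) (hP.nonneg y a x)

lemma stateDist_eq_zero (hP : IsTransition S P) {l : ℕ} {x : X} (h : S.layer x ≠ l) :
    stateDist S P π l x = 0 := by
  induction l generalizing x with
  | zero =>
    simp only [stateDist]
    rw [if_neg fun h' => h ((S.layer_eq_zero_iff x).2 h')]
  | succ l ih =>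
    refine Finset.sum_eq_zero fun y _ => Finset.sum_eq_zero fun a _ => ?_
    by_cases hy : S.layer y = l
    · rw [hP.eq_zero (by rw [hy]; exact h), mul_zero]
    · rw [ih hy]; simp

lemma sum_level_stateDist (hP : IsTransition S P) (l : ℕ) (f : X → ℝ) :
    ∑ x ∈ S.level l, stateDist S P π l x * f x = ∑ x, stateDist S P π l x * f x := by
  refine Finset.sum_subset (Finset.subset_univ _) fun x _ hx => ?_
  rw [stateDist_eq_zero hP fun h => hx (mem_level.2 h), zero_mul]

lemma sum_stateDist_zero : ∑ x, stateDist S P π 0 x = 1 := by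
  classical
  simp only [stateDist]
  rw [Finset.sum_ite_eq' Finset.univ S.first fun _ => (1 : ℝ)]
  simp

lemma sum_stateDist_succ (l : ℕ) : ∑ x', stateDist S P π (l + 1) x' =
    ∑ x, stateDist S P π l x * ∑ a, π x a * ∑ x', P x a x' := by
  simp only [stateDist]
  rw [Finset.sum_comm]
  refine Finset.sum_congr rfl fun x _ => ?_
  rw [Finset.sum_comm, Finset.mul_sum]
  refine Finset.sum_congr rfl fun a _ => ?_
  rw [← Finset.mul_sum, mul_assoc]

lemma sum_stateDist_le_one (hP : IsTransition S P) (hπ : IsSubPolicy π) (l : ℕ) :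
    ∑ x, stateDist S P π l x ≤ 1 := by
  induction l with
  | zero => exact sum_stateDist_zero.le
  | succ l ih =>
    rw [sum_stateDist_succ]
    refine le_trans (Finset.sum_le_sum fun x _ => ?_) ih
    refine mul_le_of_le_one_right (stateDist_nonneg hP hπ l x) ?_
    refine le_trans (Finset.sum_le_sum fun a _ => ?_) (hπ.sum_le_one x)
    exact mul_le_of_le_one_right (hπ.nonneg x a) (hP.sum_le_one x a)

lemma sum_stateDist_eq_one (hP : IsTransition S P) (hπ : IsPolicy π) {l : ℕ} (hl : l ≤ L) :
    ∑ x, stateDist S P π l x = 1 := by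
  induction l with
  | zero => exact sum_stateDist_zero
  | succ l ih =>
    rw [sum_stateDist_succ, ← ih (by omega)]
    refine Finset.sum_congr rfl fun x _ => ?_
    by_cases hx : S.layer x = l
    · rw [Finset.sum_congr rfl fun a _ => by rw [hP.sum_eq_one x a (by omega), mul_one],
        hπ.sum_eq_one, mul_one]
    · rw [stateDist_eq_zero hP hx, zero_mul]

lemma stateDist_le_one (hP : IsTransition S P) (hπ : IsSubPolicy π) (l : ℕ) (x : X) :
    stateDist S P π l x ≤ 1 :=
  (Finset.single_le_sum (fun x _ => stateDist_nonneg hP hπ l x) (Finset.mem_univ x)).trans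
    (sum_stateDist_le_one hP hπ l)

lemma marg_occ (hP : IsTransition S P) {x : X} (hx : S.layer x < L) (a : A) :
    marg (occ S P π) x a = stateDist S P π (S.layer x) x * π x a := by
  simp only [marg, occ]
  rw [← Finset.mul_sum, hP.sum_eq_one x a hx, mul_one]

lemma marg_occ_nonneg (hP : IsTransition S P) (hπ : IsSubPolicy π) (x : X) (a : A) :
    0 ≤ marg (occ S P π) x a :=
  Finset.sum_nonneg fun x' _ => mul_nonneg (mul_nonneg (stateDist_nonneg hP hπ _ _)
    (hπ.nonneg x a)) (hP.nonneg x a x')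

lemma marg_occ_le_one (hP : IsTransition S P) (hπ : IsSubPolicy π) {x : X} (hx : S.layer x < L)
    (a : A) : marg (occ S P π) x a ≤ 1 := by
  rw [marg_occ hP hx]
  exact mul_le_one₀ (stateDist_le_one hP hπ _ _) (hπ.nonneg x a) (hπ.le_one x a)

lemma sum_marg_occ_level (hP : IsTransition S P) {l : ℕ} (hl : l < L) (f : X → A → ℝ) :
    ∑ x ∈ S.level l, ∑ a, marg (occ S P π) x a * f x a =
      ∑ x, stateDist S P π l x * ∑ a, π x a * f x a := by
  rw [← sum_level_stateDist hP]
  refine Finset.sum_congr rfl fun x hx => ?_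
  have hx' := mem_level.1 hx
  rw [Finset.mul_sum]
  refine Finset.sum_congr rfl fun a _ => ?_
  rw [marg_occ hP (by omega), hx', mul_assoc]

lemma sum_marg_occ_level_le_one (hP : IsTransition S P) (hπ : IsSubPolicy π) {l : ℕ}
    (hl : l < L) : ∑ x ∈ S.level l, ∑ a, marg (occ S P π) x a ≤ 1 := by
  have h := sum_marg_occ_level (π := π) hP hl fun _ _ => 1
  simp only [mul_one] at h
  rw [h]
  refine le_trans (Finset.sum_le_sum fun x _ => ?_) (sum_stateDist_le_one hP hπ l)
  exact mul_le_of_le_one_right (stateDist_nonneg hP hπ l x) (hπ.sum_le_one x)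

lemma sum_marg_occ_le (hP : IsTransition S P) (hπ : IsSubPolicy π) :
    ∑ i ∈ pairs S A, marg (occ S P π) i.1 i.2 ≤ L := by
  rw [← sum_levels_eq S fun x a => marg (occ S P π) x a]
  refine (Finset.sum_le_sum fun l hl =>
    sum_marg_occ_level_le_one hP hπ (Finset.mem_range.1 hl)).trans ?_
  simp

/-- The occupancy measure of a policy is a valid occupancy measure. -/
lemma occ_mem_occSet (hP : IsTransition S P) (hπ : IsPolicy π) : occ S P π ∈ occSet S P := by
  have hπ' := hπ.isSubPolicy
  have hout : ∀ x, S.layer x < L → ∑ a, ∑ x'' ∈ S.level (S.layer x + 1), occ S P π x a x'' =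
      stateDist S P π (S.layer x) x := fun x hx => by
    have h1 : ∀ a, ∑ x'' ∈ S.level (S.layer x + 1), occ S P π x a x'' =
        stateDist S P π (S.layer x) x * π x a := fun a => by
      have h2 := hP.sum_level x a fun _ => 1
      simp only [mul_one] at h2
      simp only [occ]
      rw [← Finset.mul_sum, h2, hP.sum_eq_one x a hx, mul_one]
    rw [Finset.sum_congr rfl fun a _ => h1 a, ← Finset.mul_sum, hπ.sum_eq_one, mul_one]
  refine ⟨fun x a x' => ⟨?_, ?_⟩, fun l hl => ?_, fun l hl hl' x' hx' => ?_, fun x a x' => ?_⟩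
  · exact mul_nonneg (mul_nonneg (stateDist_nonneg hP hπ' _ _) (hπ.nonneg x a)) (hP.nonneg x a x')
  · exact mul_le_one₀ (mul_le_one₀ (stateDist_le_one hP hπ' _ _) (hπ.nonneg x a)
      (hπ'.le_one x a)) (hP.nonneg x a x') (hP.le_one x a x')
  · have h1 := sum_level_stateDist (π := π) hP l fun _ => 1
    simp only [mul_one] at h1
    rw [← sum_stateDist_eq_one hP hπ hl.le, ← h1]
    refine Finset.sum_congr rfl fun x hx => ?_
    have hx' := mem_level.1 hx
    have := hout x (by omega)
    rw [hx'] at this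
    exact this
  · have hx'' := mem_level.1 hx'
    have h1 := hout x' (by omega)
    rw [hx''] at h1
    rw [h1]
    obtain ⟨k, rfl⟩ : ∃ k, l = k + 1 := ⟨l - 1, by omega⟩
    simp only [stateDist, Nat.add_sub_cancel]
    have h2 := sum_level_stateDist (π := π) hP k fun x => ∑ a, π x a * P x a x'
    simp only [Finset.mul_sum, ← mul_assoc] at h2
    rw [← h2]
    refine Finset.sum_congr rfl fun x hx => Finset.sum_congr rfl fun a _ => ?_
    simp only [occ]
    rw [mem_level.1 hx]
  · by_cases hx : S.layer x < L
    · rw [marg_occ hP hx, occ]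
    · have h0 : P x a x' = 0 := hP.eq_zero fun h => by have := S.layer_le x'; omega
      simp only [occ]
      rw [h0, mul_zero, mul_zero]

/-- Occupancy measures of the same policy under two transitions differ by at most `L` times the
`ℓ¹` difference of the transitions, weighted with the first of the occupancy measures: an error
made in one layer is carried through the at most `L` later ones. -/
lemma occDist_occ_le {Q q : X → A → X → ℝ} (hP : IsTransition S P)
    (hQ : IsTransition S Q) (hq : q ∈ occSet S Q) (hπ : IsSubPolicy π)
    (hqπ : ∀ x a, S.layer x < L → marg q x a = (∑ a', marg q x a') * π x a) :
    occDist S (occ S P π) q ≤ L * ∑ i ∈ pairs S A,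
      marg (occ S P π) i.1 i.2 * ∑ x', |P i.1 i.2 x' - Q i.1 i.2 x'| := by
  have hqM := isMarg_of_mem_occSet hQ hq
  set m : X → ℝ := fun x => ∑ a, marg q x a with hm
  set d : ℕ → X → ℝ := stateDist S P π with hd
  set e : ℕ → ℝ := fun l => ∑ x ∈ S.level l, |d l x - m x| with he
  set ε : ℕ → ℝ := fun l => ∑ x ∈ S.level l, ∑ a,
    marg (occ S P π) x a * ∑ x', |P x a x' - Q x a x'| with hε
  have hε0 : ∀ l, 0 ≤ ε l := fun l => Finset.sum_nonneg fun x _ => Finset.sum_nonneg fun a _ =>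
    mul_nonneg (marg_occ_nonneg hP hπ x a) (Finset.sum_nonneg fun _ _ => abs_nonneg _)
  have hsucc : ∀ l, l + 1 < L → e (l + 1) ≤ e l + ε l := by
    intro l hl
    have h1 : ∀ x' ∈ S.level (l + 1), |d (l + 1) x' - m x'| ≤
        ∑ x ∈ S.level l, ∑ a, (marg (occ S P π) x a * |P x a x' - Q x a x'| +
          |d l x - m x| * (π x a * Q x a x')) := by
      intro x' hx'
      have h2 : d (l + 1) x' = ∑ x ∈ S.level l, ∑ a, d l x * π x a * P x a x' := by
        have h3 := sum_level_stateDist (π := π) hP l fun x => ∑ a, π x a * P x a x'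
        simp only [Finset.mul_sum, ← mul_assoc] at h3
        rw [hd, h3]; rfl
      have h3 : m x' = ∑ x ∈ S.level l, ∑ a, m x * π x a * Q x a x' := by
        have h4 := hq.2.2.1 (l + 1) (by omega) hl x' hx'
        rw [Nat.add_sub_cancel] at h4
        have h5 : m x' = ∑ a, ∑ x'' ∈ S.level (l + 1 + 1), q x' a x'' := by
          simp only [hm]
          refine Finset.sum_congr rfl fun a _ => ?_
          rw [← sum_level_occ hQ hq, mem_level.1 hx']
        rw [h5, ← h4]
        refine Finset.sum_congr rfl fun x hx => Finset.sum_congr rfl fun a _ => ?_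
        rw [hq.2.2.2, hqπ x a (by rw [mem_level.1 hx]; omega)]
      rw [h2, h3, ← Finset.sum_sub_distrib]
      refine (Finset.abs_sum_le_sum_abs _ _).trans (Finset.sum_le_sum fun x hx => ?_)
      rw [← Finset.sum_sub_distrib]
      refine (Finset.abs_sum_le_sum_abs _ _).trans (Finset.sum_le_sum fun a _ => ?_)
      have hxl := mem_level.1 hx
      rw [marg_occ hP (by omega), hxl]
      have h0 := stateDist_nonneg hP hπ l x
      calc _ = |d l x * π x a * (P x a x' - Q x a x') + (d l x - m x) * (π x a * Q x a x')| := by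
            congr 1; ring
        _ ≤ _ := abs_add_le _ _
        _ = _ := by
          rw [abs_mul, abs_mul (d l x - m x), abs_of_nonneg (mul_nonneg h0 (hπ.nonneg x a)),
            abs_of_nonneg (mul_nonneg (hπ.nonneg x a) (hQ.nonneg x a x'))]
    calc e (l + 1) ≤ ∑ x' ∈ S.level (l + 1), ∑ x ∈ S.level l, ∑ a,
          (marg (occ S P π) x a * |P x a x' - Q x a x'| +
          |d l x - m x| * (π x a * Q x a x')) := Finset.sum_le_sum h1
      _ ≤ ∑ x', ∑ x ∈ S.level l, ∑ a,
          (marg (occ S P π) x a * |P x a x' - Q x a x'| +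
          |d l x - m x| * (π x a * Q x a x')) := by
          refine Finset.sum_le_sum_of_subset_of_nonneg (Finset.subset_univ _) fun x' _ _ => ?_
          exact Finset.sum_nonneg fun x _ => Finset.sum_nonneg fun a _ => add_nonneg
            (mul_nonneg (marg_occ_nonneg hP hπ x a) (abs_nonneg _))
            (mul_nonneg (abs_nonneg _) (mul_nonneg (hπ.nonneg x a) (hQ.nonneg x a x')))
      _ = ε l + ∑ x ∈ S.level l, |d l x - m x| * ∑ a, π x a * ∑ x', Q x a x' := by
          rw [Finset.sum_comm, hε, ← Finset.sum_add_distrib]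
          refine Finset.sum_congr rfl fun x _ => ?_
          rw [Finset.sum_comm, Finset.mul_sum, ← Finset.sum_add_distrib]
          refine Finset.sum_congr rfl fun a _ => ?_
          rw [Finset.sum_add_distrib, Finset.mul_sum, Finset.mul_sum, Finset.mul_sum]
      _ ≤ ε l + e l := by
          refine add_le_add le_rfl (Finset.sum_le_sum fun x _ => ?_)
          refine mul_le_of_le_one_right (abs_nonneg _) ?_
          refine le_trans (Finset.sum_le_sum fun a _ => ?_) (hπ.sum_le_one x)
          exact mul_le_of_le_one_right (hπ.nonneg x a) (hQ.sum_le_one x a)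
      _ = _ := add_comm _ _
  have hzero : 0 < L → e 0 = 0 := by
    intro hL
    have hm1 : m S.first = 1 := by
      have h1 := hqM.level 0 hL
      have h2 : S.level 0 = {S.first} := by
        ext x; rw [mem_level, S.layer_eq_zero_iff, Finset.mem_singleton]
      rw [h2, Finset.sum_singleton] at h1
      exact h1
    refine Finset.sum_eq_zero fun x hx => ?_
    have hx' := (S.layer_eq_zero_iff x).1 (mem_level.1 hx)
    subst hx'
    simp [hd, stateDist, hm1]
  have hbound : ∀ l, l < L → e l ≤ ∑ k ∈ Finset.range L, ε k := by
    have h1 : ∀ l, l < L → e l ≤ ∑ k ∈ Finset.range l, ε k := by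
      intro l
      induction l with
      | zero => intro h; rw [hzero h]; simp
      | succ l ih =>
        intro h
        rw [Finset.sum_range_succ]
        linarith [hsucc l h, ih (by omega)]
    intro l hl
    refine (h1 l hl).trans (Finset.sum_le_sum_of_subset_of_nonneg ?_ fun k _ _ => hε0 k)
    exact Finset.range_subset_range.2 hl.le
  calc occDist S (occ S P π) q
      = ∑ l ∈ Finset.range L, ∑ x ∈ S.level l, ∑ a, |marg (occ S P π) x a - marg q x a| :=
        (sum_levels_eq S fun x a => |marg (occ S P π) x a - marg q x a|).symm
    _ ≤ ∑ l ∈ Finset.range L, e l := by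
        refine Finset.sum_le_sum fun l hl => Finset.sum_le_sum fun x hx => ?_
        have hl' := Finset.mem_range.1 hl
        have hxl := mem_level.1 hx
        have h1 : ∀ a, |marg (occ S P π) x a - marg q x a| = |d l x - m x| * π x a := fun a => by
          rw [marg_occ hP (by omega), hqπ x a (by omega), hxl, ← sub_mul, abs_mul,
            abs_of_nonneg (hπ.nonneg x a)]
        rw [Finset.sum_congr rfl fun a _ => h1 a, ← Finset.mul_sum]
        exact mul_le_of_le_one_right (abs_nonneg _) (hπ.sum_le_one x)
    _ ≤ ∑ l ∈ Finset.range L, ∑ k ∈ Finset.range L, ε k :=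
        Finset.sum_le_sum fun l hl => hbound l (Finset.mem_range.1 hl)
    _ = L * ∑ k ∈ Finset.range L, ε k := by simp
    _ = _ := by
        rw [hε, sum_levels_eq S fun x a =>
          marg (occ S P π) x a * ∑ x', |P x a x' - Q x a x'|]

end Occ

/-! ### Trajectories -/

section Paths

variable {X A : Type*} [Fintype X] [Fintype A]

/-- The forward recursion for sums of products of weights along paths. -/
def forward (w : ℕ → X → A → X → ℝ) (f : X → ℝ) : ℕ → X → ℝ
  | 0 => f
  | n + 1 => fun x' => ∑ x, ∑ a, forward w f n x * w n x a x'

lemma sum_paths_eq (w : ℕ → X → A → X → ℝ) (f h : X → ℝ) (n : ℕ) :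
    ∑ τ : (Fin (n + 1) → X) × (Fin n → A), f (τ.1 0) *
      (∏ l : Fin n, w l (τ.1 l.castSucc) (τ.2 l) (τ.1 l.succ)) * h (τ.1 (Fin.last n)) =
    ∑ x, forward w f n x * h x := by
  induction n generalizing h with
  | zero =>
    rw [Fintype.sum_prod_type]
    simp only [Finset.univ_unique, Finset.sum_singleton, Finset.univ_eq_empty, Finset.prod_empty,
      mul_one, forward]
    refine Fintype.sum_equiv (Equiv.funUnique (Fin 1) X) _ _ fun σ => ?_
    simp
  | succ n ih =>
    have h1 : ∑ τ : (Fin (n + 2) → X) × (Fin (n + 1) → A), f (τ.1 0) *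
        (∏ l : Fin (n + 1), w l (τ.1 l.castSucc) (τ.2 l) (τ.1 l.succ)) *
          h (τ.1 (Fin.last (n + 1))) =
        ∑ z : (X × (Fin (n + 1) → X)) × (A × (Fin n → A)), f (z.1.2 0) *
          (∏ l : Fin n, w l (z.1.2 l.castSucc) (z.2.2 l) (z.1.2 l.succ)) *
            (w n (z.1.2 (Fin.last n)) z.2.1 z.1.1 * h z.1.1) := by
      symm
      refine Fintype.sum_equiv ((Fin.snocEquiv fun _ => X).prodCongr (Fin.snocEquiv fun _ => A))
        _ _ fun z => ?_
      have e0 : (Fin.snoc (α := fun _ => X) z.1.2 z.1.1 : Fin (n + 2) → X) 0 = z.1.2 0 := by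
        rw [← Fin.castSucc_zero, Fin.snoc_castSucc]
      have e1 : ∀ l : Fin n, (Fin.snoc (α := fun _ => X) z.1.2 z.1.1 : Fin (n + 2) → X)
          l.castSucc.succ = z.1.2 l.succ := fun l => by
        rw [Fin.succ_castSucc, Fin.snoc_castSucc]
      simp only [Equiv.prodCongr_apply, Prod.map, Fin.snocEquiv, Equiv.coe_fn_mk,
        Fin.prod_univ_castSucc, Fin.snoc_castSucc, Fin.snoc_last, e0, e1, Fin.succ_last,
        Fin.val_castSucc, Fin.val_last]
      ring
    rw [h1]
    have h2 := ih fun x => ∑ x', ∑ a, w n x a x' * h x'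
    have h3 : ∑ x', forward w f (n + 1) x' * h x' =
        ∑ x, forward w f n x * ∑ x', ∑ a, w n x a x' * h x' := by
      simp only [forward, Finset.sum_mul, Finset.mul_sum]
      rw [Finset.sum_comm]
      exact Finset.sum_congr rfl fun x _ => Finset.sum_congr rfl fun x' _ =>
        Finset.sum_congr rfl fun a _ => by ring
    rw [h3, ← h2]
    simp only [Fintype.sum_prod_type, Finset.mul_sum]
    rw [Finset.sum_comm]
    refine Finset.sum_congr rfl fun σ _ => ?_
    calc _ = ∑ x', ∑ α : Fin n → A, ∑ a, _ :=
          Finset.sum_congr rfl fun x' _ => Finset.sum_comm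
      _ = _ := Finset.sum_comm

end Paths

section Traj

variable {X A : Type*} [Fintype X] [Fintype A] {L : ℕ}
variable {S : Layering X L} {P : X → A → X → ℝ} {π : X → A → ℝ}

lemma trajProb_nonneg (hP : IsTransition S P) (hπ : IsSubPolicy π) (τ : Traj X A L) :
    0 ≤ trajProb S P π τ := by
  refine mul_nonneg (by split_ifs <;> norm_num) (Finset.prod_nonneg fun l _ => ?_)
  exact mul_nonneg (hπ.nonneg _ _) (hP.nonneg _ _ _)

open Classical in
/-- The probability of a given transition at step `l`.  It is an inequality, as a policy that may
stop can lose mass after step `l`. -/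
lemma sum_trajProb_step_le (hP : IsTransition S P) (hπ : IsSubPolicy π) (l : Fin L) (x : X)
    (a : A) (x' : X) :
    ∑ τ : Traj X A L, trajProb S P π τ *
      (if τ.1 l.castSucc = x ∧ τ.2 l = a ∧ τ.1 l.succ = x' then 1 else 0) ≤
      stateDist S P π l x * π x a * P x a x' := by
  set w : ℕ → X → A → X → ℝ := fun k y b y' => (π y b * P y b y') *
    (if k = l then (if y = x ∧ b = a ∧ y' = x' then 1 else 0) else 1) with hw
  set f : X → ℝ := fun x => if x = S.first then 1 else 0 with hf
  have h1 : ∀ τ : Traj X A L, trajProb S P π τ *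
      (if τ.1 l.castSucc = x ∧ τ.2 l = a ∧ τ.1 l.succ = x' then 1 else 0) =
      f (τ.1 0) * (∏ k : Fin L, w k (τ.1 k.castSucc) (τ.2 k) (τ.1 k.succ)) * 1 := by
    intro τ
    simp only [trajProb, hw, Finset.prod_mul_distrib, hf]
    have h2 : ∀ k : Fin L, ((k : ℕ) = l) ↔ (k = l) := fun k => Fin.ext_iff.symm
    simp only [h2, Finset.prod_ite_eq', Finset.mem_univ, if_true]
    ring
  rw [Finset.sum_congr rfl fun τ _ => h1 τ]
  have h2 := sum_paths_eq w f (fun _ => 1) L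
  rw [h2]
  have hf0 : ∀ y, 0 ≤ f y := fun y => by simp only [hf]; split_ifs <;> norm_num
  have hw0 : ∀ k y b y', 0 ≤ w k y b y' := fun k y b y' => by
    refine mul_nonneg (mul_nonneg (hπ.nonneg _ _) (hP.nonneg _ _ _)) ?_
    split_ifs <;> norm_num
  have hfw0 : ∀ k y, 0 ≤ forward w f k y := by
    intro k
    induction k with
    | zero => exact hf0
    | succ k ih =>
      exact fun y => Finset.sum_nonneg fun z _ => Finset.sum_nonneg fun b _ =>
        mul_nonneg (ih z) (hw0 _ _ _ _)
  have hbefore : ∀ k, k ≤ (l : ℕ) → forward w f k = stateDist S P π k := by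
    intro k
    induction k with
    | zero => intro _; funext y; simp only [forward, stateDist, hf]
    | succ k ih =>
      intro hk
      funext y
      simp only [forward, stateDist]
      rw [ih (by omega)]
      refine Finset.sum_congr rfl fun z _ => Finset.sum_congr rfl fun b _ => ?_
      simp only [hw, if_neg (show k ≠ (l : ℕ) by omega)]
      ring
  have hat : ∑ y, forward w f (l + 1) y = stateDist S P π l x * π x a * P x a x' := by
    have hl := hbefore l le_rfl
    simp only [forward, hl]
    simp only [hw, if_true]
    rw [Finset.sum_eq_single x', Finset.sum_eq_single x, Finset.sum_eq_single a]
    · simp only [and_self, if_true, mul_one]; ring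
    · intro b _ hb; simp [hb]
    · simp
    · intro y _ hy; exact Finset.sum_eq_zero fun b _ => by simp [hy]
    · simp
    · intro y _ hy
      exact Finset.sum_eq_zero fun z _ => Finset.sum_eq_zero fun b _ => by simp [hy]
    · simp
  have hafter : ∀ k, (l : ℕ) + 1 ≤ k → ∑ y, forward w f k y ≤ ∑ y, forward w f (l + 1) y := by
    intro k hk
    induction k, hk using Nat.le_induction with
    | base => exact le_rfl
    | succ k hk ih =>
      refine le_trans ?_ ih
      simp only [forward]
      rw [Finset.sum_comm]
      refine Finset.sum_le_sum fun z _ => ?_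
      rw [Finset.sum_comm]
      calc _ = forward w f k z * ∑ b, π z b * ∑ y, P z b y := by
            rw [Finset.mul_sum]
            refine Finset.sum_congr rfl fun b _ => ?_
            rw [Finset.mul_sum, Finset.mul_sum]
            refine Finset.sum_congr rfl fun y _ => ?_
            simp only [hw, if_neg (show k ≠ (l : ℕ) by omega), mul_one]
        _ ≤ _ := by
          refine mul_le_of_le_one_right (hfw0 k z) ?_
          refine le_trans (Finset.sum_le_sum fun b _ => ?_) (hπ.sum_le_one z)
          exact mul_le_of_le_one_right (hπ.nonneg z b) (hP.sum_le_one z b)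
  simp only [mul_one]
  exact (hafter L l.2).trans_eq hat

lemma sum_visits₃ (τ : Traj X A L) (x : X) (a : A) :
    ∑ x', visits₃ τ x a x' = visits τ x a := by
  classical
  simp only [visits, visits₃, Finset.card_filter]
  rw [Finset.sum_comm]
  refine Finset.sum_congr rfl fun l _ => ?_
  by_cases h : τ.1 l.castSucc = x ∧ τ.2 l = a
  · simp [h]
  · rw [if_neg h]
    exact Finset.sum_eq_zero fun x' _ => if_neg fun h' => h ⟨h'.1, h'.2.1⟩

lemma sum_visits (τ : Traj X A L) : ∑ i : X × A, visits τ i.1 i.2 = L := by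
  classical
  simp only [visits, Finset.card_filter]
  rw [Finset.sum_comm]
  have : ∀ l : Fin L, ∑ i : X × A, (if τ.1 l.castSucc = i.1 ∧ τ.2 l = i.2 then 1 else 0) = 1 :=
      fun l => by
    rw [Finset.sum_eq_single (τ.1 l.castSucc, τ.2 l)]
    · simp
    · intro i _ hi
      exact if_neg fun h => hi (Prod.ext h.1.symm h.2.symm)
    · simp
  simp [this]

/-- The expected number of visits to a triple is at most its occupancy. -/
lemma sum_trajProb_visits₃_le (hP : IsTransition S P) (hπ : IsSubPolicy π) (x : X) (a : A)
    (x' : X) :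
    ∑ τ : Traj X A L, trajProb S P π τ * visits₃ τ x a x' ≤ occ S P π x a x' := by
  classical
  have h1 : ∑ τ : Traj X A L, trajProb S P π τ * visits₃ τ x a x' =
      ∑ l : Fin L, ∑ τ : Traj X A L, trajProb S P π τ *
        (if τ.1 l.castSucc = x ∧ τ.2 l = a ∧ τ.1 l.succ = x' then 1 else 0) := by
    rw [Finset.sum_comm]
    refine Finset.sum_congr rfl fun τ _ => ?_
    rw [← Finset.mul_sum, visits₃, Finset.card_filter]
    push_cast
    rfl
  rw [h1]
  refine (Finset.sum_le_sum fun l _ => sum_trajProb_step_le hP hπ l x a x').trans ?_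
  by_cases hx : S.layer x < L
  · rw [Finset.sum_eq_single (⟨S.layer x, hx⟩ : Fin L)]
    · exact le_of_eq rfl
    · intro l _ hl
      rw [stateDist_eq_zero hP fun h => hl (Fin.ext h.symm), zero_mul, zero_mul]
    · simp
  · have h0 : P x a x' = 0 := hP.eq_zero fun h => by have := S.layer_le x'; omega
    simp [occ, h0]

lemma sum_occ_le (hP : IsTransition S P) (hπ : IsSubPolicy π) :
    ∑ i : X × A, marg (occ S P π) i.1 i.2 ≤ L := by
  refine le_trans (le_of_eq ?_) (sum_marg_occ_le hP hπ)
  symm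
  refine Finset.sum_subset (Finset.subset_univ _) fun i _ hi => ?_
  have hi' : ¬ S.layer i.1 < L := fun h => hi (mem_pairs.2 h)
  refine Finset.sum_eq_zero fun x' _ => ?_
  have h0 : P i.1 i.2 x' = 0 := hP.eq_zero fun h => by have := S.layer_le x'; omega
  simp [occ, h0]

/-- If no mass is lost, the expected number of visits to a triple is its occupancy. -/
lemma sum_trajProb_visits₃ (hP : IsTransition S P) (hπ : IsSubPolicy π)
    (hmass : ∑ τ : Traj X A L, trajProb S P π τ = 1) (x : X) (a : A) (x' : X) :
    ∑ τ : Traj X A L, trajProb S P π τ * visits₃ τ x a x' = occ S P π x a x' := by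
  have hle : ∀ i : (X × A) × X, i ∈ Finset.univ →
      ∑ τ : Traj X A L, trajProb S P π τ * visits₃ τ i.1.1 i.1.2 i.2 ≤
        occ S P π i.1.1 i.1.2 i.2 := fun i _ => sum_trajProb_visits₃_le hP hπ _ _ _
  have hsum : ∑ i : (X × A) × X,
      ∑ τ : Traj X A L, trajProb S P π τ * visits₃ τ i.1.1 i.1.2 i.2 = L := by
    rw [Finset.sum_comm]
    have h1 : ∀ τ : Traj X A L, ∑ i : (X × A) × X,
        trajProb S P π τ * visits₃ τ i.1.1 i.1.2 i.2 = trajProb S P π τ * L := fun τ => by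
      rw [← Finset.mul_sum]
      congr 1
      rw [Fintype.sum_prod_type]
      have h2 : (∑ i : X × A, ∑ x', visits₃ τ i.1 i.2 x' : ℕ) = L := by
        simp only [sum_visits₃, sum_visits]
      exact_mod_cast h2
    rw [Finset.sum_congr rfl fun τ _ => h1 τ, ← Finset.sum_mul, hmass, one_mul]
  have hsum' : ∑ i : (X × A) × X, occ S P π i.1.1 i.1.2 i.2 ≤ L := by
    rw [Fintype.sum_prod_type]
    exact sum_occ_le hP hπ
  have heq := (Finset.sum_eq_sum_iff_of_le hle).1
    (le_antisymm (Finset.sum_le_sum hle) (hsum'.trans hsum.ge))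
  exact heq ((x, a), x') (Finset.mem_univ _)

lemma sum_trajProb_visits (hP : IsTransition S P) (hπ : IsSubPolicy π)
    (hmass : ∑ τ : Traj X A L, trajProb S P π τ = 1) (x : X) (a : A) :
    ∑ τ : Traj X A L, trajProb S P π τ * visits τ x a = marg (occ S P π) x a := by
  have h1 : ∀ τ : Traj X A L, trajProb S P π τ * visits τ x a =
      ∑ x', trajProb S P π τ * visits₃ τ x a x' := fun τ => by
    rw [← sum_visits₃, Nat.cast_sum, Finset.mul_sum]
  rw [Finset.sum_congr rfl fun τ _ => h1 τ, Finset.sum_comm]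
  exact Finset.sum_congr rfl fun x' _ => sum_trajProb_visits₃ hP hπ hmass x a x'

lemma sum_trajProb_le_one (hP : IsTransition S P) (hπ : IsSubPolicy π) :
    ∑ τ : Traj X A L, trajProb S P π τ ≤ 1 := by
  classical
  set w : ℕ → X → A → X → ℝ := fun _ y b y' => π y b * P y b y' with hw
  have h2 := sum_paths_eq w (fun x => if x = S.first then 1 else 0) (fun _ => 1) L
  have h3 : ∀ k, forward w (fun x => if x = S.first then 1 else 0) k = stateDist S P π k := by
    intro k
    induction k with
    | zero => funext y; simp only [forward, stateDist]
    | succ k ih =>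
      funext y
      simp only [forward, stateDist, ih]
      simp only [hw, mul_assoc]
  rw [h3] at h2
  simp only [mul_one] at h2
  refine le_trans (le_of_eq ?_) (h2.trans_le (sum_stateDist_le_one hP hπ L))
  refine Finset.sum_congr rfl fun τ _ => ?_
  simp only [trajProb, hw]

/-- The trajectory moves from each layer to the next one. -/
def IsPath (S : Layering X L) (τ : Traj X A L) : Prop :=
  ∀ k : Fin (L + 1), S.layer (τ.1 k) = k

lemma isPath_of_trajProb_ne_zero (hP : IsTransition S P) {τ : Traj X A L}
    (h : trajProb S P π τ ≠ 0) : IsPath S τ := by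
  classical
  have h1 := left_ne_zero_of_mul h
  have h2 := right_ne_zero_of_mul h
  rw [Finset.prod_ne_zero_iff] at h2
  intro k
  induction k using Fin.induction with
  | zero =>
    have : τ.1 0 = S.first := by by_contra h0; exact h1 (if_neg h0)
    rw [this]
    exact (S.layer_eq_zero_iff _).2 rfl
  | succ l ih =>
    have h3 := right_ne_zero_of_mul (h2 l (Finset.mem_univ _))
    have h4 := hP.loop_free _ _ _ (lt_of_le_of_ne (hP.nonneg _ _ _) (Ne.symm h3))
    rw [h4, ih]
    simp

lemma IsPath.visits_le_one {τ : Traj X A L} (hτ : IsPath S τ) (x : X) (a : A) :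
    visits τ x a ≤ 1 := by
  classical
  refine Finset.card_le_one.2 fun k hk l hl => ?_
  simp only [Finset.mem_filter, Finset.mem_univ, true_and] at hk hl
  have h1 := hτ k.castSucc
  have h2 := hτ l.castSucc
  rw [hk.1] at h1
  rw [hl.1] at h2
  exact Fin.ext (by simpa using h1.symm.trans h2)

lemma IsPath.visits₃_eq_zero {τ : Traj X A L} (hτ : IsPath S τ) {x : X} {a : A} {x' : X}
    (h : S.layer x' ≠ S.layer x + 1) : visits₃ τ x a x' = 0 := by
  classical
  refine Finset.card_eq_zero.2 (Finset.filter_eq_empty_iff.2 fun l _ hl => h ?_)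
  rw [← hl.1, ← hl.2.2, hτ, hτ]
  simp

/-- A trajectory visits exactly one pair of each non-terminal layer. -/
lemma IsPath.sum_visits_level {τ : Traj X A L} (hτ : IsPath S τ) {l : ℕ} (hl : l < L) :
    ∑ x ∈ S.level l, ∑ a, visits τ x a = 1 := by
  classical
  have h1 : ∀ x ∈ S.level l, ∀ a, visits τ x a =
      if τ.1 (⟨l, hl⟩ : Fin L).castSucc = x ∧ τ.2 ⟨l, hl⟩ = a then 1 else 0 := by
    intro x hx a
    rw [visits, Finset.card_filter, Finset.sum_eq_single (⟨l, hl⟩ : Fin L)]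
    · intro k _ hk
      refine if_neg fun h => hk (Fin.ext ?_)
      have h2 := hτ k.castSucc
      rw [h.1, mem_level.1 hx] at h2
      simpa using h2.symm
    · simp
  have hmem : τ.1 (⟨l, hl⟩ : Fin L).castSucc ∈ S.level l := by
    rw [mem_level, hτ]; simp
  rw [Finset.sum_congr rfl fun x hx => Finset.sum_congr rfl fun a _ => h1 x hx a,
    Finset.sum_eq_single_of_mem _ hmem, Finset.sum_eq_single (τ.2 ⟨l, hl⟩)]
  · simp
  · intro a _ ha; exact if_neg fun h => ha h.2.symm
  · simp
  · intro x _ hx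
    exact Finset.sum_eq_zero fun a _ => if_neg fun h => hx h.1.symm

end Traj

/-! ### Visitation counters -/

section Counters

variable {X A : Type*} [Fintype X] [Fintype A] {L : ℕ}

/-- The number of visits to `(x, a)` in the episodes `1, …, t`. -/
noncomputable def total (τ : ℕ → Traj X A L) (t : ℕ) (x : X) (a : A) : ℕ :=
  ∑ s ∈ Finset.range t, visits (τ (s + 1)) x a

/-- The number of visits to `(x, a, x')` in the episodes `1, …, t`. -/
noncomputable def total₃ (τ : ℕ → Traj X A L) (t : ℕ) (x : X) (a : A) (x' : X) : ℕ :=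
  ∑ s ∈ Finset.range t, visits₃ (τ (s + 1)) x a x'

variable {S : Layering X L} {τ : ℕ → Traj X A L} {κ : ℕ}

lemma sum_total₃ (t : ℕ) (x : X) (a : A) : ∑ x', total₃ τ t x a x' = total τ t x a := by
  simp only [total₃, total]
  rw [Finset.sum_comm]
  exact Finset.sum_congr rfl fun s _ => sum_visits₃ _ _ _

lemma total_succ (t : ℕ) (x : X) (a : A) :
    total τ (t + 1) x a = total τ t x a + visits (τ (t + 1)) x a := by
  simp only [total, Finset.sum_range_succ]

lemma total₃_succ (t : ℕ) (x : X) (a : A) (x' : X) :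
    total₃ τ (t + 1) x a x' = total₃ τ t x a x' + visits₃ (τ (t + 1)) x a x' := by
  simp only [total₃, Finset.sum_range_succ]

lemma total_mono {s t : ℕ} (h : s ≤ t) (x : X) (a : A) : total τ s x a ≤ total τ t x a :=
  Finset.sum_le_sum_of_subset (Finset.range_subset_range.2 h)

lemma total₃_mono {s t : ℕ} (h : s ≤ t) (x : X) (a : A) (x' : X) :
    total₃ τ s x a x' ≤ total₃ τ t x a x' :=
  Finset.sum_le_sum_of_subset (Finset.range_subset_range.2 h)

lemma total_le {T : ℕ} (hτ : ∀ t, t < T → IsPath S (τ (t + 1))) {t : ℕ} (ht : t ≤ T) (x : X)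
    (a : A) : total τ t x a ≤ t := by
  calc total τ t x a ≤ ∑ _s ∈ Finset.range t, 1 :=
        Finset.sum_le_sum fun s hs =>
          (hτ s (by have := Finset.mem_range.1 hs; omega)).visits_le_one x a
    _ = t := by simp

lemma total₃_eq_zero {T : ℕ} (hτ : ∀ t, t < T → IsPath S (τ (t + 1))) {t : ℕ} (ht : t ≤ T)
    {x : X} {a : A} {x' : X} (h : S.layer x' ≠ S.layer x + 1) : total₃ τ t x a x' = 0 :=
  Finset.sum_eq_zero fun s hs =>
    (hτ s (by have := Finset.mem_range.1 hs; omega)).visits₃_eq_zero h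

lemma sum_total_level {T : ℕ} (hτ : ∀ t, t < T → IsPath S (τ (t + 1))) {l : ℕ} (hl : l < L) :
    ∑ x ∈ S.level l, ∑ a, total τ T x a = T := by
  have h1 : ∀ x ∈ S.level l, ∑ a, total τ T x a =
      ∑ s ∈ Finset.range T, ∑ a, visits (τ (s + 1)) x a := fun x _ => Finset.sum_comm
  rw [Finset.sum_congr rfl h1, Finset.sum_comm, Finset.sum_congr rfl fun s hs =>
    (hτ s (Finset.mem_range.1 hs)).sum_visits_level hl]
  simp

lemma Counters.step_cases (κ : ℕ) (c : Counters X A) (σ : Traj X A L) :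
    c.step κ σ = { n := fun _ _ => 0
                   m := fun _ _ _ => 0
                   N := fun x a => c.N x a + (c.n x a + visits σ x a)
                   M := fun x a x' => c.M x a x' + (c.m x a x' + visits₃ σ x a x') } ∨
    c.step κ σ = { n := fun x a => c.n x a + visits σ x a
                   m := fun x a x' => c.m x a x' + visits₃ σ x a x'
                   N := c.N
                   M := c.M } ∧ ∀ x a, c.n x a + visits σ x a < max κ (c.N x a) := by
  classical
  unfold Counters.step
  split_ifs with h
  · exact Or.inl rfl
  · push Not at h
    exact Or.inr ⟨rfl, h⟩

lemma counters_add (t : ℕ) (x : X) (a : A) :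
    (counters κ τ t).N x a + (counters κ τ t).n x a = total τ t x a := by
  induction t with
  | zero => simp [counters, total]
  | succ t ih =>
    rw [total_succ, ← ih, counters]
    rcases (counters κ τ t).step_cases κ (τ (t + 1)) with h | ⟨h, -⟩
    · rw [h]; simp [add_assoc]
    · rw [h]; simp [add_assoc]

lemma counters_add₃ (t : ℕ) (x : X) (a : A) (x' : X) :
    (counters κ τ t).M x a x' + (counters κ τ t).m x a x' = total₃ τ t x a x' := by
  induction t with
  | zero => simp [counters, total₃]
  | succ t ih =>
    rw [total₃_succ, ← ih, counters]
    rcases (counters κ τ t).step_cases κ (τ (t + 1)) with h | ⟨h, -⟩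
    · rw [h]; simp [add_assoc]
    · rw [h]; simp [add_assoc]

/-- At the beginning of an episode, the visits in the current epoch number at most those before. -/
lemma counters_n_le (hκ : κ ≤ 1) (t : ℕ) (x : X) (a : A) :
    (counters κ τ t).n x a ≤ (counters κ τ t).N x a := by
  cases t with
  | zero => simp [counters]
  | succ t =>
    rw [counters]
    rcases (counters κ τ t).step_cases κ (τ (t + 1)) with h | ⟨h, h'⟩
    · rw [h]; simp
    · rw [h]
      have := h' x a
      simp only
      rcases le_max_iff.1 (le_refl (max κ ((counters κ τ t).N x a))) with h1 | h1 <;> omega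

lemma total_le_two_mul (hκ : κ ≤ 1) (t : ℕ) (x : X) (a : A) :
    total τ t x a ≤ 2 * (counters κ τ t).N x a := by
  have h1 := counters_add (κ := κ) (τ := τ) t x a
  have h2 := counters_n_le (κ := κ) (τ := τ) hκ t x a
  omega

/-- The counts before the current epoch are the total counts at the end of an earlier episode. -/
lemma exists_counters_eq_total (t : ℕ) : ∃ t' ≤ t,
    (∀ x a, (counters κ τ t).N x a = total τ t' x a) ∧
    (∀ x a x', (counters κ τ t).M x a x' = total₃ τ t' x a x') := by
  induction t with
  | zero => exact ⟨0, le_rfl, fun x a => by simp [counters, total],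
      fun x a x' => by simp [counters, total₃]⟩
  | succ t ih =>
    have hN := fun x a => counters_add (κ := κ) (τ := τ) t x a
    have hM := fun x a x' => counters_add₃ (κ := κ) (τ := τ) t x a x'
    rw [counters]
    rcases (counters κ τ t).step_cases κ (τ (t + 1)) with h | ⟨h, -⟩
    · refine ⟨t + 1, le_rfl, fun x a => ?_, fun x a x' => ?_⟩
      · rw [h, total_succ, ← hN, add_assoc]
      · rw [h, total₃_succ, ← hM, add_assoc]
    · obtain ⟨t', ht', h1, h2⟩ := ih
      refine ⟨t', by omega, fun x a => ?_, fun x a x' => ?_⟩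
      · rw [h]; exact h1 x a
      · rw [h]; exact h2 x a x'

/-- Either nothing has changed in the counts before the current epoch, or they are up to date. -/
lemma counters_succ_cases (t : ℕ) :
    ((counters κ τ (t + 1)).N = (counters κ τ t).N ∧
      (counters κ τ (t + 1)).M = (counters κ τ t).M) ∨
    ((∀ x a, (counters κ τ (t + 1)).N x a = total τ (t + 1) x a) ∧
      ∀ x a x', (counters κ τ (t + 1)).M x a x' = total₃ τ (t + 1) x a x') := by
  have hN := fun x a => counters_add (κ := κ) (τ := τ) t x a
  have hM := fun x a x' => counters_add₃ (κ := κ) (τ := τ) t x a x'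
  rw [counters]
  rcases (counters κ τ t).step_cases κ (τ (t + 1)) with h | ⟨h, -⟩
  · refine Or.inr ⟨fun x a => ?_, fun x a x' => ?_⟩
    · rw [h, total_succ, ← hN, add_assoc]
    · rw [h, total₃_succ, ← hM, add_assoc]
  · rw [h]; exact Or.inl ⟨rfl, rfl⟩

lemma counters_le_total (t : ℕ) (x : X) (a : A) : (counters κ τ t).N x a ≤ total τ t x a := by
  rw [← counters_add (κ := κ)]; exact Nat.le_add_right _ _

lemma counters_le_total₃ (t : ℕ) (x : X) (a : A) (x' : X) :
    (counters κ τ t).M x a x' ≤ total₃ τ t x a x' := by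
  rw [← counters_add₃ (κ := κ)]; exact Nat.le_add_right _ _

lemma counters_mono (t : ℕ) (x : X) (a : A) :
    (counters κ τ t).N x a ≤ (counters κ τ (t + 1)).N x a := by
  rcases counters_succ_cases (κ := κ) (τ := τ) t with ⟨h, -⟩ | ⟨h, -⟩
  · rw [h]
  · rw [h]; exact (counters_le_total t x a).trans (total_mono (Nat.le_succ t) x a)

lemma counters_mono₃ (t : ℕ) (x : X) (a : A) (x' : X) :
    (counters κ τ t).M x a x' ≤ (counters κ τ (t + 1)).M x a x' := by
  rcases counters_succ_cases (κ := κ) (τ := τ) t with ⟨-, h⟩ | ⟨-, h⟩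
  · rw [h]
  · rw [h]; exact (counters_le_total₃ t x a x').trans (total₃_mono (Nat.le_succ t) x a x')

lemma sum_counters_M (t : ℕ) (x : X) (a : A) :
    ∑ x', (counters κ τ t).M x a x' = (counters κ τ t).N x a := by
  obtain ⟨t', -, h1, h2⟩ := exists_counters_eq_total (κ := κ) (τ := τ) t
  rw [h1, ← sum_total₃]
  exact Finset.sum_congr rfl fun x' _ => h2 x a x'

/-- A transition of the old confidence set can be moved into the new one, at a cost that is small
compared to the number of new visits: mix it with the empirical transition of the new visits. -/
lemma exists_transition_near {T : ℕ} {δ : ℝ} {c c' : Counters X A} {Q : X → A → X → ℝ}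
    (hJ : 0 ≤ Real.log (T * Fintype.card A * Fintype.card X / δ))
    (hQ : Q ∈ c.transitions S T δ) (hN : ∀ x a, c.N x a ≤ c'.N x a)
    (hM : ∀ x a x', c.M x a x' ≤ c'.M x a x') (hs : ∀ x a, ∑ x', c.M x a x' = c.N x a)
    (hs' : ∀ x a, ∑ x', c'.M x a x' = c'.N x a)
    (hl : ∀ x a x', S.layer x' ≠ S.layer x + 1 → c'.M x a x' = 0) :
    ∃ Q' ∈ c'.transitions S T δ, ∀ x a, ∑ x', |Q' x a x' - Q x a x'| ≤
      2 * (((c'.N x a : ℝ) - c.N x a) / max 1 (c'.N x a : ℝ)) := by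
  classical
  obtain ⟨hQt, hQc⟩ := hQ
  have hsR : ∀ x a, ∑ x', (c.M x a x' : ℝ) = c.N x a := fun x a => by exact_mod_cast hs x a
  have hsR' : ∀ x a, ∑ x', (c'.M x a x' : ℝ) = c'.N x a := fun x a => by exact_mod_cast hs' x a
  have hNR : ∀ x a, (c.N x a : ℝ) ≤ c'.N x a := fun x a => by exact_mod_cast hN x a
  have hMR : ∀ x a x', (c.M x a x' : ℝ) ≤ c'.M x a x' := fun x a x' => by exact_mod_cast hM x a x'
  set Q' : X → A → X → ℝ := fun x a x' => if c'.N x a = 0 then Q x a x' else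
    (c.N x a * Q x a x' + (c'.M x a x' - c.M x a x')) / c'.N x a with hQ'
  have hM0 : ∀ x a, c.N x a = 0 → ∀ x', c.M x a x' = 0 := fun x a h x' => by
    have h1 := hs x a
    rw [h] at h1
    exact Finset.sum_eq_zero_iff.1 h1 x' (Finset.mem_univ _)
  have hmax : ∀ x a, c'.N x a ≠ 0 → max 1 (c'.N x a : ℝ) = c'.N x a := fun x a h =>
    max_eq_right (by exact_mod_cast Nat.one_le_iff_ne_zero.2 h)
  refine ⟨Q', ⟨⟨fun x a x' => ?_, fun x a hx => ?_, fun x a x' h => ?_⟩, fun x a hx => ?_⟩,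
    fun x a => ?_⟩
  · simp only [hQ']
    split_ifs with h
    · exact hQt.nonneg x a x'
    · exact div_nonneg (add_nonneg (mul_nonneg (Nat.cast_nonneg _) (hQt.nonneg x a x'))
        (sub_nonneg.2 (hMR x a x'))) (Nat.cast_nonneg _)
  · simp only [hQ']
    split_ifs with h
    · exact hQt.sum_eq_one x a hx
    · have h0 : (c'.N x a : ℝ) ≠ 0 := by exact_mod_cast h
      rw [← Finset.sum_div, Finset.sum_add_distrib, ← Finset.mul_sum, hQt.sum_eq_one x a hx,
        Finset.sum_sub_distrib, hsR, hsR']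
      field_simp; ring
  · by_contra hne
    have h1 := hQt.eq_zero (a := a) hne
    have h2 := hl x a x' hne
    have h3 := hM x a x'
    rw [h2, Nat.le_zero] at h3
    simp only [hQ', h1, h2, h3] at h
    simp at h
  · by_cases h : c'.N x a = 0
    · have h0 : c.N x a = 0 := by have := hN x a; omega
      have h1 := hQc x a hx
      have h2 : ∀ x', c'.M x a x' = 0 := fun x' => by
        have h1 := hs' x a
        rw [h] at h1
        exact Finset.sum_eq_zero_iff.1 h1 x' (Finset.mem_univ _)
      simp only [Counters.radius, Counters.empirical, h0, hM0 x a h0] at h1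
      simp only [hQ', Counters.radius, Counters.empirical, h, h2, if_true]
      exact h1
    · have h0 : (0 : ℝ) < c'.N x a := by exact_mod_cast Nat.pos_of_ne_zero h
      by_cases hc : c.N x a = 0
      · have h1 : ∀ x', Q' x a x' - c'.empirical x a x' = 0 := fun x' => by
          simp only [hQ', if_neg h, Counters.empirical, hmax x a h, hc, hM0 x a hc]
          simp
        rw [Finset.sum_congr rfl fun x' _ => by rw [h1 x', abs_zero]]
        simp only [Finset.sum_const_zero]
        exact Real.sqrt_nonneg _
      · have hc0 : (0 : ℝ) < c.N x a := by exact_mod_cast Nat.pos_of_ne_zero hc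
        have hmaxc : max 1 (c.N x a : ℝ) = c.N x a :=
          max_eq_right (by exact_mod_cast Nat.one_le_iff_ne_zero.2 hc)
        have h1 : ∀ x', |Q' x a x' - c'.empirical x a x'| =
            c.N x a / c'.N x a * |Q x a x' - c.empirical x a x'| := fun x' => by
          rw [← abs_of_nonneg (show 0 ≤ (c.N x a : ℝ) / c'.N x a by positivity), ← abs_mul]
          congr 1
          simp only [hQ', if_neg h, Counters.empirical, hmax x a h, hmaxc]
          field_simp; ring
        rw [Finset.sum_congr rfl fun x' _ => h1 x', ← Finset.mul_sum]
        refine (mul_le_mul_of_nonneg_left (hQc x a hx) (by positivity)).trans ?_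
        simp only [Counters.radius, hmax x a h, hmaxc]
        rw [← Real.sqrt_sq (show 0 ≤ (c.N x a : ℝ) / c'.N x a by positivity),
          ← Real.sqrt_mul (by positivity)]
        refine Real.sqrt_le_sqrt ?_
        set K := 2 * ((S.level (S.layer x + 1)).card : ℝ) *
          Real.log (T * Fintype.card A * Fintype.card X / δ) with hK
        have hK0 : 0 ≤ K := by positivity
        have e : ((c.N x a : ℝ) / c'.N x a) ^ 2 * (K / c.N x a) =
          (c.N x a / c'.N x a) * (K / c'.N x a) := by field_simp
        rw [e]
        refine mul_le_of_le_one_left (by positivity) ?_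
        rw [div_le_one h0]
        exact hNR x a
  · by_cases h : c'.N x a = 0
    · have h0 : c.N x a = 0 := by have := hN x a; omega
      simp [hQ', h, h0]
    · have h0 : (0 : ℝ) < c'.N x a := by exact_mod_cast Nat.pos_of_ne_zero h
      have hd : 0 ≤ (c'.N x a : ℝ) - c.N x a := sub_nonneg.2 (hNR x a)
      have h1 : ∀ x', |Q' x a x' - Q x a x'| ≤ (((c'.M x a x' : ℝ) - c.M x a x') +
          (c'.N x a - c.N x a) * Q x a x') / c'.N x a := fun x' => by
        have e : Q' x a x' - Q x a x' = (((c'.M x a x' : ℝ) - c.M x a x') -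
          (c'.N x a - c.N x a) * Q x a x') / c'.N x a := by
          simp only [hQ', if_neg h]; field_simp; ring
        rw [e, abs_div, abs_of_pos h0]
        refine div_le_div_of_nonneg_right ?_ h0.le
        have h2 := sub_nonneg.2 (hMR x a x')
        have h3 := mul_nonneg hd (hQt.nonneg x a x')
        rw [abs_le]; constructor <;> linarith
      refine (Finset.sum_le_sum fun x' _ => h1 x').trans ?_
      rw [← Finset.sum_div, Finset.sum_add_distrib, Finset.sum_sub_distrib, hsR, hsR',
        ← Finset.mul_sum, hmax x a h, mul_div_assoc', div_le_div_iff_of_pos_right h0]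
      have := mul_le_of_le_one_right hd (hQt.sum_le_one x a)
      linarith

/-- The domain of the primal update moves slowly: an element of the old domain has an element of
the new domain nearby. -/
lemma exists_mem_domain_near [Nonempty A] {T : ℕ} {δ : ℝ} {c c' : Counters X A}
    {q : X → A → X → ℝ}
    (hJ : 0 ≤ Real.log (T * Fintype.card A * Fintype.card X / δ))
    (hq : q ∈ c.domain S T δ) (hN : ∀ x a, c.N x a ≤ c'.N x a)
    (hM : ∀ x a x', c.M x a x' ≤ c'.M x a x') (hs : ∀ x a, ∑ x', c.M x a x' = c.N x a)
    (hs' : ∀ x a, ∑ x', c'.M x a x' = c'.N x a)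
    (hl : ∀ x a x', S.layer x' ≠ S.layer x + 1 → c'.M x a x' = 0) :
    ∃ q' ∈ c'.domain S T δ, occDist S q' q ≤ 2 * L *
      ∑ i ∈ pairs S A, ((c'.N i.1 i.2 : ℝ) - c.N i.1 i.2) / max 1 (c'.N i.1 i.2 : ℝ) := by
  classical
  obtain ⟨Q, hQ, hqQ⟩ := hq
  obtain ⟨Q', hQ', hd⟩ := exists_transition_near hJ hQ hN hM hs hs' hl
  have hqM := isMarg_of_mem_occSet hQ.1 hqQ
  have hA : (0 : ℝ) < Fintype.card A := by exact_mod_cast Fintype.card_pos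
  set π : X → A → ℝ := fun x a => if ∑ a', marg q x a' = 0 then 1 / Fintype.card A
    else policyOf q x a with hπdef
  have hπ : IsPolicy π := by
    refine ⟨fun x a => ?_, fun x => ?_⟩
    · simp only [hπdef]; split_ifs
      · positivity
      · exact (isSubPolicy_policyOf hqM).nonneg x a
    · simp only [hπdef]; split_ifs with h
      · simp
      · simp only [policyOf]
        rw [← Finset.sum_div, div_self h]
  have hqπ : ∀ x a, S.layer x < L → marg q x a = (∑ a', marg q x a') * π x a := by
    intro x a _
    simp only [hπdef]; split_ifs with h
    · rw [h, zero_mul]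
      exact (Finset.sum_eq_zero_iff_of_nonneg fun a _ => hqM.nonneg x a).1 h a (Finset.mem_univ _)
    · rw [policyOf]; field_simp
  refine ⟨occ S Q' π, ⟨Q', hQ', occ_mem_occSet hQ'.1 hπ⟩, ?_⟩
  refine (occDist_occ_le hQ'.1 hQ.1 hqQ hπ.isSubPolicy hqπ).trans ?_
  rw [mul_assoc, mul_comm (2 : ℝ), mul_assoc]
  refine mul_le_mul_of_nonneg_left ?_ (Nat.cast_nonneg _)
  rw [mul_comm, Finset.mul_sum]
  refine Finset.sum_le_sum fun i hi => ?_
  refine le_trans ?_ (hd i.1 i.2)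
  exact mul_le_of_le_one_left (Finset.sum_nonneg fun _ _ => abs_nonneg _)
    (marg_occ_le_one hQ'.1 hπ.isSubPolicy (mem_pairs.1 hi) _)

/-! ### Sums of reciprocals of the counters -/

/-- The function `min 1 n + log n` is a potential for relative increments. -/
lemma sub_div_max_le {a b : ℕ} (h : a ≤ b) : ((b : ℝ) - a) / max 1 (b : ℝ) ≤
    (min 1 (b : ℝ) + Real.log b) - (min 1 (a : ℝ) + Real.log a) := by
  rcases Nat.eq_zero_or_pos b with rfl | hb
  · have : a = 0 := by omega
    subst this; simp
  have hb1 : (1 : ℝ) ≤ b := by exact_mod_cast hb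
  rw [max_eq_right hb1, min_eq_left hb1]
  rcases Nat.eq_zero_or_pos a with rfl | ha
  · have := Real.log_nonneg hb1
    simp only [Nat.cast_zero, sub_zero, Real.log_zero, add_zero]
    rw [div_self (by positivity)]
    simp [this]
  · have ha1 : (1 : ℝ) ≤ a := by exact_mod_cast ha
    rw [min_eq_left ha1]
    have h1 := Real.log_le_sub_one_of_pos (show (0 : ℝ) < a / b by positivity)
    rw [Real.log_div (by positivity) (by positivity)] at h1
    have : ((b : ℝ) - a) / b = 1 - a / b := by field_simp
    rw [this]; linarith

/-- The relative increments of the counters have a logarithmic sum. -/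
lemma sum_counters_increments_le {T : ℕ} (hT : 1 ≤ T) (hτ : ∀ t, t < T → IsPath S (τ (t + 1)))
    {n : ℕ} (hn : n ≤ T) (x : X) (a : A) :
    ∑ t ∈ Finset.range n, ((counters κ τ (t + 1)).N x a - (counters κ τ t).N x a : ℝ) /
      max 1 ((counters κ τ (t + 1)).N x a : ℝ) ≤ 1 + Real.log T := by
  refine (Finset.sum_le_sum fun t _ => sub_div_max_le (counters_mono t x a)).trans ?_
  rw [Finset.sum_range_sub fun t => min 1 ((counters κ τ t).N x a : ℝ) +
    Real.log ((counters κ τ t).N x a)]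
  have h1 : (counters κ τ 0).N x a = 0 := by simp [counters]
  rw [h1]
  have h2 : ((counters κ τ n).N x a : ℝ) ≤ T := by
    exact_mod_cast ((counters_le_total n x a).trans (total_le hτ hn x a)).trans hn
  have h3 : Real.log ((counters κ τ n).N x a : ℝ) ≤ Real.log T := by
    rcases Nat.eq_zero_or_pos ((counters κ τ n).N x a) with h | h
    · rw [h]; simp only [Nat.cast_zero, Real.log_zero]
      exact Real.log_nonneg (by exact_mod_cast hT)
    · exact Real.log_le_log (by exact_mod_cast h) h2
  have h4 : min 1 ((counters κ τ n).N x a : ℝ) ≤ 1 := min_le_left _ _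
  simp only [Nat.cast_zero, Real.log_zero, add_zero]
  have h5 : min (1 : ℝ) 0 = 0 := by simp
  rw [h5]
  linarith

/-- The discrete form of `∫ dn / √n`; each visit raises the total by one. -/
lemma sum_visits_div_sqrt_le {T : ℕ} (hτ : ∀ t, t < T → IsPath S (τ (t + 1))) (x : X) (a : A)
    {n : ℕ} (hn : n ≤ T) :
    ∑ t ∈ Finset.range n, (visits (τ (t + 1)) x a : ℝ) / √(max 1 (total τ t x a : ℝ)) ≤
      3 * √(total τ n x a : ℝ) := by
  induction n with
  | zero => simp
  | succ n ih =>
    rw [Finset.sum_range_succ, total_succ]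
    have ih := ih (by omega)
    have h1 := (hτ n (by omega)).visits_le_one x a
    set k := total τ n x a with hk
    interval_cases h : visits (τ (n + 1)) x a
    · simpa using ih
    · have h2 : (1 : ℝ) / √(max 1 (k : ℝ)) ≤ 3 * √((k + 1 : ℕ) : ℝ) - 3 * √(k : ℝ) := by
        rcases Nat.eq_zero_or_pos k with h0 | h0
        · rw [h0]; simp
        · have hk1 : (1 : ℝ) ≤ k := by exact_mod_cast h0
          rw [max_eq_right hk1]
          have hs : 1 ≤ √(k : ℝ) := Real.one_le_sqrt.2 hk1
          have hsq := Real.sq_sqrt (show (0 : ℝ) ≤ k by positivity)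
          have hsq' := Real.sq_sqrt (show (0 : ℝ) ≤ ((k + 1 : ℕ) : ℝ) by positivity)
          have hle : √((k + 1 : ℕ) : ℝ) ≤ 2 * √(k : ℝ) := by
            rw [Real.sqrt_le_left (by positivity), mul_pow, hsq]
            push_cast; linarith
          have hpos : 0 < √((k + 1 : ℕ) : ℝ) := Real.sqrt_pos.2 (by positivity)
          have hdiff : (√((k + 1 : ℕ) : ℝ) - √(k : ℝ)) * (√((k + 1 : ℕ) : ℝ) + √(k : ℝ)) = 1 := by
            push_cast at hsq' ⊢
            nlinarith
          rw [div_le_iff₀ (by positivity)]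
          have hdn : 0 ≤ √((k + 1 : ℕ) : ℝ) - √(k : ℝ) := by
            rw [sub_nonneg]; apply Real.sqrt_le_sqrt; push_cast; linarith
          nlinarith
      push_cast at h2 ih ⊢
      linarith

lemma sum_card_level (S : Layering X L) :
    ∑ l ∈ Finset.range (L + 1), (S.level l).card = Fintype.card X := by
  classical
  rw [← Finset.card_univ, Finset.card_eq_sum_card_fiberwise (s := Finset.univ)
    (t := Finset.range (L + 1)) (f := S.layer)
    (fun x _ => by simpa using Nat.lt_succ_iff.2 (S.layer_le x))]
  rfl

/-- Cauchy-Schwarz within each layer, where the visits add up to `T`. -/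
lemma sum_sqrt_total_le {T : ℕ} (hτ : ∀ t, t < T → IsPath S (τ (t + 1))) :
    ∑ i ∈ pairs S A, √((S.level (S.layer i.1 + 1)).card : ℝ) * √(total τ T i.1 i.2 : ℝ) ≤
      Fintype.card X * √(T * Fintype.card A) := by
  rw [← sum_levels_eq S fun x a =>
    √((S.level (S.layer x + 1)).card : ℝ) * √(total τ T x a : ℝ)]
  have h1 : ∀ l ∈ Finset.range L, ∑ x ∈ S.level l, ∑ a,
      √((S.level (S.layer x + 1)).card : ℝ) * √(total τ T x a : ℝ) ≤
      √(T * Fintype.card A) * ((((S.level l).card : ℝ) + (S.level (l + 1)).card) / 2) := by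
    intro l hl
    have hl' := Finset.mem_range.1 hl
    have h2 : ∑ x ∈ S.level l, ∑ a,
        √((S.level (S.layer x + 1)).card : ℝ) * √(total τ T x a : ℝ) =
        ∑ i ∈ S.level l ×ˢ (Finset.univ : Finset A),
          √((S.level (l + 1)).card : ℝ) * √(total τ T i.1 i.2 : ℝ) := by
      rw [Finset.sum_product]
      refine Finset.sum_congr rfl fun x hx => ?_
      rw [mem_level.1 hx]
    rw [h2]
    refine (Real.sum_sqrt_mul_sqrt_le _ (fun _ => Nat.cast_nonneg _)
      (fun _ => Nat.cast_nonneg _)).trans ?_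
    have h3 : ∑ i ∈ S.level l ×ˢ (Finset.univ : Finset A), (total τ T i.1 i.2 : ℝ) = T := by
      rw [Finset.sum_product]
      exact_mod_cast sum_total_level hτ hl'
    rw [h3, Finset.sum_const, nsmul_eq_mul, Finset.card_product, Finset.card_univ]
    push_cast
    set u := ((S.level l).card : ℝ)
    set v := ((S.level (l + 1)).card : ℝ)
    have hu : 0 ≤ u := Nat.cast_nonneg _
    have hv : 0 ≤ v := Nat.cast_nonneg _
    have h4 : √(u * (Fintype.card A) * v) * √(T : ℝ) = √(T * Fintype.card A) * √(u * v) := by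
      rw [← Real.sqrt_mul (by positivity), ← Real.sqrt_mul (by positivity)]
      congr 1; ring
    rw [h4]
    refine mul_le_mul_of_nonneg_left ?_ (Real.sqrt_nonneg _)
    rw [Real.sqrt_le_left (by positivity)]
    nlinarith [sq_nonneg (u - v)]
  refine (Finset.sum_le_sum h1).trans ?_
  rw [← Finset.mul_sum, mul_comm]
  refine mul_le_mul_of_nonneg_right ?_ (Real.sqrt_nonneg _)
  rw [← Finset.sum_div, Finset.sum_add_distrib]
  have h5 : (∑ l ∈ Finset.range L, ((S.level l).card : ℝ)) ≤ Fintype.card X := by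
    rw [← sum_card_level S]; push_cast
    rw [Finset.sum_range_succ]
    exact le_add_of_nonneg_right (Nat.cast_nonneg _)
  have h6 : (∑ l ∈ Finset.range L, ((S.level (l + 1)).card : ℝ)) ≤ Fintype.card X := by
    rw [← sum_card_level S]; push_cast
    rw [Finset.sum_range_succ']
    exact le_add_of_nonneg_right (Nat.cast_nonneg _)
  linarith

end Counters

/-! ### Mirror descent along one run of one player -/

section Path

variable {X A : Type*} [Fintype X] [Fintype A] {L : ℕ}

/-- One realization of the algorithm from the point of view of one player, who minimizes the linear
losses `c t` under the constraint `⟨q, g t⟩ ≤ b`.  The action of the other player enters only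
through `c`.  For the max-player `c t` is minus the reward, hence losses in `[-1, 1]`. -/
structure PlayerPath (S : Layering X L) (b : ℝ) (T κ : ℕ) (δ : ℝ) (τ : ℕ → Traj X A L)
    (q : ℕ → X → A → X → ℝ) (lam : ℕ → ℝ) (g c : ℕ → X → A → ℝ) : Prop where
  b_mem : b ∈ Set.Ioc (0 : ℝ) L
  path : ∀ t, t < T → IsPath S (τ (t + 1))
  g_mem : ∀ t x a, g t x a ∈ Set.Icc (0 : ℝ) 1
  c_le : ∀ t, t < T → ∀ x a, |c t x a| ≤ 1
  q_zero : q 0 = uniformOcc S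
  lam_zero : lam 0 = 0
  mem : ∀ t, t < T → q (t + 1) ∈ (counters κ τ t).domain S T δ
  opt : ∀ t, t < T → ∀ q' ∈ (counters κ τ t).domain S T δ,
    L * √T * utility S (q (t + 1)) (c t) + lam t * utility S (q (t + 1)) (g t) +
        T * L * kl S (marg (q (t + 1))) (mix S (1 / T) (q t)) ≤
      L * √T * utility S q' (c t) + lam t * utility S q' (g t) +
        T * L * kl S (marg q') (mix S (1 / T) (q t))
  dual : ∀ t, t < T → lam (t + 1) = max (lam t + (utility S (q (t + 1)) (g t) - b)) 0

/-- The numerical conditions under which the analysis runs; `J` is the logarithmic factor. -/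
structure Params (X A : Type*) [Fintype X] [Fintype A] (L T : ℕ) (δ J : ℝ) : Prop where
  L_pos : 1 ≤ L
  T_two : 2 ≤ T
  card_le : Fintype.card X * Fintype.card A ≤ T
  J_one : 1 ≤ J
  J_eq : J = Real.log (T * Fintype.card A * Fintype.card X / δ)
  J_exp : (T * (Fintype.card X * Fintype.card A) : ℝ) ≤ Real.exp J
  J_log : Real.log T ≤ J

variable {S : Layering X L} {b : ℝ} {T κ : ℕ} {δ J : ℝ} {τ : ℕ → Traj X A L}
  {q : ℕ → X → A → X → ℝ} {lam : ℕ → ℝ} {g c : ℕ → X → A → ℝ}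

lemma utility_eq_utility_add (S : Layering X L) (q : X → A → X → ℝ) (u v : ℝ)
    (g c : X → A → ℝ) :
    utility S q (fun x a => u * c x a + v * g x a) = u * utility S q c + v * utility S q g := by
  simp only [utility_eq, Finset.mul_sum, ← Finset.sum_add_distrib]
  exact Finset.sum_congr rfl fun i _ => by ring

lemma IsMarg.abs_utility_le {q : X → A → X → ℝ} (hq : IsMarg S q) {c : X → A → ℝ}
    (hc : ∀ x a, |c x a| ≤ 1) : |utility S q c| ≤ L := by
  rw [utility_eq, ← hq.sum_pairs]
  refine (Finset.abs_sum_le_sum_abs _ _).trans (Finset.sum_le_sum fun i _ => ?_)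
  rw [abs_mul, abs_of_nonneg (hq.nonneg _ _)]
  exact mul_le_of_le_one_right (hq.nonneg _ _) (hc _ _)

namespace PlayerPath

variable (H : PlayerPath S b T κ δ τ q lam g c) (hp : Params X A L T δ J)

include H hp

lemma isMarg_succ {t : ℕ} (ht : t < T) : IsMarg S (q (t + 1)) :=
  Counters.isMarg_of_mem_domain (H.mem t ht)

lemma level_nonempty {l : ℕ} (hl : l ≤ L) : (S.level l).Nonempty :=
  (H.isMarg_succ hp (t := 0) (by have := hp.T_two; omega)).level_nonempty hl

lemma nonempty_action : Nonempty A :=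
  (H.isMarg_succ hp (t := 0) (by have := hp.T_two; omega)).nonempty_action hp.L_pos

lemma L_lt_card : L + 1 ≤ Fintype.card X :=
  (H.isMarg_succ hp (t := 0) (by have := hp.T_two; omega)).succ_le_card

lemma isMarg {t : ℕ} (ht : t ≤ T) : IsMarg S (q t) := by
  cases t with
  | zero =>
    have := H.nonempty_action hp
    rw [H.q_zero]; exact isMarg_uniformOcc fun l hl => H.level_nonempty hp hl
  | succ t => exact H.isMarg_succ hp ht

lemma theta_pos : (0 : ℝ) < 1 / T := by
  have : 0 < T := by have := hp.T_two; omega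
  positivity

lemma theta_le : (1 : ℝ) / T ≤ 1 / 2 := by
  have : (2 : ℝ) ≤ T := by exact_mod_cast hp.T_two
  gcongr

lemma lam_nonneg {t : ℕ} (ht : t ≤ T) : 0 ≤ lam t := by
  cases t with
  | zero => rw [H.lam_zero]
  | succ t => rw [H.dual t ht]; exact le_max_right _ _

lemma mix_pos {t : ℕ} (ht : t ≤ T) (x : X) (a : A) : 0 < mix S (1 / T) (q t) x a := by
  have := H.nonempty_action hp
  exact ConstrainedMG.mix_pos (H.theta_pos hp) (by linarith [H.theta_le hp]) (H.isMarg hp ht) x a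

/-- The three-point inequality for the primal update. -/
lemma one_step {t : ℕ} (ht : t < T) {q' : X → A → X → ℝ}
    (hq' : q' ∈ (counters κ τ t).domain S T δ) {a : ℝ} (ha : 0 < a) (ha' : a < 1) :
    L * √T * (utility S (q (t + 1)) (c t) - utility S q' (c t)) +
        lam t * (utility S (q (t + 1)) (g t) - utility S q' (g t)) ≤
      T * L * (relEnt (pairs S A) (fun i => marg q' i.1 i.2)
          (fun i => mix S (1 / T) (q t) i.1 i.2) -
        relEnt (pairs S A) (fun i => marg (q (t + 1)) i.1 i.2)
          (fun i => mix S (1 / T) (q t) i.1 i.2) -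
        relEnt (pairs S A) (fun i => marg q' i.1 i.2)
          (fun i => (1 - a) * marg (q (t + 1)) i.1 i.2 + a * marg q' i.1 i.2)) := by
  have hw := H.isMarg_succ hp ht
  have hqm := Counters.isMarg_of_mem_domain hq'
  have hTL : (0 : ℝ) < T * L := by
    have h1 : (0 : ℝ) < T := by have := hp.T_two; positivity
    have h2 : (0 : ℝ) < L := by have := hp.L_pos; positivity
    positivity
  have hopt := H.opt t ht _ (Counters.domain_convex (H.mem t ht) hq' ha.le ha'.le)
  rw [← utility_eq_utility_add, ← utility_eq_utility_add, kl_eq, kl_eq, utility_eq,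
    utility_eq] at hopt
  simp only [marg_add_smul] at hopt
  have := mirror_step (s := pairs S A) (w := fun i => marg (q (t + 1)) i.1 i.2)
    (q := fun i => marg q' i.1 i.2) (v := fun i => mix S (1 / T) (q t) i.1 i.2)
    (l := fun i => L * √T * c t i.1 i.2 + lam t * g t i.1 i.2) ha ha' hTL
    (fun i _ => hw.nonneg _ _) (fun i _ => hqm.nonneg _ _)
    (fun i _ => H.mix_pos hp ht.le _ _) (by
      simpa only [mul_comm] using hopt)
  refine le_trans (le_of_eq ?_) this
  have e : ∀ p : X → A → X → ℝ, ∑ i ∈ pairs S A,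
      (L * √T * c t i.1 i.2 + lam t * g t i.1 i.2) * marg p i.1 i.2 =
      L * √T * utility S p (c t) + lam t * utility S p (g t) := fun p => by
    rw [← utility_eq_utility_add, utility_eq]
    exact Finset.sum_congr rfl fun i _ => mul_comm _ _
  simp only [mul_sub, Finset.sum_sub_distrib, e]
  ring

/-- The entropy of a comparator relative to the mixed iterate serves as a potential.  The mixing
keeps it bounded and costs only `3 L²` per episode. -/
lemma one_step_potential {t : ℕ} (ht : t < T) {q' : X → A → X → ℝ}
    (hq' : q' ∈ (counters κ τ t).domain S T δ) :
    L * √T * (utility S (q (t + 1)) (c t) - utility S q' (c t)) +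
        lam t * (utility S (q (t + 1)) (g t) - utility S q' (g t)) ≤
      T * L * (relEnt (pairs S A) (fun i => marg q' i.1 i.2)
          (fun i => mix S (1 / T) (q t) i.1 i.2) -
        relEnt (pairs S A) (fun i => marg q' i.1 i.2)
          (fun i => mix S (1 / T) (q (t + 1)) i.1 i.2)) + 3 * (L : ℝ) ^ 2 := by
  have hA := H.nonempty_action hp
  have hw := H.isMarg_succ hp ht
  have hqm := Counters.isMarg_of_mem_domain hq'
  have hT0 : (0 : ℝ) < T := by have := hp.T_two; positivity
  have hTL : (0 : ℝ) ≤ T * L := by positivity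
  set θ : ℝ := 1 / T with hθ
  have hθ0 : 0 < θ := H.theta_pos hp
  have hθ2 : θ ≤ 1 / 2 := H.theta_le hp
  have hX : (0 : ℝ) < Fintype.card X := by
    have := H.L_lt_card hp
    exact_mod_cast (by omega : 0 < Fintype.card X)
  have hAc : (0 : ℝ) < Fintype.card A := by exact_mod_cast Fintype.card_pos
  set m : ℝ := θ / (Fintype.card X * Fintype.card A) with hm
  have hm0 : 0 < m := by positivity
  have hm1 : m ≤ θ := div_le_self hθ0.le (by
    have h1 : (1 : ℝ) ≤ Fintype.card X := by
      have := H.L_lt_card hp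
      exact_mod_cast (by omega : 1 ≤ Fintype.card X)
    have h2 : (1 : ℝ) ≤ Fintype.card A := by exact_mod_cast Fintype.card_pos
    nlinarith)
  -- the weight of the comparator is small compared to the smallest value of the mixed iterate
  have ha0 : 0 < θ * m := by positivity
  have ha1 : θ * m < 1 := by nlinarith
  have h1 := H.one_step hp ht hq' ha0 ha1
  have h2 : 0 ≤ relEnt (pairs S A) (fun i => marg (q (t + 1)) i.1 i.2)
      (fun i => mix S θ (q t) i.1 i.2) :=
    relEnt_nonneg (fun i _ => hw.nonneg _ _) (fun i _ => (H.mix_pos hp ht.le _ _).le)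
      (fun i _ h => absurd h (H.mix_pos hp ht.le _ _).ne')
  have h3 := relEnt_le_of_le_mul (s := pairs S A) (q := fun i => marg q' i.1 i.2)
    (z := fun i => (1 - θ * m) * marg (q (t + 1)) i.1 i.2 + θ * m * marg q' i.1 i.2)
    (v := fun i => mix S θ (q (t + 1)) i.1 i.2) (c := 3 * θ)
    (fun i _ => hqm.nonneg _ _)
    (fun i _ h => by
      have := lt_of_le_of_ne (hqm.nonneg i.1 i.2) (Ne.symm h)
      have h5 := hw.nonneg i.1 i.2
      have : 0 < 1 - θ * m := by linarith
      positivity)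
    (fun i _ => H.mix_pos hp ht _ _)
    (fun i hi => by
      have h4 := le_mix hθ0.le (by linarith) hw i.1 i.2
      have h5 := le_mix' (S := S) (q := q (t + 1)) hθ0.le i.1 i.2
      have h6 := hqm.le_one i.2 (mem_pairs.1 hi)
      have h7 := hw.nonneg i.1 i.2
      have h8 : θ * m * marg q' i.1 i.2 ≤ θ * m := mul_le_of_le_one_right ha0.le h6
      have h9 : (1 - θ * m) * marg (q (t + 1)) i.1 i.2 ≤ marg (q (t + 1)) i.1 i.2 :=
        mul_le_of_le_one_left h7 (by linarith)
      have h10 : θ * m ≤ θ * mix S θ (q (t + 1)) i.1 i.2 := mul_le_mul_of_nonneg_left h4 hθ0.le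
      have h11 : marg (q (t + 1)) i.1 i.2 ≤ (1 + 2 * θ) * mix S θ (q (t + 1)) i.1 i.2 := by
        have h12 := mul_le_mul_of_nonneg_left h5 (show 0 ≤ 1 + 2 * θ by linarith)
        have h13 : 1 ≤ (1 + 2 * θ) * (1 - θ) := by nlinarith
        have h14 := mul_le_mul_of_nonneg_right h13 h7
        nlinarith
      calc _ ≤ marg (q (t + 1)) i.1 i.2 + θ * m := add_le_add h9 h8
        _ ≤ _ := by linarith)
    (by
      rw [sum_mix (fun l hl => H.level_nonempty hp hl) hw, Finset.sum_add_distrib,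
        ← Finset.mul_sum, ← Finset.mul_sum, hw.sum_pairs, hqm.sum_pairs]
      ring)
  rw [hqm.sum_pairs] at h3
  have h4 : T * L * (3 * θ * L) = 3 * (L : ℝ) ^ 2 := by rw [hθ]; field_simp
  refine h1.trans ?_
  rw [← h4, ← mul_add]
  exact mul_le_mul_of_nonneg_left (by linarith) hTL

lemma le_exp_mul_mix {t : ℕ} (ht : t ≤ T) (x : X) (a : A) :
    1 ≤ Real.exp J * mix S (1 / T) (q t) x a := by
  have hA := H.nonempty_action hp
  have h1 := le_mix (H.theta_pos hp).le (by linarith [H.theta_le hp]) (H.isMarg hp ht) x a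
  have hX : (0 : ℝ) < Fintype.card X := by
    have := H.L_lt_card hp
    exact_mod_cast (by omega : 0 < Fintype.card X)
  have hAc : (0 : ℝ) < Fintype.card A := by exact_mod_cast Fintype.card_pos
  have hT0 : (0 : ℝ) < T := by have := hp.T_two; positivity
  calc (1 : ℝ) = (T * (Fintype.card X * Fintype.card A)) *
        (1 / T / (Fintype.card X * Fintype.card A)) := by field_simp
    _ ≤ _ := mul_le_mul hp.J_exp h1 (by positivity) (Real.exp_nonneg _)

lemma potential_le {t : ℕ} (ht : t ≤ T) {q' : X → A → X → ℝ} (hq' : IsMarg S q') :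
    relEnt (pairs S A) (fun i => marg q' i.1 i.2) (fun i => mix S (1 / T) (q t) i.1 i.2) ≤
      L * J := by
  have hA := H.nonempty_action hp
  exact relEnt_le_mass (fun _ _ => hq'.nonneg _ _) (fun _ _ => H.mix_pos hp ht _ _)
    (fun i hi => (hq'.le_one i.2 (mem_pairs.1 hi)).trans (H.le_exp_mul_mix hp ht _ _))
    hq'.sum_pairs (sum_mix (fun l hl => H.level_nonempty hp hl) (H.isMarg hp ht) _)

lemma potential_nonneg {t : ℕ} (ht : t ≤ T) {q' : X → A → X → ℝ} (hq' : IsMarg S q') :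
    0 ≤ relEnt (pairs S A) (fun i => marg q' i.1 i.2)
      (fun i => mix S (1 / T) (q t) i.1 i.2) :=
  relEnt_nonneg (fun _ _ => hq'.nonneg _ _) (fun _ _ => (H.mix_pos hp ht _ _).le)
    (fun _ _ h => absurd h (H.mix_pos hp ht _ _).ne')

lemma abs_constraint_le {t : ℕ} (ht : t < T) : |utility S (q (t + 1)) (g t) - b| ≤ L := by
  have hw := H.isMarg_succ hp ht
  have h1 := hw.utility_nonneg fun x a => (H.g_mem t x a).1
  have h2 := hw.utility_le fun x a => (H.g_mem t x a).2
  have h3 := H.b_mem.1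
  have h4 := H.b_mem.2
  rw [abs_le]; constructor <;> linarith

lemma lam_succ_le {t : ℕ} (ht : t < T) : lam (t + 1) ≤ lam t + L := by
  have h1 := abs_le.1 (H.abs_constraint_le hp ht)
  have h2 := H.lam_nonneg hp ht.le
  have h3 : (0 : ℝ) ≤ L := Nat.cast_nonneg _
  rw [H.dual t ht]
  exact max_le (by linarith) (by linarith)

lemma lam_sq_succ_le {t : ℕ} (ht : t < T) :
    (lam (t + 1) ^ 2 - lam t ^ 2) / 2 ≤
      (L : ℝ) ^ 2 / 2 + lam t * (utility S (q (t + 1)) (g t) - b) := by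
  set e := utility S (q (t + 1)) (g t) - b with he
  have h1 : e ^ 2 ≤ (L : ℝ) ^ 2 := sq_le_sq' (by have := abs_le.1 (H.abs_constraint_le hp ht); linarith)
    (abs_le.1 (H.abs_constraint_le hp ht)).2
  have h2 : lam (t + 1) ^ 2 ≤ (lam t + e) ^ 2 := by
    rw [H.dual t ht]
    rcases le_total (lam t + e) 0 with h | h
    · rw [max_eq_right h]; simpa using sq_nonneg (lam t + e)
    · rw [max_eq_left h]
  nlinarith

/-- Drift of the dual variable and regret of the primal variable, against a comparator that belongs
to all the domains, over a window of episodes. -/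
lemma drift {q' : X → A → X → ℝ} (hq' : ∀ u, u < T → q' ∈ (counters κ τ u).domain S T δ)
    {s t : ℕ} (hst : s ≤ t) (ht : t ≤ T) :
    (lam t ^ 2 - lam s ^ 2) / 2 + L * √T * ∑ u ∈ Finset.Ico s t,
        (utility S (q (u + 1)) (c u) - utility S q' (c u)) ≤
      ((t : ℝ) - s) * (7 / 2 * (L : ℝ) ^ 2) + T * (L : ℝ) ^ 2 * J +
        ∑ u ∈ Finset.Ico s t, lam u * (utility S q' (g u) - b) := by
  have hqm : IsMarg S q' := Counters.isMarg_of_mem_domain (hq' 0 (by have := hp.T_two; omega))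
  set Φ : ℕ → ℝ := fun u => relEnt (pairs S A) (fun i => marg q' i.1 i.2)
    (fun i => mix S (1 / T) (q u) i.1 i.2) with hΦ
  have hmain : (lam t ^ 2 - lam s ^ 2) / 2 + L * √T * ∑ u ∈ Finset.Ico s t,
        (utility S (q (u + 1)) (c u) - utility S q' (c u)) ≤
      ((t : ℝ) - s) * (7 / 2 * (L : ℝ) ^ 2) + T * L * (Φ s - Φ t) +
        ∑ u ∈ Finset.Ico s t, lam u * (utility S q' (g u) - b) := by
    induction t, hst using Nat.le_induction with
    | base => simp
    | succ t hst ih =>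
      rw [Finset.sum_Ico_succ_top hst, Finset.sum_Ico_succ_top hst]
      have h1 := ih (by omega)
      have h2 := H.one_step_potential hp (t := t) (by omega) (hq' t (by omega))
      have h3 := H.lam_sq_succ_le hp (t := t) (by omega)
      change _ ≤ T * L * (Φ t - Φ (t + 1)) + _ at h2
      push_cast
      nlinarith
  have h1 : Φ s - Φ t ≤ L * J := by
    linarith [H.potential_le hp (hst.trans ht) hqm, H.potential_nonneg hp ht hqm]
  have h2 : T * L * (Φ s - Φ t) ≤ T * L * (L * J) := mul_le_mul_of_nonneg_left h1 (by positivity)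
  nlinarith

/-! ### Boundedness of the dual variable -/

/-- In a window on which the dual variable lies between `Λ / 2` and `Λ`, the negative drift
`-ξ Λ / 2` due to strict feasibility beats everything else. -/
lemma lam_le_of_window {q' : X → A → X → ℝ}
    (hq' : ∀ u, u < T → q' ∈ (counters κ τ u).domain S T δ)
    {ξ : ℝ} (hξ : 0 < ξ) {g₀ : X → A → ℝ} (hfeas : utility S q' g₀ + ξ ≤ b) {Λ : ℝ}
    (hΛ0 : 0 < Λ) (hLΛ : (L : ℝ) ≤ Λ / 100)
    (hdrift : 7 / 2 * (L : ℝ) ^ 2 + 2 * (L ^ 2 * √T) ≤ ξ * Λ / 4)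
    (h6 : T * (L : ℝ) ^ 2 * J ≤ Λ ^ 2 / 10000)
    (h7 : 6 * J * Λ * (L : ℝ) ^ 2 / ξ ≤ 6 / 100 * Λ ^ 2)
    {s t : ℕ} (hst : s ≤ t) (ht : t ≤ T)
    (hnoise : ∑ u ∈ Finset.Ico s t,
      (if lam u ≤ Λ then lam u else 0) * (utility S q' (g u) - utility S q' g₀) ≤
        ξ * Λ / 4 * ((t : ℝ) - s) + 6 * J * Λ * (L : ℝ) ^ 2 / ξ)
    (hls : lam s ≤ Λ / 2 + L) (hu : ∀ u, s ≤ u → u < t → Λ / 2 < lam u ∧ lam u ≤ Λ) :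
    lam t ≤ Λ := by
  have hqm : IsMarg S q' := Counters.isMarg_of_mem_domain (hq' 0 (by have := hp.T_two; omega))
  have h1 := H.drift hp hq' hst ht
  have hn : (0 : ℝ) ≤ (t : ℝ) - s := by
    have : (s : ℝ) ≤ t := by exact_mod_cast hst
    linarith
  have hcard : ((Finset.Ico s t).card : ℝ) = (t : ℝ) - s := by
    rw [Nat.card_Ico, Nat.cast_sub hst]
  have h2 : -(((t : ℝ) - s) * (2 * L)) ≤ ∑ u ∈ Finset.Ico s t,
      (utility S (q (u + 1)) (c u) - utility S q' (c u)) := by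
    rw [← hcard, ← mul_neg, ← nsmul_eq_mul, ← Finset.sum_const]
    refine Finset.sum_le_sum fun u hu' => ?_
    have hut : u < T := by have := (Finset.mem_Ico.1 hu').2; omega
    have h3 := abs_le.1 ((H.isMarg_succ hp hut).abs_utility_le (H.c_le u hut))
    have h4 := abs_le.1 (hqm.abs_utility_le (H.c_le u hut))
    linarith
  have h3 : ∑ u ∈ Finset.Ico s t, lam u * (utility S q' (g u) - b) ≤
      ξ * Λ / 4 * ((t : ℝ) - s) + 6 * J * Λ * (L : ℝ) ^ 2 / ξ -
        ((t : ℝ) - s) * (ξ * Λ / 2) := by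
    have h4 := hnoise
    have h5 : ∑ u ∈ Finset.Ico s t, lam u * (utility S q' (g u) - b) ≤
        ∑ u ∈ Finset.Ico s t, ((if lam u ≤ Λ then lam u else 0) *
          (utility S q' (g u) - utility S q' g₀) - ξ * Λ / 2) := by
      refine Finset.sum_le_sum fun u hu' => ?_
      have h6 := Finset.mem_Ico.1 hu'
      obtain ⟨h7, h8⟩ := hu u h6.1 h6.2
      rw [if_pos h8]
      have h9 : lam u * ξ ≤ lam u * (b - utility S q' g₀) :=
        mul_le_mul_of_nonneg_left (by linarith) (by linarith)
      have h10 : ξ * Λ / 2 ≤ lam u * ξ := by nlinarith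
      linarith
    rw [Finset.sum_sub_distrib, Finset.sum_const, nsmul_eq_mul, hcard] at h5
    linarith
  have h4 : L * √T * -(((t : ℝ) - s) * (2 * L)) ≤ L * √T * ∑ u ∈ Finset.Ico s t,
      (utility S (q (u + 1)) (c u) - utility S q' (c u)) :=
    mul_le_mul_of_nonneg_left h2 (by positivity)
  have h5 : ((t : ℝ) - s) * (7 / 2 * (L : ℝ) ^ 2 + 2 * (L ^ 2 * √T) - ξ * Λ / 4) ≤ 0 :=
    mul_nonpos_of_nonneg_of_nonpos hn (by linarith)
  have h8 : lam s ^ 2 ≤ (51 / 100 * Λ) ^ 2 := by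
    have h9 := H.lam_nonneg hp (hst.trans ht)
    have : lam s ≤ 51 / 100 * Λ := by linarith
    gcongr
  have h9 : lam t ^ 2 ≤ Λ ^ 2 := by linarith [sq_nonneg Λ]
  exact (abs_le_of_sq_le_sq' h9 hΛ0.le).2

/-- Strict feasibility keeps the dual variable bounded, as long as the noise of the utilities at the
strictly feasible point `q'` is controlled in each window. -/
lemma lam_le {q' : X → A → X → ℝ} (hq' : ∀ u, u < T → q' ∈ (counters κ τ u).domain S T δ)
    {ξ : ℝ} (hξ : 0 < ξ) {g₀ : X → A → ℝ} (hfeas : utility S q' g₀ + ξ ≤ b) {Λ : ℝ}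
    (hΛ : Λ = 100 * (1 + 1 / ξ) * ((L : ℝ) ^ 2 * √T * J))
    (hnoise : ∀ s t, 1 ≤ s → s ≤ t → t ≤ T → ∑ u ∈ Finset.Ico s t,
      (if lam u ≤ Λ then lam u else 0) * (utility S q' (g u) - utility S q' g₀) ≤
        ξ * Λ / 4 * ((t : ℝ) - s) + 6 * J * Λ * (L : ℝ) ^ 2 / ξ)
    {t : ℕ} (ht : t ≤ T) : lam t ≤ Λ := by
  have hJ := hp.J_one
  have hL1 : (1 : ℝ) ≤ L := by exact_mod_cast hp.L_pos
  have hT2 : (2 : ℝ) ≤ T := by exact_mod_cast hp.T_two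
  have hsT : 1 ≤ √(T : ℝ) := Real.one_le_sqrt.2 (by linarith)
  have hsT2 : √(T : ℝ) ^ 2 = T := Real.sq_sqrt (by linarith)
  set R : ℝ := (L : ℝ) ^ 2 * √T * J with hR
  have hL2 : (L : ℝ) ≤ (L : ℝ) ^ 2 := by nlinarith
  have hLT : (L : ℝ) ^ 2 ≤ (L : ℝ) ^ 2 * √T := le_mul_of_one_le_right (by positivity) hsT
  have hLTR : (L : ℝ) ^ 2 * √T ≤ R := le_mul_of_one_le_right (by positivity) hJ
  have hRpos : 1 ≤ R := by linarith
  have hξi : 0 < 1 / ξ := by positivity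
  have hΛ1 : 100 * R ≤ Λ := by rw [hΛ]; nlinarith
  have hΛξ : 100 * R ≤ ξ * Λ := by
    have : ξ * Λ = 100 * R * (ξ + 1) := by rw [hΛ]; field_simp
    rw [this]; nlinarith
  have hΛξ' : 100 * (L : ℝ) ^ 2 * J / ξ ≤ Λ := by
    have h1 : (L : ℝ) ^ 2 * J ≤ R := by rw [hR]; nlinarith
    have h2 : 100 * (L : ℝ) ^ 2 * J / ξ = 100 * (1 / ξ) * ((L : ℝ) ^ 2 * J) := by
      field_simp
    rw [h2, hΛ]
    have h3 : 100 * (1 / ξ) * ((L : ℝ) ^ 2 * J) ≤ 100 * (1 / ξ) * R := by gcongr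
    nlinarith
  have hΛ0 : 0 < Λ := by linarith
  have h6 : T * (L : ℝ) ^ 2 * J ≤ Λ ^ 2 / 10000 := by
    have h7 : T * (L : ℝ) ^ 2 * J ≤ R ^ 2 := by
      have : R ^ 2 = T * (L : ℝ) ^ 2 * J * (L ^ 2 * J) := by
        rw [hR]; calc _ = √(T : ℝ) ^ 2 * ((L : ℝ) ^ 2 * J * ((L : ℝ) ^ 2 * J)) := by ring
          _ = _ := by rw [hsT2]; ring
      rw [this]
      refine le_mul_of_one_le_right (by positivity) ?_
      nlinarith
    have h8 : (100 * R) ^ 2 ≤ Λ ^ 2 := by gcongr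
    nlinarith
  have h7 : 6 * J * Λ * (L : ℝ) ^ 2 / ξ ≤ 6 / 100 * Λ ^ 2 := by
    have : 6 * J * Λ * (L : ℝ) ^ 2 / ξ = 6 / 100 * Λ * (100 * (L : ℝ) ^ 2 * J / ξ) := by
      field_simp
    have h8 : 6 / 100 * Λ ^ 2 = 6 / 100 * Λ * Λ := by ring
    rw [this, h8]
    exact mul_le_mul_of_nonneg_left hΛξ' (by positivity)
  have hwindow : ∀ s t, 1 ≤ s → s ≤ t → t ≤ T → lam s ≤ Λ / 2 + L →
      (∀ u, s ≤ u → u < t → Λ / 2 < lam u ∧ lam u ≤ Λ) → lam t ≤ Λ :=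
    fun s t hs hst ht hls hu => H.lam_le_of_window hp hq' hξ hfeas hΛ0 (by linarith)
      (by linarith) h6 h7 hst ht (hnoise s t hs hst ht) hls hu
  have hclaim : ∀ t, 1 ≤ t → t ≤ T → ∃ s, 1 ≤ s ∧ s ≤ t ∧ lam s ≤ Λ / 2 + L ∧
      ∀ u, s ≤ u → u < t → Λ / 2 < lam u ∧ lam u ≤ Λ := by
    intro t ht1
    induction t, ht1 using Nat.le_induction with
    | base =>
      intro hT
      refine ⟨1, le_rfl, le_rfl, ?_, fun u h1 h2 => by omega⟩
      have h1 := H.lam_succ_le hp (t := 0) (by omega)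
      rw [H.lam_zero] at h1
      simp only [zero_add] at h1
      linarith
    | succ t ht1 ih =>
      intro hT
      obtain ⟨s, hs1, hst, hls, hu⟩ := ih (by omega)
      have hlt := hwindow s t hs1 hst (by omega) hls hu
      rcases le_or_gt (lam t) (Λ / 2) with h | h
      · refine ⟨t + 1, by omega, le_rfl, ?_, fun u h1 h2 => by omega⟩
        have := H.lam_succ_le hp (t := t) (by omega)
        linarith
      · refine ⟨s, hs1, by omega, hls, fun u h1 h2 => ?_⟩
        rcases (Nat.lt_succ_iff.1 h2).lt_or_eq with h3 | rfl
        · exact hu u h1 h3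
        · exact ⟨h, hlt⟩
  rcases Nat.eq_zero_or_pos t with rfl | ht0
  · rw [H.lam_zero]; exact hΛ0.le
  · obtain ⟨s, hs1, hst, hls, hu⟩ := hclaim t ht0 ht
    exact hwindow s t hs1 hst ht hls hu

/-- The regret of the iterates, each charged with the loss that it has already seen. -/
lemma regret_succ_le {q' : X → A → X → ℝ}
    (hq' : ∀ u, u < T → q' ∈ (counters κ τ u).domain S T δ)
    {g₀ : X → A → ℝ} (hfeas : utility S q' g₀ ≤ b) {Λ : ℝ} (hlam : ∀ t, t ≤ T → lam t ≤ Λ)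
    (hnoise : ∑ u ∈ Finset.Ico 1 T,
      (if lam u ≤ Λ then lam u else 0) * (utility S q' (g u) - utility S q' g₀) ≤
        Λ * L * √T * (1 / 2 + 3 * J)) :
    ∑ u ∈ Finset.range T, (utility S (q (u + 1)) (c u) - utility S q' (c u)) ≤
      9 / 2 * (L * √T * J) + 7 / 2 * (Λ * J) := by
  have hJ := hp.J_one
  have hL1 : (1 : ℝ) ≤ L := by exact_mod_cast hp.L_pos
  have hT2 : (2 : ℝ) ≤ T := by exact_mod_cast hp.T_two
  have hsT : 1 ≤ √(T : ℝ) := Real.one_le_sqrt.2 (by linarith)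
  have hsT2 : √(T : ℝ) ^ 2 = T := Real.sq_sqrt (by linarith)
  have hΛ0 : 0 ≤ Λ := by have := hlam 0 (Nat.zero_le _); rwa [H.lam_zero] at this
  have h1 := H.drift hp hq' (Nat.zero_le T) le_rfl
  have h2 : ∑ u ∈ Finset.Ico 0 T, lam u * (utility S q' (g u) - b) ≤
      Λ * L * √T * (1 / 2 + 3 * J) := by
    have hT1 : 0 < T := by have := hp.T_two; omega
    rw [← Finset.sum_Ioo_add_eq_sum_Ico hT1, H.lam_zero, zero_mul, add_zero]
    refine le_trans ?_ hnoise
    rw [show Finset.Ioo 0 T = Finset.Ico 1 T by ext; simp [Nat.succ_le_iff]]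
    refine Finset.sum_le_sum fun u hu => ?_
    have hu' := (Finset.mem_Ico.1 hu).2
    rw [if_pos (hlam u hu'.le)]
    exact mul_le_mul_of_nonneg_left (by linarith) (H.lam_nonneg hp hu'.le)
  rw [H.lam_zero, Nat.Ico_zero_eq_range] at h1
  rw [Nat.Ico_zero_eq_range] at h2
  set Q := ∑ u ∈ Finset.range T, (utility S (q (u + 1)) (c u) - utility S q' (c u)) with hQ
  have h3 : L * √T * Q ≤ L * √T * (9 / 2 * (L * √T * J) + 7 / 2 * (Λ * J)) := by
    have h4 : L * √T * (9 / 2 * (L * √T * J)) = 9 / 2 * (T * (L : ℝ) ^ 2 * J) := by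
      calc _ = 9 / 2 * (√(T : ℝ) ^ 2 * (L : ℝ) ^ 2 * J) := by ring
        _ = _ := by rw [hsT2]
    have h5 : (T : ℝ) * (L : ℝ) ^ 2 ≤ T * (L : ℝ) ^ 2 * J :=
      le_mul_of_one_le_right (by positivity) hJ
    have h6 : Λ * L * √T * (1 / 2 + 3 * J) ≤ L * √T * (7 / 2 * (Λ * J)) := by
      have : 0 ≤ Λ * L * √T := by positivity
      nlinarith
    have h7 := sq_nonneg (lam T)
    rw [mul_add, h4]
    push_cast at h1
    nlinarith
  exact le_of_mul_le_mul_left h3 (by positivity)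

end PlayerPath

end Path

section Path

variable {X A : Type*} [Fintype X] [Fintype A] {L : ℕ}
variable {S : Layering X L} {b : ℝ} {T κ : ℕ} {δ J : ℝ} {τ : ℕ → Traj X A L}
  {q : ℕ → X → A → X → ℝ} {lam : ℕ → ℝ} {g c : ℕ → X → A → ℝ}

/-! ### Stability of the iterates -/

lemma le_add_sqrt_of_sq_le {x u v : ℝ} (hu : 0 ≤ u) (hv : 0 ≤ v) (h : x ^ 2 ≤ v + u * x) :
    x ≤ u + √v := by
  by_contra h0
  push Not at h0
  have h1 := Real.sqrt_nonneg v
  have h2 := Real.sq_sqrt hv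
  nlinarith

namespace PlayerPath

variable (H : PlayerPath S b T κ δ τ q lam g c) (hp : Params X A L T δ J)

include H hp

/-- Distance of the new iterate to any element of the new domain that is close to the old one. -/
lemma occDist_succ_le_of_near {t : ℕ} (ht : t < T) {Λ : ℝ} (hΛ : lam t ≤ Λ)
    {q' : X → A → X → ℝ} (hq' : q' ∈ (counters κ τ t).domain S T δ) {D : ℝ}
    (hD : occDist S q' (q t) ≤ D) :
    occDist S (q t) (q (t + 1)) ≤ D + (16 * (L * √T + Λ) / T + √(48 * L * J * (D + 2 * L / T))) := by
  have hA := H.nonempty_action hp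
  have hw := H.isMarg_succ hp ht
  have hqm := Counters.isMarg_of_mem_domain hq'
  have hqt := H.isMarg hp ht.le
  have hT0 : (0 : ℝ) < T := by have := hp.T_two; positivity
  have hL0 : (0 : ℝ) < L := by have := hp.L_pos; positivity
  have hJ := hp.J_one
  have hlam0 := H.lam_nonneg hp ht.le
  set d := occDist S q' (q (t + 1)) with hd
  have hd0 : 0 ≤ d := occDist_nonneg _ _ _
  set E := relEnt (pairs S A) (fun i => marg q' i.1 i.2)
    (fun i => mix S (1 / T) (q t) i.1 i.2) with hE
  set Z := relEnt (pairs S A) (fun i => marg q' i.1 i.2)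
    (fun i => (1 - 1 / 2) * marg (q (t + 1)) i.1 i.2 + 1 / 2 * marg q' i.1 i.2) with hZ
  have hE0 : 0 ≤ E := H.potential_nonneg hp ht.le hqm
  have h1 := H.one_step hp ht hq' (a := 1 / 2) (by norm_num) (by norm_num)
  rw [← hE, ← hZ] at h1
  set W := relEnt (pairs S A) (fun i => marg (q (t + 1)) i.1 i.2)
    (fun i => mix S (1 / T) (q t) i.1 i.2) with hW
  have h2 : 0 ≤ T * L * W := mul_nonneg (by positivity) (H.potential_nonneg hp ht.le hw)
  have h3 : Z ≤ E + (L * √T + Λ) * d / (T * L) := by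
    have h4 := utility_sub_le_occDist S q' (q (t + 1)) (H.c_le t ht)
    have h5 := utility_sub_le_occDist S q' (q (t + 1)) (g := g t) fun x a => by
      rw [abs_of_nonneg (H.g_mem t x a).1]; exact (H.g_mem t x a).2
    have h6 := mul_le_mul_of_nonneg_left h4 (show 0 ≤ L * √(T : ℝ) by positivity)
    have h7 := mul_le_mul_of_nonneg_left h5 hlam0
    have h8 : lam t * d ≤ Λ * d := mul_le_mul_of_nonneg_right hΛ hd0
    have h9 : T * L * (Z - E) ≤ (L * √T + Λ) * d := by
      rw [← hd] at h6 h7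
      linarith
    rw [← sub_le_iff_le_add', le_div_iff₀ (by positivity)]
    linarith
  have h4 : d ^ 2 ≤ 16 * L * Z := by
    have h5 := sq_sum_abs_sub_le_relEnt (s := pairs S A) (u := fun i => marg q' i.1 i.2)
      (v := fun i => (1 - 1 / 2) * marg (q (t + 1)) i.1 i.2 + 1 / 2 * marg q' i.1 i.2)
      (fun i _ => hqm.nonneg _ _)
      (fun i _ => by have := hqm.nonneg i.1 i.2; have := hw.nonneg i.1 i.2; linarith)
      (fun i _ h => by have := hqm.nonneg i.1 i.2; have := hw.nonneg i.1 i.2; linarith)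
    have h6 : ∑ i ∈ pairs S A, |marg q' i.1 i.2 -
        ((1 - 1 / 2) * marg (q (t + 1)) i.1 i.2 + 1 / 2 * marg q' i.1 i.2)| = d / 2 := by
      rw [hd, occDist, Finset.sum_div]
      refine Finset.sum_congr rfl fun i _ => ?_
      rw [← abs_of_pos (show (0 : ℝ) < 2 by norm_num), ← abs_div, abs_of_pos (show (0 : ℝ) < 2 by norm_num)]
      congr 1; ring
    have h7 : ∑ i ∈ pairs S A, (marg q' i.1 i.2 +
        ((1 - 1 / 2) * marg (q (t + 1)) i.1 i.2 + 1 / 2 * marg q' i.1 i.2)) = 2 * L := by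
      rw [Finset.sum_add_distrib, Finset.sum_add_distrib, ← Finset.mul_sum, ← Finset.mul_sum,
        hqm.sum_pairs, hw.sum_pairs]
      ring
    rw [h6, h7] at h5
    nlinarith
  have h5 : d ≤ 16 * (L * √T + Λ) / T + √(16 * L * E) := by
    refine le_add_sqrt_of_sq_le ?_ (by positivity) ?_
    · have : 0 ≤ Λ := hlam0.trans hΛ
      positivity
    · refine h4.trans ?_
      have h6 := mul_le_mul_of_nonneg_left h3 (show (0 : ℝ) ≤ 16 * L by positivity)
      refine h6.trans (le_of_eq ?_)
      field_simp
  have h6 : E ≤ 3 * J * (D + 2 * L / T) := by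
    have h7 := relEnt_le_dist (s := pairs S A) (q := fun i => marg q' i.1 i.2)
      (v := fun i => mix S (1 / T) (q t) i.1 i.2) (K := J) (by linarith)
      (fun i _ => hqm.nonneg _ _) (fun i _ => H.mix_pos hp ht.le _ _)
      (fun i hi => (hqm.le_one i.2 (mem_pairs.1 hi)).trans (H.le_exp_mul_mix hp ht.le _ _))
    have h8 : ∑ i ∈ pairs S A, |marg q' i.1 i.2 - mix S (1 / T) (q t) i.1 i.2| ≤
        D + 2 * L / T := by
      have h9 := sum_abs_sub_mix_le (fun l hl => H.level_nonempty hp hl) hqt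
        (H.theta_pos hp).le
      calc _ ≤ ∑ i ∈ pairs S A, (|marg q' i.1 i.2 - marg (q t) i.1 i.2| +
            |marg (q t) i.1 i.2 - mix S (1 / T) (q t) i.1 i.2|) :=
            Finset.sum_le_sum fun i _ => abs_sub_le _ _ _
        _ ≤ D + 2 * (1 / T) * L := by
            rw [Finset.sum_add_distrib]; exact add_le_add hD h9
        _ = _ := by ring
    have h10 : 0 ≤ ∑ i ∈ pairs S A, |marg q' i.1 i.2 - mix S (1 / T) (q t) i.1 i.2| :=
      Finset.sum_nonneg fun _ _ => abs_nonneg _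
    calc E ≤ (J + 2) * _ := h7
      _ ≤ (3 * J) * (D + 2 * L / T) := mul_le_mul (by linarith) h8 h10 (by linarith)
  have h7 : √(16 * L * E) ≤ √(48 * L * J * (D + 2 * L / T)) := by
    refine Real.sqrt_le_sqrt ?_
    have := mul_le_mul_of_nonneg_left h6 (show (0 : ℝ) ≤ 16 * L by positivity)
    linarith
  have h8 := occDist_triangle S (q t) q' (q (t + 1))
  rw [occDist_comm S (q t) q'] at h8
  linarith

/-- The increments of the counters at the end of episode `k + 1`, relative to the counters. -/
lemma sum_increments_le :
    ∑ k ∈ Finset.range (T - 1), 2 * (L : ℝ) * ∑ i ∈ pairs S A,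
      ((counters κ τ (k + 1)).N i.1 i.2 - (counters κ τ k).N i.1 i.2 : ℝ) /
        max 1 ((counters κ τ (k + 1)).N i.1 i.2 : ℝ) ≤
      4 * L * J * (Fintype.card X * Fintype.card A) := by
  have hT1 : 1 ≤ T := by have := hp.T_two; omega
  rw [← Finset.mul_sum, Finset.sum_comm]
  have h1 : ∀ i ∈ pairs S A, ∑ k ∈ Finset.range (T - 1),
      ((counters κ τ (k + 1)).N i.1 i.2 - (counters κ τ k).N i.1 i.2 : ℝ) /
        max 1 ((counters κ τ (k + 1)).N i.1 i.2 : ℝ) ≤ 2 * J := fun i _ =>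
    (sum_counters_increments_le hT1 H.path (by omega) i.1 i.2).trans
      (by linarith [hp.J_one, hp.J_log])
  have h2 := Finset.sum_le_sum h1
  rw [Finset.sum_const, nsmul_eq_mul] at h2
  have h3 : ((pairs S A).card : ℝ) ≤ Fintype.card X * Fintype.card A := by
    rw [← Nat.cast_mul, ← Fintype.card_prod]
    exact_mod_cast Finset.card_le_univ _
  have h4 : ((pairs S A).card : ℝ) * (2 * J) ≤ (Fintype.card X * Fintype.card A) * (2 * J) :=
    mul_le_mul_of_nonneg_right h3 (by linarith [hp.J_one])
  have h5 := mul_le_mul_of_nonneg_left (h2.trans h4) (show (0 : ℝ) ≤ 2 * L by positivity)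
  linarith

/-- The iterates move little in total, no matter how often the domains change: by Cauchy-Schwarz,
because the movements of the domains have a logarithmic sum. -/
lemma sum_occDist_succ_le {Λ : ℝ} (hΛ : ∀ t, t ≤ T → lam t ≤ Λ) :
    ∑ t ∈ Finset.range T, occDist S (q t) (q (t + 1)) ≤
      16 * (L * √T + Λ) + 23 * (L * J * √(T * (Fintype.card X * Fintype.card A))) := by
  have hA := H.nonempty_action hp
  have hT2 := hp.T_two
  have hT0 : (0 : ℝ) < T := by positivity
  have hL1 : (1 : ℝ) ≤ L := by exact_mod_cast hp.L_pos
  have hJ := hp.J_one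
  have hΛ0 : 0 ≤ Λ := by have := hΛ 0 (Nat.zero_le _); rwa [H.lam_zero] at this
  set U : ℝ := Fintype.card X * Fintype.card A with hU
  have hU1 : 1 ≤ U := by
    have h1 : (1 : ℝ) ≤ Fintype.card X := by
      have := H.L_lt_card hp
      exact_mod_cast (by omega : 1 ≤ Fintype.card X)
    have h2 : (1 : ℝ) ≤ Fintype.card A := by exact_mod_cast Fintype.card_pos
    nlinarith
  have hUT : U ≤ T := by
    have := hp.card_le
    rw [hU]; exact_mod_cast this
  have hUs : U ≤ √(T * U) := by
    rw [Real.le_sqrt (by positivity) (by positivity), pow_two]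
    exact mul_le_mul_of_nonneg_right hUT (by positivity)
  set D : ℕ → ℝ := fun k => 2 * (L : ℝ) * ∑ i ∈ pairs S A,
      ((counters κ τ (k + 1)).N i.1 i.2 - (counters κ τ k).N i.1 i.2 : ℝ) /
        max 1 ((counters κ τ (k + 1)).N i.1 i.2 : ℝ) with hD
  have hDsum : ∑ k ∈ Finset.range (T - 1), D k ≤ 4 * L * J * U := H.sum_increments_le hp
  have hD0 : ∀ k, 0 ≤ D k := fun k => by
    refine mul_nonneg (by positivity) (Finset.sum_nonneg fun i _ => div_nonneg ?_ (by positivity))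
    rw [sub_nonneg]; exact_mod_cast counters_mono k i.1 i.2
  have hstep : ∀ k, k < T - 1 → occDist S (q (k + 1)) (q (k + 1 + 1)) ≤
      D k + (16 * (L * √T + Λ) / T + √(48 * L * J * (D k + 2 * L / T))) := fun k hk => by
    obtain ⟨q', hq', hd⟩ := exists_mem_domain_near (S := S) (T := T) (δ := δ)
      (c := counters κ τ k) (c' := counters κ τ (k + 1)) (q := q (k + 1))
      (by rw [← hp.J_eq]; linarith) (H.mem k (by omega)) (counters_mono k) (counters_mono₃ k)
      (sum_counters_M k) (sum_counters_M (k + 1)) (fun x a x' h => by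
        have h1 := counters_le_total₃ (κ := κ) (τ := τ) (k + 1) x a x'
        rw [total₃_eq_zero H.path (by omega) h] at h1
        omega)
    exact H.occDist_succ_le_of_near hp (by omega) (hΛ _ (by omega)) hq' hd
  have hsqrt : ∑ k ∈ Finset.range (T - 1), √(48 * L * J * (D k + 2 * L / T)) ≤
      17 * (L * J * √(T * U)) := by
    have h1 := Real.sum_sqrt_mul_sqrt_le (Finset.range (T - 1)) (f := fun _ => (1 : ℝ))
      (g := fun k => 48 * L * J * (D k + 2 * L / T)) (fun _ => zero_le_one)
      (fun k => by have := hD0 k; positivity)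
    simp only [Real.sqrt_one, one_mul, Finset.sum_const, Finset.card_range, nsmul_eq_mul,
      mul_one] at h1
    refine h1.trans ?_
    rw [← Finset.mul_sum, Finset.sum_add_distrib, Finset.sum_const, Finset.card_range,
      nsmul_eq_mul, ← Real.sqrt_mul (Nat.cast_nonneg _)]
    have hTm : ((T - 1 : ℕ) : ℝ) ≤ T := by exact_mod_cast Nat.sub_le _ _
    have h2 : ((T - 1 : ℕ) : ℝ) * (2 * L / T) ≤ 2 * L := by
      calc _ ≤ (T : ℝ) * (2 * L / T) := mul_le_mul_of_nonneg_right hTm (by positivity)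
        _ = 2 * L := by field_simp
    have h3 : (2 : ℝ) * L ≤ 2 * L * J * U := by
      have : (1 : ℝ) ≤ J * U := by nlinarith
      nlinarith
    have h4 : ((T - 1 : ℕ) : ℝ) * (48 * L * J * (∑ k ∈ Finset.range (T - 1), D k +
        ((T - 1 : ℕ) : ℝ) * (2 * L / T))) ≤ T * (48 * L * J * (6 * L * J * U)) := by
      have h5 : 0 ≤ ∑ k ∈ Finset.range (T - 1), D k := Finset.sum_nonneg fun k _ => hD0 k
      refine mul_le_mul hTm ?_ (by positivity) (by positivity)
      exact mul_le_mul_of_nonneg_left (by linarith) (by positivity)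
    calc _ ≤ √(T * (48 * L * J * (6 * L * J * U))) := Real.sqrt_le_sqrt h4
      _ ≤ √((17 * (L * J)) ^ 2 * (T * U)) := by
          refine Real.sqrt_le_sqrt ?_
          have : 0 ≤ (L * J) ^ 2 * (T * U) := by positivity
          nlinarith
      _ = _ := by
          rw [Real.sqrt_mul (by positivity), Real.sqrt_sq (by positivity)]; ring
  have hT' : T = (T - 1) + 1 := by omega
  have hfirst : occDist S (q 0) (q (0 + 1)) ≤ 2 * L :=
    (H.isMarg hp (Nat.zero_le _)).occDist_le (H.isMarg_succ hp (by omega))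
  have hcongr : ∑ t ∈ Finset.range T, occDist S (q t) (q (t + 1)) =
      ∑ k ∈ Finset.range (T - 1), occDist S (q (k + 1)) (q (k + 1 + 1)) +
        occDist S (q 0) (q (0 + 1)) := by
    conv_lhs => rw [hT', Finset.sum_range_succ']
  rw [hcongr]
  have hsum := Finset.sum_le_sum fun k (hk : k ∈ Finset.range (T - 1)) =>
    hstep k (Finset.mem_range.1 hk)
  rw [Finset.sum_add_distrib, Finset.sum_add_distrib, Finset.sum_const, Finset.card_range,
    nsmul_eq_mul] at hsum
  have hmid : ((T - 1 : ℕ) : ℝ) * (16 * (L * √T + Λ) / T) ≤ 16 * (L * √T + Λ) := by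
    calc _ ≤ (T : ℝ) * (16 * (L * √T + Λ) / T) := by
          refine mul_le_mul_of_nonneg_right ?_ (by positivity)
          exact_mod_cast Nat.sub_le _ _
      _ = _ := by field_simp
  have h1 : 4 * L * J * U ≤ 4 * (L * J * √(T * U)) := by
    have := mul_le_mul_of_nonneg_left hUs (show 0 ≤ 4 * L * J by positivity)
    linarith
  have h2 : 2 * (L : ℝ) ≤ 2 * (L * J * √(T * U)) := by
    have h3 : (1 : ℝ) ≤ J * √(T * U) := by nlinarith
    nlinarith
  linarith

/-! ### Estimation of the occupancy measures -/

/-- The execution of the policies under the true transition costs at most the confidence radii at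
the visited pairs, hence a square root of the number of episodes. -/
lemma sum_occDist_occ_le (hκ : κ ≤ 1) {P : X → A → X → ℝ}
    (hP : ∀ t, t < T → P ∈ (counters κ τ t).transitions S T δ)
    (hnoise : ∑ t ∈ Finset.range T, ∑ i ∈ pairs S A,
      min 2 (2 * (counters κ τ t).radius S T δ i.1 i.2) *
        (marg (occ S P (policyOf (q (t + 1)))) i.1 i.2 - visits (τ (t + 1)) i.1 i.2) ≤
      2 * L * √T * (1 / 2 + 3 * J)) :
    ∑ t ∈ Finset.range T, occDist S (occ S P (policyOf (q (t + 1)))) (q (t + 1)) ≤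
      L * (12 * √J * (Fintype.card X * √(T * Fintype.card A)) + 7 * (L * √T * J)) := by
  have hJ := hp.J_one
  have hL0 : (0 : ℝ) ≤ L := Nat.cast_nonneg _
  have hPt : IsTransition S P := (hP 0 (by have := hp.T_two; omega)).1
  set ρ : ℕ → X × A → ℝ := fun t i => min 2 (2 * (counters κ τ t).radius S T δ i.1 i.2) with hρ
  have hρ0 : ∀ t i, 0 ≤ ρ t i := fun t i =>
    le_min (by norm_num) (mul_nonneg (by norm_num) (Real.sqrt_nonneg _))
  have h1 : ∀ t, t < T → occDist S (occ S P (policyOf (q (t + 1)))) (q (t + 1)) ≤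
      L * ∑ i ∈ pairs S A, marg (occ S P (policyOf (q (t + 1)))) i.1 i.2 * ρ t i := by
    intro t ht
    obtain ⟨Q, hQ, hqQ⟩ := H.mem t ht
    have hqm := isMarg_of_mem_occSet hQ.1 hqQ
    have hπ := isSubPolicy_policyOf hqm
    have hqπ : ∀ x a, S.layer x < L →
        marg (q (t + 1)) x a = (∑ a', marg (q (t + 1)) x a') * policyOf (q (t + 1)) x a := by
      intro x a _
      rw [policyOf]
      by_cases h : ∑ a', marg (q (t + 1)) x a' = 0
      · rw [h, zero_mul]
        exact (Finset.sum_eq_zero_iff_of_nonneg fun a _ => hqm.nonneg x a).1 h a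
          (Finset.mem_univ _)
      · field_simp
    refine (occDist_occ_le hPt hQ.1 hqQ hπ hqπ).trans ?_
    refine mul_le_mul_of_nonneg_left (Finset.sum_le_sum fun i hi => ?_) hL0
    refine mul_le_mul_of_nonneg_left (le_min ?_ ?_) (marg_occ_nonneg hPt hπ _ _)
    · calc _ ≤ ∑ x', (P i.1 i.2 x' + Q i.1 i.2 x') := by
            refine Finset.sum_le_sum fun x' _ => ?_
            have h2 := hPt.nonneg i.1 i.2 x'
            have h3 := hQ.1.nonneg i.1 i.2 x'
            rw [abs_le]; constructor <;> linarith
        _ ≤ 2 := by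
            rw [Finset.sum_add_distrib]
            linarith [hPt.sum_le_one i.1 i.2, hQ.1.sum_le_one i.1 i.2]
    · have h2 := (hP t ht).2 i.1 i.2 (mem_pairs.1 hi)
      have h3 := hQ.2 i.1 i.2 (mem_pairs.1 hi)
      calc _ ≤ ∑ x', (|P i.1 i.2 x' - (counters κ τ t).empirical i.1 i.2 x'| +
            |Q i.1 i.2 x' - (counters κ τ t).empirical i.1 i.2 x'|) := by
            refine Finset.sum_le_sum fun x' _ => ?_
            rw [abs_sub_comm (Q i.1 i.2 x')]
            exact abs_sub_le _ _ _
        _ ≤ _ := by rw [Finset.sum_add_distrib]; linarith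
  have h2 : ∑ t ∈ Finset.range T, ∑ i ∈ pairs S A, (visits (τ (t + 1)) i.1 i.2 : ℝ) * ρ t i ≤
      12 * √J * (Fintype.card X * √(T * Fintype.card A)) := by
    rw [Finset.sum_comm]
    have h3 : ∀ i ∈ pairs S A, ∑ t ∈ Finset.range T, (visits (τ (t + 1)) i.1 i.2 : ℝ) * ρ t i ≤
        12 * √J * (√((S.level (S.layer i.1 + 1)).card : ℝ) * √(total τ T i.1 i.2 : ℝ)) := by
      intro i _
      have h4 : ∀ t, ρ t i ≤ 4 * √J * √((S.level (S.layer i.1 + 1)).card : ℝ) *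
          (1 / √(max 1 (total τ t i.1 i.2 : ℝ))) := by
        intro t
        refine (min_le_right _ _).trans ?_
        set u : ℝ := ((S.level (S.layer i.1 + 1)).card : ℝ) with hu
        have hu0 : 0 ≤ u := Nat.cast_nonneg _
        have h5 : (total τ t i.1 i.2 : ℝ) ≤ 2 * (counters κ τ t).N i.1 i.2 := by
          exact_mod_cast total_le_two_mul hκ t i.1 i.2
        set m : ℝ := max 1 (total τ t i.1 i.2 : ℝ) with hm
        set n : ℝ := max 1 ((counters κ τ t).N i.1 i.2 : ℝ) with hn
        have hm1 : 1 ≤ m := le_max_left _ _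
        have hn1 : 1 ≤ n := le_max_left _ _
        have hmn : m ≤ 2 * n := max_le (by linarith) (h5.trans (by
          have := le_max_right 1 ((counters κ τ t).N i.1 i.2 : ℝ); linarith))
        have h6 : (counters κ τ t).radius S T δ i.1 i.2 ≤ √(4 * (J * (u * (1 / m)))) := by
          rw [Counters.radius, ← hp.J_eq, ← hu, ← hn]
          refine Real.sqrt_le_sqrt ?_
          rw [div_le_iff₀ (by positivity)]
          have : 4 * (J * (u * (1 / m))) * n = (2 * u * J) * (2 * n / m) := by field_simp; ring
          rw [this]
          refine le_mul_of_one_le_right (by positivity) ?_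
          rw [one_le_div (by positivity)]; exact hmn
        have h7 : √(4 * (J * (u * (1 / m)))) = 2 * (√J * (√u * (1 / √m))) := by
          rw [Real.sqrt_mul (by norm_num), Real.sqrt_mul (by linarith), Real.sqrt_mul hu0,
            Real.sqrt_div zero_le_one, Real.sqrt_one, show (4 : ℝ) = 2 ^ 2 by norm_num,
            Real.sqrt_sq (by norm_num)]
        linarith
      calc _ ≤ ∑ t ∈ Finset.range T, 4 * √J * √((S.level (S.layer i.1 + 1)).card : ℝ) *
            ((visits (τ (t + 1)) i.1 i.2 : ℝ) / √(max 1 (total τ t i.1 i.2 : ℝ))) := by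
            refine Finset.sum_le_sum fun t _ => ?_
            have := mul_le_mul_of_nonneg_left (h4 t)
              (Nat.cast_nonneg (visits (τ (t + 1)) i.1 i.2) : (0 : ℝ) ≤ _)
            refine this.trans (le_of_eq ?_)
            ring
        _ ≤ 4 * √J * √((S.level (S.layer i.1 + 1)).card : ℝ) *
            (3 * √(total τ T i.1 i.2 : ℝ)) := by
            rw [← Finset.mul_sum]
            exact mul_le_mul_of_nonneg_left (sum_visits_div_sqrt_le H.path _ _ le_rfl)
              (by positivity)
        _ = _ := by ring
    refine (Finset.sum_le_sum h3).trans ?_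
    rw [← Finset.mul_sum]
    exact mul_le_mul_of_nonneg_left (sum_sqrt_total_le H.path) (by positivity)
  refine (Finset.sum_le_sum fun t ht => h1 t (Finset.mem_range.1 ht)).trans ?_
  rw [← Finset.mul_sum]
  refine mul_le_mul_of_nonneg_left ?_ hL0
  have h3 : ∑ t ∈ Finset.range T, ∑ i ∈ pairs S A,
      marg (occ S P (policyOf (q (t + 1)))) i.1 i.2 * ρ t i =
      ∑ t ∈ Finset.range T, ∑ i ∈ pairs S A, ρ t i *
        (marg (occ S P (policyOf (q (t + 1)))) i.1 i.2 - visits (τ (t + 1)) i.1 i.2) +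
      ∑ t ∈ Finset.range T, ∑ i ∈ pairs S A, (visits (τ (t + 1)) i.1 i.2 : ℝ) * ρ t i := by
    rw [← Finset.sum_add_distrib]
    refine Finset.sum_congr rfl fun t _ => ?_
    rw [← Finset.sum_add_distrib]
    exact Finset.sum_congr rfl fun i _ => by ring
  rw [h3]
  have h4 : 2 * (L : ℝ) * √T * (1 / 2 + 3 * J) ≤ 7 * (L * √T * J) := by
    have : (0 : ℝ) ≤ L * √T := by positivity
    nlinarith
  linarith

end PlayerPath

end Path

/-! ### Concentration inequalities -/

section Azuma

variable {Ω : Type*} {m0 : MeasurableSpace Ω} {μ : Measure Ω} [IsProbabilityMeasure μ]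

/-- A function that is bounded almost everywhere. -/
def AEBdd (μ : Measure Ω) (f : Ω → ℝ) : Prop := ∃ C : ℝ, ∀ᵐ ω ∂μ, |f ω| ≤ C

/-- `Y` has conditional mean zero given `m`, expressed by testing against all bounded
`m`-measurable functions. -/
def IsNoise (μ : Measure Ω) (m : MeasurableSpace Ω) (Y : Ω → ℝ) : Prop :=
  ∀ f : Ω → ℝ, Measurable[m] f → AEBdd μ f → ∫ ω, f ω * Y ω ∂μ = 0

lemma AEBdd.mul {f g : Ω → ℝ} (hf : AEBdd μ f) (hg : AEBdd μ g) :
    AEBdd μ (fun ω => f ω * g ω) := by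
  obtain ⟨C, hC⟩ := hf
  obtain ⟨D, hD⟩ := hg
  refine ⟨C * D, ?_⟩
  filter_upwards [hC, hD] with ω h1 h2
  rw [abs_mul]
  exact mul_le_mul h1 h2 (abs_nonneg _) ((abs_nonneg _).trans h1)

lemma AEBdd.const (C : ℝ) : AEBdd μ (fun _ : Ω => C) := ⟨|C|, Filter.Eventually.of_forall fun _ => le_rfl⟩

lemma AEBdd.add {f g : Ω → ℝ} (hf : AEBdd μ f) (hg : AEBdd μ g) :
    AEBdd μ (fun ω => f ω + g ω) := by
  obtain ⟨C, hC⟩ := hf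
  obtain ⟨D, hD⟩ := hg
  refine ⟨C + D, ?_⟩
  filter_upwards [hC, hD] with ω h1 h2
  exact (abs_add_le _ _).trans (add_le_add h1 h2)

lemma AEBdd.sum {ι : Type*} (s : Finset ι) {f : ι → Ω → ℝ} (hf : ∀ i ∈ s, AEBdd μ (f i)) :
    AEBdd μ (fun ω => ∑ i ∈ s, f i ω) := by
  classical
  induction s using Finset.induction_on with
  | empty => simpa using AEBdd.const (μ := μ) 0
  | insert i s hi ih =>
    simp only [Finset.sum_insert hi]
    exact (hf i (Finset.mem_insert_self i s)).add
      (ih fun j hj => hf j (Finset.mem_insert_of_mem hj))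

lemma AEBdd.exp {f : Ω → ℝ} (hf : AEBdd μ f) : AEBdd μ (fun ω => Real.exp (f ω)) := by
  obtain ⟨C, hC⟩ := hf
  refine ⟨Real.exp C, ?_⟩
  filter_upwards [hC] with ω h1
  rw [abs_of_pos (Real.exp_pos _)]
  exact Real.exp_le_exp.2 ((le_abs_self _).trans h1)

lemma AEBdd.integrable {f : Ω → ℝ} (hf : AEBdd μ f) (hm : Measurable f) : Integrable f μ := by
  obtain ⟨C, hC⟩ := hf
  exact Integrable.of_bound hm.aestronglyMeasurable C (by simpa only [Real.norm_eq_abs] using hC)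

/-- The chord of the exponential function over `[-B, B]`. -/
lemma exp_le_chord {s z B : ℝ} (hB : 0 < B) (hz : |z| ≤ B) :
    Real.exp (s * z) ≤ Real.cosh (s * B) + Real.sinh (s * B) / B * z := by
  have hz' := abs_le.1 hz
  have h1 : 0 ≤ (B + z) / (2 * B) := div_nonneg (by linarith) (by linarith)
  have h2 : 0 ≤ (B - z) / (2 * B) := div_nonneg (by linarith) (by linarith)
  have h3 : (B + z) / (2 * B) + (B - z) / (2 * B) = 1 := by field_simp; ring
  have h := convexOn_exp.2 (Set.mem_univ (s * B)) (Set.mem_univ (-(s * B))) h1 h2 h3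
  simp only [smul_eq_mul] at h
  have e : (B + z) / (2 * B) * (s * B) + (B - z) / (2 * B) * -(s * B) = s * z := by
    field_simp; ring
  rw [e] at h
  refine h.trans (le_of_eq ?_)
  rw [Real.cosh_eq, Real.sinh_eq]
  field_simp; ring

lemma integral_exp_sum_le {F : ℕ → MeasurableSpace Ω} (hF : ∀ t, F t ≤ m0) (hmono : Monotone F)
    {D : ℕ → Ω → ℝ} {T : ℕ} {B ζ : ℝ} (hB : 0 < B)
    (hmeas : ∀ u, u < T → Measurable[F (u + 1)] (D u))
    (hbdd : ∀ u, u < T → ∀ᵐ ω ∂μ, |D u ω| ≤ B)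
    (hnoise : ∀ u, u < T → IsNoise μ (F u) (D u)) {s t : ℕ} (hst : s ≤ t) (ht : t ≤ T) :
    ∫ ω, Real.exp (ζ * ∑ u ∈ Finset.Ico s t, D u ω) ∂μ ≤
      Real.exp (ζ ^ 2 * B ^ 2 / 2 * ((t : ℝ) - s)) := by
  induction t, hst using Nat.le_induction with
  | base => simp
  | succ t hst ih =>
    have ih := ih (by omega)
    set W : Ω → ℝ := fun ω => Real.exp (ζ * ∑ u ∈ Finset.Ico s t, D u ω) with hW
    have hDb : ∀ u, u < T → AEBdd μ (D u) := fun u hu => ⟨B, hbdd u hu⟩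
    have hWm : Measurable[F t] W := by
      refine Real.measurable_exp.comp (Measurable.const_mul ?_ ζ)
      refine Finset.measurable_sum _ fun u hu => ?_
      have hu' := (Finset.mem_Ico.1 hu).2
      exact (hmeas u (by omega)).mono (hmono hu') le_rfl
    have hWb : AEBdd μ W := ((AEBdd.const ζ).mul (AEBdd.sum _ fun u hu =>
      hDb u (by have := (Finset.mem_Ico.1 hu).2; omega))).exp
    have hWi : Integrable W μ := hWb.integrable (hWm.mono (hF t) le_rfl)
    have hDm : Measurable (D t) := (hmeas t (by omega)).mono (hF _) le_rfl
    have hWDi : Integrable (fun ω => W ω * D t ω) μ :=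
      (hWb.mul (hDb t (by omega))).integrable ((hWm.mono (hF t) le_rfl).mul hDm)
    have h1 : ∫ ω, Real.exp (ζ * ∑ u ∈ Finset.Ico s (t + 1), D u ω) ∂μ ≤
        ∫ ω, (Real.cosh (ζ * B) * W ω + Real.sinh (ζ * B) / B * (W ω * D t ω)) ∂μ := by
      refine integral_mono_ae ?_ ?_ ?_
      · refine AEBdd.integrable ((AEBdd.const ζ).mul (AEBdd.sum _ fun u hu =>
          hDb u (by have := (Finset.mem_Ico.1 hu).2; omega))).exp ?_
        refine Real.measurable_exp.comp (Measurable.const_mul ?_ ζ)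
        refine Finset.measurable_sum _ fun u hu => ?_
        have hu' := (Finset.mem_Ico.1 hu).2
        exact (hmeas u (by omega)).mono (hF _) le_rfl
      · exact (hWi.const_mul _).add (hWDi.const_mul _)
      · filter_upwards [hbdd t (by omega)] with ω hω
        rw [Finset.sum_Ico_succ_top hst, mul_add, Real.exp_add]
        have := mul_le_mul_of_nonneg_left (exp_le_chord (s := ζ) hB hω)
          (Real.exp_pos (ζ * ∑ u ∈ Finset.Ico s t, D u ω)).le
        refine this.trans (le_of_eq ?_)
        simp only [hW]; ring
    rw [integral_add (hWi.const_mul _) (hWDi.const_mul _), integral_const_mul,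
      integral_const_mul, hnoise t (by omega) W hWm hWb, mul_zero, add_zero] at h1
    refine h1.trans ?_
    have h2 : Real.cosh (ζ * B) ≤ Real.exp (ζ ^ 2 * B ^ 2 / 2) := by
      refine (Real.cosh_le_exp_half_sq _).trans (le_of_eq ?_)
      congr 1; ring
    calc _ ≤ Real.exp (ζ ^ 2 * B ^ 2 / 2) * Real.exp (ζ ^ 2 * B ^ 2 / 2 * ((t : ℝ) - s)) :=
          mul_le_mul h2 ih (integral_nonneg fun ω => (Real.exp_pos _).le) (Real.exp_pos _).le
      _ = _ := by rw [← Real.exp_add]; congr 1; push_cast; ring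

lemma measure_lt_le_of_integral_exp_le {Z : Ω → ℝ} (hm : Measurable Z) (hb : AEBdd μ Z)
    {c v : ℝ} (h : ∫ ω, Real.exp (Z ω) ∂μ ≤ Real.exp c) :
    μ {ω | v < Z ω} ≤ ENNReal.ofReal (Real.exp (c - v)) := by
  have hi := hb.exp.integrable (Real.measurable_exp.comp hm)
  have h1 := mul_meas_ge_le_integral_of_nonneg
    (Filter.Eventually.of_forall fun ω => (Real.exp_pos (Z ω)).le) hi (Real.exp v)
  have h2 : μ.real {ω | Real.exp v ≤ Real.exp (Z ω)} ≤ Real.exp (c - v) := by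
    rw [Real.exp_sub, le_div_iff₀ (Real.exp_pos v), mul_comm]
    exact h1.trans h
  refine (measure_mono (t := {ω | Real.exp v ≤ Real.exp (Z ω)}) fun ω hω => ?_).trans ?_
  · exact Real.exp_le_exp.2 (le_of_lt hω)
  · rw [← ofReal_measureReal]
    exact ENNReal.ofReal_le_ofReal h2

/-- The Azuma-Hoeffding inequality, for a window of bounded martingale differences. -/
lemma azuma {F : ℕ → MeasurableSpace Ω} (hF : ∀ t, F t ≤ m0) (hmono : Monotone F)
    {D : ℕ → Ω → ℝ} {T : ℕ} {B ζ : ℝ} (hB : 0 < B) (hζ : 0 < ζ) (a : ℝ)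
    (hmeas : ∀ u, u < T → Measurable[F (u + 1)] (D u))
    (hbdd : ∀ u, u < T → ∀ᵐ ω ∂μ, |D u ω| ≤ B)
    (hnoise : ∀ u, u < T → IsNoise μ (F u) (D u)) {s t : ℕ} (hst : s ≤ t) (ht : t ≤ T) :
    μ {ω | ζ * B ^ 2 / 2 * ((t : ℝ) - s) + a / ζ < ∑ u ∈ Finset.Ico s t, D u ω} ≤
      ENNReal.ofReal (Real.exp (-a)) := by
  have h1 := integral_exp_sum_le (μ := μ) (ζ := ζ) hF hmono hB hmeas hbdd hnoise hst ht
  have hm : Measurable fun ω => ζ * ∑ u ∈ Finset.Ico s t, D u ω := by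
    refine Measurable.const_mul (Finset.measurable_sum _ fun u hu => ?_) ζ
    have hu' := (Finset.mem_Ico.1 hu).2
    exact (hmeas u (by omega)).mono (hF _) le_rfl
  have hb : AEBdd μ fun ω => ζ * ∑ u ∈ Finset.Ico s t, D u ω :=
    (AEBdd.const ζ).mul (AEBdd.sum _ fun u hu =>
      ⟨B, hbdd u (by have := (Finset.mem_Ico.1 hu).2; omega)⟩)
  have h2 := measure_lt_le_of_integral_exp_le hm hb h1
    (v := ζ ^ 2 * B ^ 2 / 2 * ((t : ℝ) - s) + a)
  refine (measure_mono fun ω hω => ?_).trans (h2.trans (le_of_eq ?_))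
  · have h3 := mul_lt_mul_of_pos_left hω hζ
    refine lt_of_eq_of_lt ?_ h3
    field_simp
  · congr 2; ring

/-- Hoeffding's lemma for a distribution on a finite set. -/
lemma sum_mul_exp_le {X : Type*} [Fintype X] {P σ : X → ℝ} (hP : ∀ x, 0 ≤ P x)
    (hsum : ∑ x, P x = 1) (hσ : ∀ x, |σ x| ≤ 1) (s : ℝ) :
    ∑ x, P x * Real.exp (s * (σ x - ∑ y, P y * σ y)) ≤ Real.exp (s ^ 2 / 2) := by
  let _ : MeasurableSpace X := ⊤
  have : MeasurableSingletonClass X := ⟨fun _ => trivial⟩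
  have hs : ∑ x, ENNReal.ofReal (P x) = 1 := by
    rw [← ENNReal.ofReal_sum_of_nonneg fun x _ => hP x, hsum, ENNReal.ofReal_one]
  set p : PMF X := PMF.ofFintype (fun x => ENNReal.ofReal (P x)) hs with hp
  have hint : ∀ f : X → ℝ, ∫ x, f x ∂p.toMeasure = ∑ x, P x * f x := fun f => by
    rw [PMF.integral_eq_sum]
    refine Finset.sum_congr rfl fun x _ => ?_
    rw [hp, PMF.ofFintype_apply, ENNReal.toReal_ofReal (hP x), smul_eq_mul]
  have h := hasSubgaussianMGF_of_mem_Icc (μ := p.toMeasure) (X := σ) (a := -1) (b := 1)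
    (measurable_from_top.aemeasurable) (Filter.Eventually.of_forall fun x => abs_le.1 (hσ x))
  have h2 := h.mgf_le s
  rw [mgf, hint, hint] at h2
  refine h2.trans (le_of_eq ?_)
  congr 1
  have : ((‖(1 : ℝ) - (-1)‖₊ / 2) ^ 2 : NNReal) = 1 := by
    ext
    simp only [NNReal.coe_pow, NNReal.coe_div, coe_nnnorm, Real.norm_eq_abs]
    norm_num
  rw [this]; simp

end Azuma

/-! ### The random run of one player -/

section PlayerRun

variable {X A : Type*} [Fintype X] [Fintype A] {L : ℕ}
variable {Ω : Type*}

section Measurability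

variable [MeasurableSpace Ω] {S : Layering X L} {P : X → A → X → ℝ} {q : Ω → X → A → X → ℝ}

lemma measurable_marg (hq : Measurable q) (x : X) (a : A) :
    Measurable fun ω => marg (q ω) x a := by
  unfold marg
  refine Finset.measurable_sum _ fun x' _ => ?_
  exact (measurable_pi_apply x').comp ((measurable_pi_apply a).comp
    ((measurable_pi_apply x).comp hq))

lemma measurable_policyOf (hq : Measurable q) (x : X) (a : A) :
    Measurable fun ω => policyOf (q ω) x a :=
  (measurable_marg hq x a).div (Finset.measurable_sum _ fun a' _ => measurable_marg hq x a')

lemma measurable_trajProb (hq : Measurable q) (σ : Traj X A L) :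
    Measurable fun ω => trajProb S P (policyOf (q ω)) σ := by
  unfold trajProb
  refine Measurable.const_mul (Finset.measurable_prod _ fun l _ => ?_) _
  exact (measurable_policyOf hq _ _).mul_const _

lemma measurable_stateDist (hq : Measurable q) (l : ℕ) (x : X) :
    Measurable fun ω => stateDist S P (policyOf (q ω)) l x := by
  induction l generalizing x with
  | zero => simp only [stateDist]; exact measurable_const
  | succ l ih =>
    simp only [stateDist]
    refine Finset.measurable_sum _ fun y _ => Finset.measurable_sum _ fun a _ => ?_
    exact ((ih y).mul (measurable_policyOf hq _ _)).mul_const _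

lemma measurable_marg_occ (hq : Measurable q) (x : X) (a : A) :
    Measurable fun ω => marg (occ S P (policyOf (q ω))) x a := by
  simp only [marg, occ]
  refine Finset.measurable_sum _ fun y _ => ?_
  exact ((measurable_stateDist hq _ _).mul (measurable_policyOf hq _ _)).mul_const _

lemma measurable_utility {g : Ω → X → A → ℝ} (hg : Measurable g) (q : X → A → X → ℝ) :
    Measurable fun ω => utility S q (g ω) := by
  simp only [utility_eq]
  refine Finset.measurable_sum _ fun i _ => Measurable.const_mul ?_ _
  exact (measurable_pi_apply i.2).comp ((measurable_pi_apply i.1).comp hg)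

end Measurability

open Classical in
/-- The random run of the algorithm from the point of view of one player: its realizations are
almost surely of the kind `PlayerPath`, the utilities are unbiased given the past, and the
trajectories follow the current policy under the true transition `P`. -/
structure PlayerRun {m0 : MeasurableSpace Ω} (μ : Measure Ω) (S : Layering X L)
    (P : X → A → X → ℝ) (g₀ : X → A → ℝ) (b : ℝ) (T κ : ℕ) (δ : ℝ) (F : ℕ → MeasurableSpace Ω)
    (τ : ℕ → Ω → Traj X A L) (q : ℕ → Ω → X → A → X → ℝ) (lam : ℕ → Ω → ℝ)
    (g c : ℕ → Ω → X → A → ℝ) : Prop where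
  F_le : ∀ t, F t ≤ m0
  F_mono : Monotone F
  isTransition : IsTransition S P
  g₀_mem : ∀ x a, g₀ x a ∈ Set.Icc (0 : ℝ) 1
  path : ∀ᵐ ω ∂μ, PlayerPath S b T κ δ (fun t => τ t ω) (fun t => q t ω) (fun t => lam t ω)
    (fun t => g t ω) (fun t => c t ω)
  τ_meas : ∀ t, t < T → Measurable[F (t + 1), ⊤] (τ (t + 1))
  q_meas : ∀ t, t < T → Measurable[F t] (q (t + 1))
  lam_meas : ∀ t, t < T → Measurable[F t] (lam (t + 1))
  g_meas : ∀ t, t < T → Measurable[F (t + 1)] (g (t + 1))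
  g_noise : ∀ t, t < T → ∀ x a, IsNoise μ (F t) (fun ω => g (t + 1) ω x a - g₀ x a)
  law : ∀ t, t < T → ∀ (σ : Traj X A L) (f : Ω → ℝ), Measurable[F t] f → AEBdd μ f →
    ∫ ω, f ω * (if τ (t + 1) ω = σ then 1 else 0) ∂μ =
      ∫ ω, f ω * trajProb S P (policyOf (q (t + 1) ω)) σ ∂μ
  mass : ∀ t, t < T → ∀ᵐ ω ∂μ, ∑ σ : Traj X A L, trajProb S P (policyOf (q (t + 1) ω)) σ = 1

namespace PlayerRun

variable {m0 : MeasurableSpace Ω} {μ : Measure Ω} [IsProbabilityMeasure μ] {S : Layering X L}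
  {P : X → A → X → ℝ} {g₀ : X → A → ℝ} {b : ℝ} {T κ : ℕ} {δ J : ℝ}
  {F : ℕ → MeasurableSpace Ω}
  {τ : ℕ → Ω → Traj X A L} {q : ℕ → Ω → X → A → X → ℝ} {lam : ℕ → Ω → ℝ}
  {g c : ℕ → Ω → X → A → ℝ}
  (R : PlayerRun μ S P g₀ b T κ δ F τ q lam g c)

include R

lemma isSubPolicy {t : ℕ} (ht : t < T) : ∀ᵐ ω ∂μ, IsSubPolicy (policyOf (q (t + 1) ω)) := by
  filter_upwards [R.path] with ω H
  exact isSubPolicy_policyOf (Counters.isMarg_of_mem_domain (H.mem t ht))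

lemma aebdd_trajProb {t : ℕ} (ht : t < T) (σ : Traj X A L) :
    AEBdd μ fun ω => trajProb S P (policyOf (q (t + 1) ω)) σ := by
  refine ⟨1, ?_⟩
  filter_upwards [R.isSubPolicy ht] with ω hω
  rw [abs_of_nonneg (trajProb_nonneg R.isTransition hω σ)]
  exact (Finset.single_le_sum (fun σ _ => trajProb_nonneg R.isTransition hω σ)
    (Finset.mem_univ σ)).trans (sum_trajProb_le_one R.isTransition hω)

/-- Integration over the trajectory of an episode, with the past fixed. -/
lemma integral_traj {t : ℕ} (ht : t < T) (ψ : Ω → Traj X A L → ℝ)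
    (hψ : ∀ σ, Measurable[F t] fun ω => ψ ω σ) (hb : ∀ σ, AEBdd μ fun ω => ψ ω σ) :
    ∫ ω, ψ ω (τ (t + 1) ω) ∂μ =
      ∫ ω, ∑ σ, ψ ω σ * trajProb S P (policyOf (q (t + 1) ω)) σ ∂μ := by
  classical
  have h1 : ∀ ω, ψ ω (τ (t + 1) ω) =
      ∑ σ, ψ ω σ * (if τ (t + 1) ω = σ then 1 else 0) := fun ω => by
    simp
  have hq := @measurable_trajProb X A _ _ L Ω (F t) S P (q (t + 1)) (R.q_meas t ht)
  rw [integral_congr_ae (Filter.Eventually.of_forall h1), integral_finsetSum, integral_finsetSum]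
  · exact Finset.sum_congr rfl fun σ _ => by
      convert R.law t ht σ _ (hψ σ) (hb σ)
  · intro σ _
    refine ((hb σ).mul (R.aebdd_trajProb ht σ)).integrable ?_
    exact ((hψ σ).mul (hq σ)).mono (R.F_le t) le_rfl
  · intro σ _
    have h2 : AEBdd μ fun ω => if τ (t + 1) ω = σ then (1 : ℝ) else 0 :=
      ⟨1, Filter.Eventually.of_forall fun ω => by dsimp only; split_ifs <;> norm_num⟩
    refine ((hb σ).mul h2).integrable ?_
    refine ((hψ σ).mono (R.F_le t) le_rfl).mul ?_
    have h3 : MeasurableSet {ω | τ (t + 1) ω = σ} :=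
      R.F_le (t + 1) _ (R.τ_meas t ht (MeasurableSpace.measurableSet_top (s := {σ})))
    exact Measurable.ite h3 measurable_const measurable_const

lemma measurable_comp_τ {t : ℕ} (ht : t < T) (φ : Traj X A L → ℝ) :
    Measurable[F (t + 1)] fun ω => φ (τ (t + 1) ω) :=
  (@measurable_from_top _ _ _ φ).comp (R.τ_meas t ht)

lemma measurable_counters {t : ℕ} (ht : t ≤ T) :
    Measurable[F t, ⊤] fun ω => counters κ (fun s => τ s ω) t := by
  induction t with
  | zero => simp only [counters]; exact measurable_const
  | succ t ih =>
    have ih := ih (by omega)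
    intro s _
    have h1 : (fun ω => counters κ (fun s => τ s ω) (t + 1)) ⁻¹' s =
        ⋃ σ : Traj X A L, (τ (t + 1) ⁻¹' {σ}) ∩
          ((fun ω => counters κ (fun s => τ s ω) t) ⁻¹' {k | k.step κ σ ∈ s}) := by
      ext ω
      simp only [Set.mem_preimage, Set.mem_iUnion, Set.mem_inter_iff, Set.mem_singleton_iff,
        Set.mem_ofPred_eq, counters, exists_eq_left']
    rw [h1]
    refine MeasurableSet.iUnion fun σ => MeasurableSet.inter ?_ ?_
    · exact R.τ_meas t (by omega) (MeasurableSpace.measurableSet_top)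
    · exact R.F_mono (Nat.le_succ t) _ (ih (MeasurableSpace.measurableSet_top))

lemma measurable_comp_counters {t : ℕ} (ht : t ≤ T) (φ : Counters X A → ℝ) :
    Measurable[F t] fun ω => φ (counters κ (fun s => τ s ω) t) :=
  (@measurable_from_top _ _ _ φ).comp (R.measurable_counters ht)

/-! ### Noise of the utilities and of the visits -/

/-- With probability at least `1 - exp (-a)`, the weighted sum of the deviations of the utilities at
a fixed occupancy measure is small on a given window. -/
lemma utility_noise (hp : Params X A L T δ J) {q' : X → A → X → ℝ} (hq' : IsMarg S q') {Λ : ℝ}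
    (hΛ : 0 < Λ) {ζ : ℝ} (hζ : 0 < ζ) (a : ℝ) {s t : ℕ} (hs : 1 ≤ s) (hst : s ≤ t) (ht : t ≤ T) :
    μ {ω | ζ * (Λ * L) ^ 2 / 2 * ((t : ℝ) - s) + a / ζ < ∑ u ∈ Finset.Ico s t,
      (if lam u ω ≤ Λ then lam u ω else 0) * (utility S q' (g u ω) - utility S q' g₀)} ≤
      ENNReal.ofReal (Real.exp (-a)) := by
  have hL0 : (0 : ℝ) < L := by have := hp.L_pos; positivity
  set D : ℕ → Ω → ℝ := fun u ω => (if lam (u + 1) ω ≤ Λ then lam (u + 1) ω else 0) *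
    (utility S q' (g (u + 1) ω) - utility S q' g₀) with hD
  have hlam : ∀ u, u < T → Measurable[F u] fun ω =>
      (if lam (u + 1) ω ≤ Λ then lam (u + 1) ω else 0) := fun u hu =>
    Measurable.ite (measurableSet_le (R.lam_meas u hu) measurable_const) (R.lam_meas u hu)
      measurable_const
  have hlamb : ∀ u, u < T → ∀ᵐ ω ∂μ,
      |if lam (u + 1) ω ≤ Λ then lam (u + 1) ω else 0| ≤ Λ := fun u hu => by
    filter_upwards [R.path] with ω H
    have h1 := H.lam_nonneg hp (t := u + 1) hu
    split_ifs with h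
    · rwa [abs_of_nonneg h1]
    · simpa using hΛ.le
  have hutil : ∀ u ω, utility S q' (g (u + 1) ω) - utility S q' g₀ =
      ∑ i ∈ pairs S A, marg q' i.1 i.2 * (g (u + 1) ω i.1 i.2 - g₀ i.1 i.2) := fun u ω => by
    rw [utility_eq, utility_eq, ← Finset.sum_sub_distrib]
    exact Finset.sum_congr rfl fun i _ => by ring
  have hDb : ∀ u, u < T → ∀ᵐ ω ∂μ, |D u ω| ≤ Λ * L := fun u hu => by
    filter_upwards [R.path, hlamb u hu] with ω H hω
    rw [hD, abs_mul]
    refine mul_le_mul hω ?_ (abs_nonneg _) hΛ.le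
    have h1 := hq'.utility_nonneg fun x a => (H.g_mem (u + 1) x a).1
    have h2 := hq'.utility_le fun x a => (H.g_mem (u + 1) x a).2
    have h3 := hq'.utility_nonneg fun x a => (R.g₀_mem x a).1
    have h4 := hq'.utility_le fun x a => (R.g₀_mem x a).2
    rw [abs_le]; constructor <;> linarith
  have hDm : ∀ u, u < T → Measurable[F (u + 1)] (D u) := fun u hu =>
    ((hlam u hu).mono (R.F_mono (Nat.le_succ u)) le_rfl).mul
      ((@measurable_utility X A _ _ L Ω (F (u + 1)) S _ (R.g_meas u hu) q').sub_const _)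
  have hDn : ∀ u, u < T → IsNoise μ (F u) (D u) := fun u hu f hf hfb => by
    have h1 : ∀ ω, f ω * D u ω = ∑ i ∈ pairs S A, (f ω *
        (if lam (u + 1) ω ≤ Λ then lam (u + 1) ω else 0) * marg q' i.1 i.2) *
          (g (u + 1) ω i.1 i.2 - g₀ i.1 i.2) := fun ω => by
      simp only [hD]
      rw [hutil, Finset.mul_sum, Finset.mul_sum]
      exact Finset.sum_congr rfl fun i _ => by ring
    have hfm : ∀ i : X × A, Measurable[F u] fun ω => f ω *
        (if lam (u + 1) ω ≤ Λ then lam (u + 1) ω else 0) * marg q' i.1 i.2 := fun i =>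
      (hf.mul (hlam u hu)).mul_const _
    have hfb' : ∀ i : X × A, AEBdd μ fun ω => f ω *
        (if lam (u + 1) ω ≤ Λ then lam (u + 1) ω else 0) * marg q' i.1 i.2 := fun i =>
      (hfb.mul ⟨Λ, hlamb u hu⟩).mul (AEBdd.const _)
    rw [integral_congr_ae (Filter.Eventually.of_forall h1), integral_finsetSum]
    · exact Finset.sum_eq_zero fun i _ => R.g_noise u hu i.1 i.2 _ (hfm i) (hfb' i)
    · intro i _
      refine ((hfb' i).mul ⟨1, ?_⟩).integrable (((hfm i).mono (R.F_le u) le_rfl).mul ?_)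
      · filter_upwards [R.path] with ω H
        have h1 := H.g_mem (u + 1) i.1 i.2
        have h2 := R.g₀_mem i.1 i.2
        rw [abs_le]; constructor <;> linarith [h1.1, h1.2, h2.1, h2.2]
      · have := (R.g_meas u hu).mono (R.F_le (u + 1)) le_rfl
        exact ((measurable_pi_apply i.2).comp ((measurable_pi_apply i.1).comp this)).sub_const _
  obtain ⟨s, rfl⟩ : ∃ s', s = s' + 1 := ⟨s - 1, by omega⟩
  obtain ⟨t, rfl⟩ : ∃ t', t = t' + 1 := ⟨t - 1, by omega⟩
  have h := azuma (μ := μ) R.F_le R.F_mono (mul_pos hΛ hL0) hζ a hDm hDb hDn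
    (s := s) (t := t) (by omega) (by omega)
  refine le_trans (le_of_eq ?_) h
  congr 1
  ext ω
  simp only [Set.mem_ofPred_eq, hD]
  rw [← Finset.sum_Ico_add' (fun u => (if lam u ω ≤ Λ then lam u ω else 0) *
    (utility S q' (g u ω) - utility S q' g₀)) s t 1]
  push_cast
  rw [show (t : ℝ) + 1 - (s + 1) = t - s by ring]

/-- With probability at least `1 - exp (-a)`, the confidence radii at the visited pairs add up to
almost as much as their expectations given the past. -/
lemma visits_noise (hp : Params X A L T δ J) {ζ : ℝ} (hζ : 0 < ζ) (a : ℝ) :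
    μ {ω | ζ * (2 * L) ^ 2 / 2 * T + a / ζ < ∑ t ∈ Finset.range T, ∑ i ∈ pairs S A,
      min 2 (2 * (counters κ (fun s => τ s ω) t).radius S T δ i.1 i.2) *
        (marg (occ S P (policyOf (q (t + 1) ω))) i.1 i.2 - visits (τ (t + 1) ω) i.1 i.2)} ≤
      ENNReal.ofReal (Real.exp (-a)) := by
  have hL0 : (0 : ℝ) < L := by have := hp.L_pos; positivity
  set ρ : ℕ → Ω → X × A → ℝ := fun t ω i =>
    min 2 (2 * (counters κ (fun s => τ s ω) t).radius S T δ i.1 i.2) with hρ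
  have hρ0 : ∀ t ω i, 0 ≤ ρ t ω i := fun t ω i =>
    le_min (by norm_num) (mul_nonneg (by norm_num) (Real.sqrt_nonneg _))
  have hρ2 : ∀ t ω i, ρ t ω i ≤ 2 := fun t ω i => min_le_left _ _
  have hρm : ∀ t, t < T → ∀ i, Measurable[F t] fun ω => ρ t ω i := fun t ht i =>
    R.measurable_comp_counters ht.le fun k => min 2 (2 * k.radius S T δ i.1 i.2)
  set m : ℕ → Ω → X × A → ℝ := fun t ω i =>
    marg (occ S P (policyOf (q (t + 1) ω))) i.1 i.2 with hm
  have hmm : ∀ t, t < T → ∀ i, Measurable[F t] fun ω => m t ω i := fun t ht i =>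
    @measurable_marg_occ X A _ _ L Ω (F t) S P (q (t + 1)) (R.q_meas t ht) i.1 i.2
  set ψ : ℕ → Ω → Traj X A L → ℝ := fun t ω σ =>
    ∑ i ∈ pairs S A, ρ t ω i * (m t ω i - visits σ i.1 i.2) with hψ
  have hψm : ∀ t, t < T → ∀ σ, Measurable[F t] fun ω => ψ t ω σ := fun t ht σ =>
    Finset.measurable_sum _ fun i _ => (hρm t ht i).mul ((hmm t ht i).sub_const _)
  have hψb : ∀ t, t < T → ∀ᵐ ω ∂μ, ∀ σ, |ψ t ω σ| ≤ 2 * L := fun t ht => by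
    filter_upwards [R.isSubPolicy ht] with ω hω σ
    have h1 : ∑ i ∈ pairs S A, m t ω i ≤ L := sum_marg_occ_le R.isTransition hω
    have h2 : ∑ i ∈ pairs S A, (visits σ i.1 i.2 : ℝ) ≤ L := by
      have h3 : ∑ i ∈ pairs S A, visits σ i.1 i.2 ≤ L := by
        exact (Finset.sum_le_sum_of_subset (Finset.subset_univ _)).trans (sum_visits σ).le
      exact_mod_cast h3
    have h4 : ∀ i, 0 ≤ ρ t ω i * m t ω i := fun i =>
      mul_nonneg (hρ0 t ω i) (marg_occ_nonneg R.isTransition hω _ _)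
    have h5 : ∀ i : X × A, 0 ≤ ρ t ω i * visits σ i.1 i.2 := fun i =>
      mul_nonneg (hρ0 t ω i) (Nat.cast_nonneg _)
    have h6 : ∑ i ∈ pairs S A, ρ t ω i * m t ω i ≤ 2 * L :=
      (Finset.sum_le_sum fun i _ => mul_le_mul_of_nonneg_right (hρ2 t ω i)
        (marg_occ_nonneg R.isTransition hω _ _)).trans (by rw [← Finset.mul_sum]; linarith)
    have h7 : ∑ i ∈ pairs S A, ρ t ω i * (visits σ i.1 i.2 : ℝ) ≤ 2 * L :=
      (Finset.sum_le_sum fun i _ => mul_le_mul_of_nonneg_right (hρ2 t ω i)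
        (Nat.cast_nonneg _)).trans (by rw [← Finset.mul_sum]; linarith)
    have h8 := Finset.sum_nonneg fun i (_ : i ∈ pairs S A) => h4 i
    have h9 := Finset.sum_nonneg fun i (_ : i ∈ pairs S A) => h5 i
    simp only [hψ, mul_sub, Finset.sum_sub_distrib]
    rw [abs_le]; constructor <;> linarith
  set D : ℕ → Ω → ℝ := fun t ω => ψ t ω (τ (t + 1) ω) with hD
  have hDb : ∀ u, u < T → ∀ᵐ ω ∂μ, |D u ω| ≤ 2 * L := fun u hu => by
    filter_upwards [hψb u hu] with ω hω
    exact hω _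
  have hDm : ∀ u, u < T → Measurable[F (u + 1)] (D u) := fun u hu => by
    refine Finset.measurable_sum _ fun i _ => Measurable.mul ?_ (Measurable.sub ?_ ?_)
    · exact (hρm u hu i).mono (R.F_mono (Nat.le_succ u)) le_rfl
    · exact (hmm u hu i).mono (R.F_mono (Nat.le_succ u)) le_rfl
    · exact R.measurable_comp_τ hu fun σ => (visits σ i.1 i.2 : ℝ)
  have hDn : ∀ u, u < T → IsNoise μ (F u) (D u) := fun u hu f hf hfb => by
    have h1 := R.integral_traj hu (fun ω σ => f ω * ψ u ω σ) (fun σ => hf.mul (hψm u hu σ))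
      (fun σ => hfb.mul ⟨2 * L, by filter_upwards [hψb u hu] with ω hω using hω σ⟩)
    refine h1.trans ?_
    refine integral_eq_zero_of_ae ?_
    filter_upwards [R.isSubPolicy hu, R.mass u hu] with ω hω hmass
    have h2 : ∑ σ, f ω * ψ u ω σ * trajProb S P (policyOf (q (u + 1) ω)) σ =
        f ω * ∑ i ∈ pairs S A, ρ u ω i * (m u ω i *
          (∑ σ, trajProb S P (policyOf (q (u + 1) ω)) σ) -
          ∑ σ, trajProb S P (policyOf (q (u + 1) ω)) σ * visits σ i.1 i.2) := by
      simp only [hψ, Finset.mul_sum, ← Finset.sum_sub_distrib]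
      rw [Finset.sum_congr rfl fun σ _ => Finset.sum_mul _ _ _, Finset.sum_comm]
      exact Finset.sum_congr rfl fun i _ => Finset.sum_congr rfl fun σ _ => by ring
    rw [h2, hmass]
    simp only [Pi.zero_apply]
    rw [Finset.sum_eq_zero, mul_zero]
    intro i _
    rw [sum_trajProb_visits R.isTransition hω hmass]
    simp [hm]
  have h := azuma (μ := μ) R.F_le R.F_mono (show (0 : ℝ) < 2 * L by positivity) hζ a hDm hDb hDn
    (Nat.zero_le T) le_rfl
  simpa using h

end PlayerRun

end PlayerRun

/-! ### Confidence sets -/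

section Confidence

variable {X A : Type*} [Fintype X] [Fintype A] {L : ℕ}
variable {Ω : Type*}

lemma visits_le (σ : Traj X A L) (x : X) (a : A) : visits σ x a ≤ L := by
  classical
  exact (Finset.card_le_univ _).trans (by simp)

/-- The deviation of one trajectory from the mean of the test function `s` after `(x, a)`. -/
noncomputable def deviation (P : X → A → X → ℝ) (s : X → ℝ) (x : X) (a : A) (σ : Traj X A L) : ℝ :=
  ∑ x', s x' * visits₃ σ x a x' - visits σ x a * ∑ x', P x a x' * s x'

/-- One visit contributes a subgaussian factor, no visit contributes nothing.  Compensating per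
visit, and not per episode, is what makes the confidence radius depend on the number of visits. -/
lemma sum_trajProb_exp_deviation_le {S : Layering X L} {P : X → A → X → ℝ} {π : X → A → ℝ}
    (hP : IsTransition S P) (hπ : IsSubPolicy π)
    (hmass : ∑ τ : Traj X A L, trajProb S P π τ = 1) {s : X → ℝ} (hs : ∀ x, |s x| ≤ 1) (r : ℝ)
    {x : X} (hx : S.layer x < L) (a : A) :
    ∑ σ : Traj X A L, Real.exp (r * deviation P s x a σ - r ^ 2 / 2 * visits σ x a) *
      trajProb S P π σ ≤ 1 := by
  set m := ∑ x', P x a x' * s x' with hm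
  set E : X → ℝ := fun x' => Real.exp (r * (s x' - m) - r ^ 2 / 2) with hE
  have h1 : ∀ σ : Traj X A L, Real.exp (r * deviation P s x a σ - r ^ 2 / 2 * visits σ x a) *
      trajProb S P π σ = trajProb S P π σ +
        ∑ x', (E x' - 1) * (trajProb S P π σ * visits₃ σ x a x') := by
    intro σ
    by_cases h0 : trajProb S P π σ = 0
    · simp [h0]
    have hpath := isPath_of_trajProb_ne_zero hP h0
    have h2 := hpath.visits_le_one x a
    have h3 := sum_visits₃ σ x a
    have h4 : Real.exp (r * deviation P s x a σ - r ^ 2 / 2 * visits σ x a) =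
        1 + ∑ x', (E x' - 1) * visits₃ σ x a x' := by
      rcases Nat.eq_zero_or_pos (visits σ x a) with hv | hv
      · rw [hv] at h3
        have h5 : ∀ x', visits₃ σ x a x' = 0 := fun x' =>
          Finset.sum_eq_zero_iff.1 h3 x' (Finset.mem_univ _)
        simp [deviation, hv, h5]
      · have hv1 : visits σ x a = 1 := by omega
        rw [hv1] at h3
        obtain ⟨y, hy⟩ : ∃ y, visits₃ σ x a y ≠ 0 := by
          by_contra h6
          push Not at h6
          rw [Finset.sum_eq_zero fun x' _ => h6 x'] at h3
          omega
        classical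
        have h5 : ∀ x', visits₃ σ x a x' = if x' = y then 1 else 0 := by
          rw [← Finset.add_sum_erase _ _ (Finset.mem_univ y)] at h3
          have h7 : ∑ x' ∈ Finset.univ.erase y, visits₃ σ x a x' = 0 := by omega
          intro x'
          split_ifs with h
          · rw [h]; omega
          · exact Finset.sum_eq_zero_iff.1 h7 x' (Finset.mem_erase.2 ⟨h, Finset.mem_univ _⟩)
        simp only [deviation, hv1, h5]
        simp [hE, hm]
    rw [h4, add_mul, one_mul, Finset.sum_mul]
    congr 1
    exact Finset.sum_congr rfl fun x' _ => by ring
  rw [Finset.sum_congr rfl fun σ _ => h1 σ, Finset.sum_add_distrib, hmass, Finset.sum_comm]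
  have h2 : ∀ x', ∑ σ : Traj X A L, (E x' - 1) * (trajProb S P π σ * visits₃ σ x a x') =
      stateDist S P π (S.layer x) x * π x a * (P x a x' * E x' - P x a x') := fun x' => by
    rw [← Finset.mul_sum, sum_trajProb_visits₃ hP hπ hmass, occ]; ring
  rw [Finset.sum_congr rfl fun x' _ => h2 x', ← Finset.mul_sum, Finset.sum_sub_distrib,
    hP.sum_eq_one x a hx]
  have h3 : ∑ x', P x a x' * E x' ≤ 1 := by
    have h4 := sum_mul_exp_le (hP.nonneg x a) (hP.sum_eq_one x a hx) hs r
    have h5 : ∀ x', P x a x' * E x' =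
        P x a x' * Real.exp (r * (s x' - m)) * Real.exp (-(r ^ 2 / 2)) := fun x' => by
      simp only [hE]; rw [mul_assoc, ← Real.exp_add]; rfl
    rw [Finset.sum_congr rfl fun x' _ => h5 x', ← Finset.sum_mul]
    calc _ ≤ Real.exp (r ^ 2 / 2) * Real.exp (-(r ^ 2 / 2)) :=
          mul_le_mul_of_nonneg_right h4 (Real.exp_pos _).le
      _ = 1 := by rw [← Real.exp_add]; simp
  have h4 : 0 ≤ stateDist S P π (S.layer x) x * π x a :=
    mul_nonneg (stateDist_nonneg hP hπ _ _) (hπ.nonneg x a)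
  have := mul_nonpos_of_nonneg_of_nonpos h4 (sub_nonpos.2 h3)
  linarith

lemma abs_deviation_le {S : Layering X L} {P : X → A → X → ℝ} (hP : IsTransition S P)
    {s : X → ℝ} (hs : ∀ x, |s x| ≤ 1) (x : X) (a : A) (σ : Traj X A L) :
    |deviation P s x a σ| ≤ 2 * L := by
  have hv : (visits σ x a : ℝ) ≤ L := by exact_mod_cast visits_le σ x a
  have h1 : |∑ x', s x' * visits₃ σ x a x'| ≤ L := by
    refine (Finset.abs_sum_le_sum_abs _ _).trans ?_
    calc _ ≤ ∑ x', (visits₃ σ x a x' : ℝ) := by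
          refine Finset.sum_le_sum fun x' _ => ?_
          rw [abs_mul, Nat.abs_cast]
          exact mul_le_of_le_one_left (Nat.cast_nonneg _) (hs x')
      _ = visits σ x a := by exact_mod_cast sum_visits₃ σ x a
      _ ≤ L := hv
  have h2 : |∑ x', P x a x' * s x'| ≤ 1 := by
    refine (Finset.abs_sum_le_sum_abs _ _).trans ((Finset.sum_le_sum fun x' _ => ?_).trans
      (hP.sum_le_one x a))
    rw [abs_mul, abs_of_nonneg (hP.nonneg _ _ _)]
    exact mul_le_of_le_one_right (hP.nonneg _ _ _) (hs x')
  have h3 : |(visits σ x a : ℝ) * ∑ x', P x a x' * s x'| ≤ L := by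
    rw [abs_mul, Nat.abs_cast]
    exact (mul_le_of_le_one_right (Nat.cast_nonneg _) h2).trans hv
  rw [deviation]
  have h4 := abs_le.1 h1
  have h5 := abs_le.1 h3
  rw [abs_le]; constructor <;> linarith

namespace PlayerRun

variable {m0 : MeasurableSpace Ω} {μ : Measure Ω} [IsProbabilityMeasure μ] {S : Layering X L}
  {P : X → A → X → ℝ} {g₀ : X → A → ℝ} {b : ℝ} {T κ : ℕ} {δ J : ℝ}
  {F : ℕ → MeasurableSpace Ω}
  {τ : ℕ → Ω → Traj X A L} {q : ℕ → Ω → X → A → X → ℝ} {lam : ℕ → Ω → ℝ}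
  {g c : ℕ → Ω → X → A → ℝ}
  (R : PlayerRun μ S P g₀ b T κ δ F τ q lam g c)

include R

/-- The exponential supermartingale of the deviations, compensated per visit. -/
lemma integral_exp_deviation_le {s : X → ℝ} (hs : ∀ x, |s x| ≤ 1) (r : ℝ)
    {x : X} (hx : S.layer x < L) (a : A) {t : ℕ} (ht : t ≤ T) :
    ∫ ω, Real.exp (∑ u ∈ Finset.range t, (r * deviation P s x a (τ (u + 1) ω) -
      r ^ 2 / 2 * visits (τ (u + 1) ω) x a)) ∂μ ≤ 1 := by
  induction t with
  | zero => simp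
  | succ t ih =>
    set e : Traj X A L → ℝ := fun σ => r * deviation P s x a σ - r ^ 2 / 2 * visits σ x a with he
    have heb : ∀ σ, |e σ| ≤ |r| * (2 * L) + r ^ 2 / 2 * L := fun σ => by
      refine (abs_sub _ _).trans (add_le_add ?_ ?_)
      · rw [abs_mul]
        exact mul_le_mul_of_nonneg_left (abs_deviation_le R.isTransition hs x a σ) (abs_nonneg _)
      · rw [abs_of_nonneg (by positivity)]
        refine mul_le_mul_of_nonneg_left ?_ (by positivity)
        exact_mod_cast visits_le σ x a
    have hbb : ∀ u, AEBdd μ fun ω => e (τ (u + 1) ω) := fun u =>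
      ⟨_, Filter.Eventually.of_forall fun ω => heb _⟩
    set W : Ω → ℝ := fun ω => Real.exp (∑ u ∈ Finset.range t, e (τ (u + 1) ω)) with hW
    have hWm : Measurable[F t] W := by
      refine Real.measurable_exp.comp (Finset.measurable_sum _ fun u hu => ?_)
      have hu' := Finset.mem_range.1 hu
      exact (R.measurable_comp_τ (by omega) e).mono (R.F_mono hu') le_rfl
    have hWb : AEBdd μ W := (AEBdd.sum _ fun u _ => hbb u).exp
    have h1 := R.integral_traj (t := t) (by omega) (fun ω σ => W ω * Real.exp (e σ))
      (fun σ => hWm.mul_const _) (fun σ => hWb.mul (AEBdd.const _))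
    have h2 : ∀ ω, Real.exp (∑ u ∈ Finset.range (t + 1), e (τ (u + 1) ω)) =
        W ω * Real.exp (e (τ (t + 1) ω)) := fun ω => by
      rw [Finset.sum_range_succ, Real.exp_add]
    rw [integral_congr_ae (Filter.Eventually.of_forall h2), h1]
    refine le_trans (integral_mono_ae ?_ (hWb.integrable (hWm.mono (R.F_le t) le_rfl)) ?_)
      (ih (by omega))
    · refine AEBdd.integrable (AEBdd.sum _ fun σ _ =>
        (hWb.mul (AEBdd.const _)).mul (R.aebdd_trajProb (by omega) σ)) ?_
      refine Finset.measurable_sum _ fun σ _ => Measurable.mul ?_ ?_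
      · exact (hWm.mono (R.F_le t) le_rfl).mul_const _
      · exact measurable_trajProb ((R.q_meas t (by omega)).mono (R.F_le t) le_rfl) σ
    · filter_upwards [R.isSubPolicy (t := t) (by omega), R.mass t (by omega)] with ω hω hmass
      have h3 := sum_trajProb_exp_deviation_le R.isTransition hω hmass hs r hx a
      have h4 : ∑ σ, W ω * Real.exp (e σ) * trajProb S P (policyOf (q (t + 1) ω)) σ =
          W ω * ∑ σ, Real.exp (e σ) * trajProb S P (policyOf (q (t + 1) ω)) σ := by
        rw [Finset.mul_sum]
        exact Finset.sum_congr rfl fun σ _ => by ring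
      rw [h4]
      exact mul_le_of_le_one_right (Real.exp_pos _).le h3

/-- Tail bound for the deviation at the time of the `n`-th visit. -/
lemma deviation_tail {s : X → ℝ} (hs : ∀ x, |s x| ≤ 1) {r : ℝ} (hr : 0 < r)
    {x : X} (hx : S.layer x < L) (a : A) {t : ℕ} (ht : t ≤ T) (n : ℕ) :
    μ {ω | total (fun u => τ u ω) t x a = n ∧
      n * r < ∑ u ∈ Finset.range t, deviation P s x a (τ (u + 1) ω)} ≤
      ENNReal.ofReal (Real.exp (-(n * r ^ 2 / 2))) := by
  set e : Traj X A L → ℝ := fun σ => r * deviation P s x a σ - r ^ 2 / 2 * visits σ x a with he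
  have h1 := R.integral_exp_deviation_le hs r hx a ht
  rw [← Real.exp_zero] at h1
  have hm : Measurable fun ω => ∑ u ∈ Finset.range t, e (τ (u + 1) ω) :=
    Finset.measurable_sum _ fun u hu => by
      have hu' := Finset.mem_range.1 hu
      exact (R.measurable_comp_τ (by omega) e).mono (R.F_le _) le_rfl
  have hb : AEBdd μ fun ω => ∑ u ∈ Finset.range t, e (τ (u + 1) ω) :=
    AEBdd.sum _ fun u _ => ⟨∑ σ, |e σ|, Filter.Eventually.of_forall fun ω =>
      Finset.single_le_sum (f := fun σ => |e σ|) (fun σ _ => abs_nonneg _) (Finset.mem_univ _)⟩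
  have h2 := measure_lt_le_of_integral_exp_le hm hb h1 (v := n * r ^ 2 / 2)
  rw [zero_sub] at h2
  refine (measure_mono fun ω hω => ?_).trans h2
  obtain ⟨h3, h4⟩ := hω
  have h5 : ∑ u ∈ Finset.range t, (visits (τ (u + 1) ω) x a : ℝ) = n := by
    rw [← h3]; simp [total]
  have h6 : ∑ u ∈ Finset.range t, e (τ (u + 1) ω) =
      r * ∑ u ∈ Finset.range t, deviation P s x a (τ (u + 1) ω) - r ^ 2 / 2 * n := by
    simp only [he, Finset.sum_sub_distrib, ← Finset.mul_sum, h5]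
  change n * r ^ 2 / 2 < ∑ u ∈ Finset.range t, e (τ (u + 1) ω)
  rw [h6]
  nlinarith [mul_lt_mul_of_pos_left h4 hr]

end PlayerRun

lemma sum_deviation {P : X → A → X → ℝ} {s : X → ℝ} {x : X} {a : A} (τ : ℕ → Traj X A L) (t : ℕ) :
    ∑ u ∈ Finset.range t, deviation P s x a (τ (u + 1)) =
      ∑ x', s x' * total₃ τ t x a x' - total τ t x a * ∑ x', P x a x' * s x' := by
  simp only [deviation, Finset.sum_sub_distrib, total, total₃, Nat.cast_sum]
  rw [Finset.sum_comm, ← Finset.sum_mul]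
  simp only [Finset.mul_sum]

open Classical in
/-- The sign vectors that witness the `ℓ¹` norm of a function on the next layer. -/
noncomputable def signOf (U : Finset X) (x : X) : ℝ := if x ∈ U then 1 else -1

lemma abs_signOf (U : Finset X) (x : X) : |signOf U x| ≤ 1 := by
  unfold signOf; split_ifs <;> simp

/-- Outside the deviation events the `ℓ¹` distance of the true to the empirical transition is within
the confidence radius.  With at most one successor state there is nothing to estimate, and without
visits the radius is larger than one. -/
lemma transition_mem {S : Layering X L} {P : X → A → X → ℝ} (hP : IsTransition S P) {T κ : ℕ}
    {δ J : ℝ} (hp : Params X A L T δ J) {τ : ℕ → Traj X A L}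
    (hτ : ∀ t, t < T → IsPath S (τ (t + 1)))
    (hgood : ∀ x a, S.layer x < L → 2 ≤ (S.level (S.layer x + 1)).card → ∀ t, t ≤ T →
      ∀ n, 1 ≤ n → n ≤ T → ∀ U, U ⊆ S.level (S.layer x + 1) → total τ t x a = n →
        ∑ u ∈ Finset.range t, deviation P (signOf U) x a (τ (u + 1)) ≤
          n * √(2 * (S.level (S.layer x + 1)).card * J / n))
    {t : ℕ} (ht : t ≤ T) : P ∈ (counters κ τ t).transitions S T δ := by
  classical
  refine ⟨hP, fun x a hx => ?_⟩
  obtain ⟨t', ht', hN, hM⟩ := exists_counters_eq_total (κ := κ) (τ := τ) t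
  have hJ := hp.J_one
  have hsumM : ∑ x', total₃ τ t' x a x' = total τ t' x a := sum_total₃ t' x a
  have hlay : ∀ x', S.layer x' ≠ S.layer x + 1 → total₃ τ t' x a x' = 0 := fun x' h =>
    total₃_eq_zero hτ (ht'.trans ht) h
  have hcard1 : 1 ≤ (S.level (S.layer x + 1)).card := by
    rw [Nat.one_le_iff_ne_zero]
    intro h0
    have h1 := hP.sum_level x a fun _ => 1
    rw [Finset.card_eq_zero.1 h0] at h1
    simp [hP.sum_eq_one x a hx] at h1
  simp only [Counters.radius, Counters.empirical, hN, hM, ← hp.J_eq]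
  set N := total τ t' x a with hNdef
  rcases Nat.eq_zero_or_pos N with h0 | h0
  · have h1 : ∀ x', total₃ τ t' x a x' = 0 := fun x' => by
      rw [h0] at hsumM
      exact Finset.sum_eq_zero_iff.1 hsumM x' (Finset.mem_univ _)
    have h2 : ∀ x', |P x a x' - (total₃ τ t' x a x' : ℝ) / max 1 (N : ℝ)| = P x a x' := fun x' => by
      rw [h1]; simp [abs_of_nonneg (hP.nonneg x a x')]
    rw [Finset.sum_congr rfl fun x' _ => h2 x', hP.sum_eq_one x a hx, h0]
    rw [Real.one_le_sqrt]
    have h3 : (1 : ℝ) ≤ (S.level (S.layer x + 1)).card := by exact_mod_cast hcard1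
    simp only [Nat.cast_zero, zero_le_one, sup_of_le_left, div_one]
    nlinarith
  have hN1 : (1 : ℝ) ≤ N := by exact_mod_cast h0
  rw [max_eq_right hN1]
  have hNpos : (0 : ℝ) < N := by linarith
  rcases hcard1.eq_or_lt with h1 | h1
  · obtain ⟨y, hy⟩ := Finset.card_eq_one.1 h1.symm
    have hne : ∀ x', x' ≠ y → S.layer x' ≠ S.layer x + 1 := fun x' h h' => by
      have := mem_level.2 h'
      rw [hy, Finset.mem_singleton] at this
      exact h this
    have hPy : P x a y = 1 := by
      rw [← hP.sum_eq_one x a hx, Finset.sum_eq_single y]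
      · exact fun x' _ h => hP.eq_zero (hne x' h)
      · simp
    have hMy : total₃ τ t' x a y = N := by
      rw [← hsumM, Finset.sum_eq_single y]
      · exact fun x' _ h => hlay x' (hne x' h)
      · simp
    rw [Finset.sum_eq_zero]
    · exact Real.sqrt_nonneg _
    · intro x' _
      by_cases h : x' = y
      · rw [h, hPy, hMy, div_self hNpos.ne']; simp
      · rw [hP.eq_zero (hne x' h), hlay x' (hne x' h)]; simp
  · set U := (S.level (S.layer x + 1)).filter
      fun x' => P x a x' < (total₃ τ t' x a x' : ℝ) / N with hU
    have h2 := hgood x a hx h1 t' (ht'.trans ht) N h0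
      ((total_le hτ (ht'.trans ht) x a).trans (ht'.trans ht)) U (Finset.filter_subset _ _) rfl
    rw [sum_deviation, ← hNdef] at h2
    have h3 : ∀ x', |P x a x' - (total₃ τ t' x a x' : ℝ) / N| =
        (signOf U x' * total₃ τ t' x a x' - N * (P x a x' * signOf U x')) / N := fun x' => by
      by_cases hl : S.layer x' = S.layer x + 1
      · by_cases h4 : P x a x' < (total₃ τ t' x a x' : ℝ) / N
        · have : signOf U x' = 1 := if_pos (Finset.mem_filter.2 ⟨mem_level.2 hl, h4⟩)
          rw [this, abs_of_neg (sub_neg.2 h4)]; field_simp; ring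
        · have : signOf U x' = -1 := if_neg fun (h : x' ∈ U) => h4 (Finset.mem_filter.1 h).2
          rw [this, abs_of_nonneg (sub_nonneg.2 (not_lt.1 h4))]; field_simp; ring
      · rw [hP.eq_zero hl, hlay x' hl]; simp
    rw [Finset.sum_congr rfl fun x' _ => h3 x', ← Finset.sum_div, Finset.sum_sub_distrib,
      ← Finset.mul_sum, div_le_iff₀ hNpos, mul_comm (√_)]
    exact h2

namespace PlayerRun

variable {m0 : MeasurableSpace Ω} {μ : Measure Ω} [IsProbabilityMeasure μ] {S : Layering X L}
  {P : X → A → X → ℝ} {g₀ : X → A → ℝ} {b : ℝ} {T κ : ℕ} {δ J : ℝ}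
  {F : ℕ → MeasurableSpace Ω}
  {τ : ℕ → Ω → Traj X A L} {q : ℕ → Ω → X → A → X → ℝ} {lam : ℕ → Ω → ℝ}
  {g c : ℕ → Ω → X → A → ℝ}
  (R : PlayerRun μ S P g₀ b T κ δ F τ q lam g c)

include R

/-- The true transition belongs to all confidence sets with high probability.  The union bound over
the times and the numbers of visits is affordable because only pairs with two or more successor
states count: for those the failure probability is squared. -/
lemma exists_confidence_event (hp : Params X A L T δ J) (hJ2 : 2 * Real.exp (-J) ≤ 1) :
    ∃ E : Set Ω, μ E ≤ ENNReal.ofReal ((Fintype.card X * Fintype.card A) * ((T + 1) * (T *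
        (2 * Real.exp (-J)) ^ 2))) ∧
      ∀ ω, ω ∉ E → (∀ t, t < T → IsPath S (τ (t + 1) ω)) →
        ∀ t, t ≤ T → P ∈ (counters κ (fun s => τ s ω) t).transitions S T δ := by
  classical
  set r : X → ℕ → ℝ := fun x n => √(2 * (S.level (S.layer x + 1)).card * J / n) with hr
  set Q := (pairs S A).filter fun i => 2 ≤ (S.level (S.layer i.1 + 1)).card with hQ
  set bad : X × A → ℕ → ℕ → Finset X → Set Ω := fun i t n U =>
    {ω | total (fun u => τ u ω) t i.1 i.2 = n ∧ n * r i.1 n <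
      ∑ u ∈ Finset.range t, deviation P (signOf U) i.1 i.2 (τ (u + 1) ω)} with hbad
  set y : ℝ := 2 * Real.exp (-J) with hy
  have hy0 : 0 ≤ y := by positivity
  have hJ := hp.J_one
  have hbad_le : ∀ i ∈ Q, ∀ t ∈ Finset.range (T + 1), ∀ n ∈ Finset.Icc 1 T, ∀ U : Finset X,
      μ (bad i t n U) ≤
        ENNReal.ofReal (Real.exp (-J) ^ (S.level (S.layer i.1 + 1)).card) := by
    intro i hi t ht n hn U
    obtain ⟨hi1, hi2⟩ := Finset.mem_filter.1 hi
    have hn0 : (0 : ℝ) < n := by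
      have := (Finset.mem_Icc.1 hn).1
      exact_mod_cast this
    have hc0 : (0 : ℝ) < (S.level (S.layer i.1 + 1)).card := by
      exact_mod_cast (by omega : 0 < (S.level (S.layer i.1 + 1)).card)
    have hr0 : 0 < r i.1 n := Real.sqrt_pos.2 (by positivity)
    refine (R.deviation_tail (abs_signOf U) hr0 (mem_pairs.1 hi1) i.2
      (Nat.lt_succ_iff.1 (Finset.mem_range.1 ht)) n).trans (le_of_eq ?_)
    rw [← Real.exp_nat_mul]
    congr 2
    simp only [hr]
    rw [Real.sq_sqrt (by positivity)]
    field_simp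
  refine ⟨⋃ i ∈ Q, ⋃ t ∈ Finset.range (T + 1), ⋃ n ∈ Finset.Icc 1 T,
    ⋃ U ∈ (S.level (S.layer i.1 + 1)).powerset, bad i t n U, ?_, ?_⟩
  · have h1 : ∀ i ∈ Q, ∀ t ∈ Finset.range (T + 1), ∀ n ∈ Finset.Icc 1 T,
        μ (⋃ U ∈ (S.level (S.layer i.1 + 1)).powerset, bad i t n U) ≤ ENNReal.ofReal (y ^ 2) := by
      intro i hi t ht n hn
      refine (measure_biUnion_finset_le _ _).trans ?_
      refine (Finset.sum_le_sum fun U _ => hbad_le i hi t ht n hn U).trans ?_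
      rw [Finset.sum_const, Finset.card_powerset, ← ENNReal.ofReal_nsmul]
      refine ENNReal.ofReal_le_ofReal ?_
      rw [nsmul_eq_mul]
      push_cast
      rw [← mul_pow]
      exact pow_le_pow_of_le_one hy0 hJ2 (Finset.mem_filter.1 hi).2
    refine (measure_biUnion_finset_le _ _).trans ?_
    have h2 : ∀ i ∈ Q, μ (⋃ t ∈ Finset.range (T + 1), ⋃ n ∈ Finset.Icc 1 T,
        ⋃ U ∈ (S.level (S.layer i.1 + 1)).powerset, bad i t n U) ≤
        ENNReal.ofReal ((T + 1) * (T * y ^ 2)) := by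
      intro i hi
      refine (measure_biUnion_finset_le _ _).trans ?_
      refine (Finset.sum_le_sum fun t ht => (measure_biUnion_finset_le _ _).trans
        (Finset.sum_le_sum fun n hn => h1 i hi t ht n hn)).trans ?_
      rw [Finset.sum_const, Finset.sum_const, ← ENNReal.ofReal_nsmul, ← ENNReal.ofReal_nsmul]
      refine ENNReal.ofReal_le_ofReal (le_of_eq ?_)
      simp
    refine (Finset.sum_le_sum h2).trans ?_
    rw [Finset.sum_const, ← ENNReal.ofReal_nsmul]
    refine ENNReal.ofReal_le_ofReal ?_
    rw [nsmul_eq_mul]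
    refine mul_le_mul_of_nonneg_right ?_ (by positivity)
    rw [← Nat.cast_mul, ← Fintype.card_prod]
    exact_mod_cast Finset.card_le_univ _
  · intro ω hω hpath t ht
    refine transition_mem R.isTransition hp hpath ?_ ht
    intro x a hx hc t ht n hn hn' U hU htot
    by_contra h
    refine hω ?_
    simp only [Set.mem_iUnion]
    exact ⟨(x, a), Finset.mem_filter.2 ⟨mem_pairs.2 hx, hc⟩, t,
      Finset.mem_range.2 (Nat.lt_succ_iff.2 ht), n, Finset.mem_Icc.2 ⟨hn, hn'⟩, U,
      Finset.mem_powerset.2 hU, htot, not_le.1 h⟩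

end PlayerRun

end Confidence

/-! ### High-probability bounds for one player -/

section OnePlayer

variable {X A : Type*} [Fintype X] [Fintype A] {L : ℕ}
variable {Ω : Type*}

/-- The parameters of the theorem satisfy the numerical conditions of the analysis. -/
lemma Params.of_delta {T : ℕ} {p : ℝ} (hL : 1 ≤ L) (hX : 2 ≤ Fintype.card X) [Nonempty A]
    (hT : Fintype.card X * Fintype.card A ≤ T) (hp0 : 0 < p) (hp1 : p < 1) :
    Params X A L T (p / (2 * T)) (Real.log (2 * T ^ 2 * (Fintype.card X * Fintype.card A) / p)) ∧
      Real.exp (-Real.log (2 * T ^ 2 * (Fintype.card X * Fintype.card A) / p)) =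
        p / (2 * T ^ 2 * (Fintype.card X * Fintype.card A)) := by
  have hA : 1 ≤ Fintype.card A := Fintype.card_pos
  have hU : 2 ≤ Fintype.card X * Fintype.card A := by nlinarith
  have hT2 : 2 ≤ T := hU.trans hT
  have hU' : (2 : ℝ) ≤ Fintype.card X * Fintype.card A := by exact_mod_cast hU
  have hT2' : (2 : ℝ) ≤ T := by exact_mod_cast hT2
  set U : ℝ := Fintype.card X * Fintype.card A with hUdef
  have hpos : 0 < 2 * (T : ℝ) ^ 2 * U / p := by positivity
  have hTT : (T : ℝ) ≤ T ^ 2 := by nlinarith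
  have hbig : T * U ≤ 2 * (T : ℝ) ^ 2 * U / p := by
    rw [le_div_iff₀ hp0]
    have h1 : T * U * p ≤ T * U := mul_le_of_le_one_right (by positivity) hp1.le
    have h2 : T * U ≤ (T : ℝ) ^ 2 * U := mul_le_mul_of_nonneg_right hTT (by positivity)
    nlinarith
  have h3 : (3 : ℝ) ≤ T * U := by nlinarith
  refine ⟨⟨hL, hT2, hT, ?_, ?_, ?_, ?_⟩, ?_⟩
  · rw [Real.le_log_iff_exp_le hpos]
    exact (Real.exp_one_lt_d9.le.trans (by norm_num : (2.7182818286 : ℝ) ≤ 3)).trans (h3.trans hbig)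
  · congr 1
    rw [hUdef]; field_simp
  · rw [Real.exp_log hpos]; exact hbig
  · refine Real.log_le_log (by linarith) (le_trans ?_ hbig)
    exact le_mul_of_one_le_right (by linarith) (by linarith)
  · rw [Real.exp_neg, Real.exp_log hpos, inv_div]

namespace PlayerPath

variable {S : Layering X L} {b : ℝ} {T κ : ℕ} {δ J : ℝ} {τ : ℕ → Traj X A L}
  {q : ℕ → X → A → X → ℝ} {lam : ℕ → ℝ} {g c : ℕ → X → A → ℝ}
  (H : PlayerPath S b T κ δ τ q lam g c)

include H

/-- The dual variable dominates the accumulated violation. -/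
lemma sum_violation_succ_le {t : ℕ} (ht : t ≤ T) :
    ∑ u ∈ Finset.range t, (utility S (q (u + 1)) (g u) - b) ≤ lam t := by
  induction t with
  | zero => simp [H.lam_zero]
  | succ t ih =>
    rw [Finset.sum_range_succ, H.dual t ht]
    exact le_max_of_le_left (add_le_add (ih (by omega)) le_rfl)

/-- The deterministic part of the analysis of one player: on the event where the true transition is
never excluded and the three kinds of noise are controlled, regret, violation and estimation error
are small. -/
lemma bounds (hp : Params X A L T δ J) (hκ : κ ≤ 1) {P : X → A → X → ℝ} {g₀ : X → A → ℝ}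
    (hP : ∀ t, t ≤ T → P ∈ (counters κ τ t).transitions S T δ)
    {q' q'' : X → A → X → ℝ} (hq' : q' ∈ occSet S P) (hq'' : q'' ∈ occSet S P) {ξ : ℝ}
    (hξ : 0 < ξ) (hfeas : utility S q' g₀ + ξ ≤ b) (hfeas' : utility S q'' g₀ ≤ b) {Λ : ℝ}
    (hΛ : Λ = 100 * (1 + 1 / ξ) * ((L : ℝ) ^ 2 * √T * J))
    (hwin : ∀ s t, 1 ≤ s → s ≤ t → t ≤ T → ∑ u ∈ Finset.Ico s t,
      (if lam u ≤ Λ then lam u else 0) * (utility S q' (g u) - utility S q' g₀) ≤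
        ξ * Λ / 4 * ((t : ℝ) - s) + 6 * J * Λ * (L : ℝ) ^ 2 / ξ)
    (hcomp : ∑ u ∈ Finset.Ico 1 T,
      (if lam u ≤ Λ then lam u else 0) * (utility S q'' (g u) - utility S q'' g₀) ≤
        Λ * L * √T * (1 / 2 + 3 * J))
    (hvis : ∑ t ∈ Finset.range T, ∑ i ∈ pairs S A,
      min 2 (2 * (counters κ τ t).radius S T δ i.1 i.2) *
        (marg (occ S P (policyOf (q (t + 1)))) i.1 i.2 - visits (τ (t + 1)) i.1 i.2) ≤
      2 * L * √T * (1 / 2 + 3 * J))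
    {K : ℝ} (hK : K = 2000 * (1 + 1 / ξ) *
      (J ^ 2 * (Fintype.card X * L * √(T * Fintype.card A)))) :
    ∑ t ∈ Finset.range T, (utility S (q t) (c t) - utility S q'' (c t)) ≤ K ∧
    ∑ t ∈ Finset.range T, (utility S (q t) (g t) - b) ≤ K ∧
    ∑ t ∈ Finset.range T, occDist S (occ S P (policyOf (q t))) (q t) ≤ K := by
  have hdom' : ∀ u, u < T → q' ∈ (counters κ τ u).domain S T δ := fun u hu => ⟨P, hP u hu.le, hq'⟩
  have hdom'' : ∀ u, u < T → q'' ∈ (counters κ τ u).domain S T δ := fun u hu =>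
    ⟨P, hP u hu.le, hq''⟩
  have hT2 := hp.T_two
  have hlam : ∀ t, t ≤ T → lam t ≤ Λ := fun t ht => H.lam_le hp hdom' hξ hfeas hΛ hwin ht
  have hreg := H.regret_succ_le hp hdom'' hfeas' hlam hcomp
  have hstab := H.sum_occDist_succ_le hp hlam
  have hest := H.sum_occDist_occ_le hp hκ (fun t ht => hP t ht.le) hvis
  have hPt : IsTransition S P := (hP 0 (Nat.zero_le _)).1
  have hA := H.nonempty_action hp
  have hLX := H.L_lt_card hp
  have hA1 : (1 : ℝ) ≤ Fintype.card A := by exact_mod_cast Fintype.card_pos (α := A)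
  have hL1 : (1 : ℝ) ≤ L := by exact_mod_cast hp.L_pos
  have hJ := hp.J_one
  have hLX' : (L : ℝ) ≤ Fintype.card X := by exact_mod_cast (by omega : L ≤ Fintype.card X)
  have hX1 : (1 : ℝ) ≤ Fintype.card X := hL1.trans hLX'
  have hξ1 : 1 ≤ 1 + 1 / ξ := by have := one_div_pos.2 hξ; linarith
  set x : ℝ := (Fintype.card X : ℝ) with hx
  set s : ℝ := √(T * Fintype.card A) with hs
  set z : ℝ := 1 + 1 / ξ with hz
  have hsT : √(T : ℝ) ≤ s := Real.sqrt_le_sqrt (le_mul_of_one_le_right (Nat.cast_nonneg _) hA1)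
  have hs1 : 1 ≤ √(T : ℝ) := Real.one_le_sqrt.2 (by exact_mod_cast (by omega : 1 ≤ T))
  have hs0 : 0 < s := by linarith
  have hJ2 : J ≤ J ^ 2 := by nlinarith
  have hsJ : √J ≤ J := by
    rw [Real.sqrt_le_left (by linarith)]; exact hJ2
  set D : ℝ := z * (J ^ 2 * (x * L * s)) with hD
  have hD0 : J ^ 2 * (x * L * s) ≤ D := le_mul_of_one_le_left (by positivity) hξ1
  have hb0 : x * L * s ≤ J ^ 2 * (x * L * s) :=
    le_mul_of_one_le_left (by positivity) (by nlinarith)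
  have hb1 : J * (x * L * s) ≤ J ^ 2 * (x * L * s) := mul_le_mul_of_nonneg_right hJ2 (by positivity)
  have hc1 : (L : ℝ) * √T ≤ x * L * s := by
    calc (L : ℝ) * √T ≤ L * s := by gcongr
      _ ≤ x * (L * s) := le_mul_of_one_le_left (by positivity) hX1
      _ = _ := by ring
  have hc2 : (L : ℝ) ^ 2 * √T ≤ x * L * s := by
    calc (L : ℝ) ^ 2 * √T = L * L * √T := by ring
      _ ≤ x * L * s := by gcongr
  have hd1 : L * √T ≤ D := by linarith
  have hd2 : L * √T * J ≤ D := by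
    have : L * √T * J ≤ x * L * s * J := mul_le_mul_of_nonneg_right hc1 (by linarith)
    linarith
  have hd3 : (L : ℝ) ^ 2 * √T * J ≤ J * (x * L * s) := by
    have : (L : ℝ) ^ 2 * √T * J ≤ x * L * s * J := mul_le_mul_of_nonneg_right hc2 (by linarith)
    linarith
  have hz0 : 0 ≤ z := by linarith
  have hd4 : Λ ≤ 100 * D := by
    have : z * ((L : ℝ) ^ 2 * √T * J) ≤ D := mul_le_mul_of_nonneg_left (hd3.trans hb1) hz0
    rw [hΛ]; linarith
  have hd5 : Λ * J ≤ 100 * D := by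
    have h1 : z * ((L : ℝ) ^ 2 * √T * J * J) ≤ D := by
      refine mul_le_mul_of_nonneg_left ?_ hz0
      calc (L : ℝ) ^ 2 * √T * J * J ≤ J * (x * L * s) * J :=
            mul_le_mul_of_nonneg_right hd3 (by linarith)
        _ = _ := by ring
    rw [hΛ]; linarith
  have hd6 : L * J * √(T * (x * Fintype.card A)) ≤ D := by
    have h1 : √(T * (x * Fintype.card A)) ≤ x * s := by
      rw [show (T : ℝ) * (x * Fintype.card A) = x * (T * Fintype.card A) by ring,
        Real.sqrt_mul (by linarith)]
      refine mul_le_mul_of_nonneg_right ?_ hs0.le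
      rw [Real.sqrt_le_left (by linarith)]
      nlinarith
    have h2 : L * J * √(T * (x * Fintype.card A)) ≤ L * J * (x * s) :=
      mul_le_mul_of_nonneg_left h1 (by positivity)
    have h3 : L * J * (x * s) = J * (x * L * s) := by ring
    linarith
  have hd7 : L * (√J * (x * s)) ≤ D := by
    have h2 : L * (√J * (x * s)) ≤ L * (J * (x * s)) := by gcongr
    have h3 : L * (J * (x * s)) = J * (x * L * s) := by ring
    linarith
  have hd8 : (L : ℝ) ≤ D := (le_mul_of_one_le_right (by linarith) hs1).trans hd1
  have hKD : K = 2000 * D := by rw [hK, hD]; ring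
  have hD0' : 0 ≤ D := by linarith
  have hstab' : ∑ t ∈ Finset.range T, occDist S (q t) (q (t + 1)) ≤ 1639 * D := by linarith
  refine ⟨?_, ?_, ?_⟩
  · have h1 : ∑ t ∈ Finset.range T, (utility S (q t) (c t) - utility S q'' (c t)) ≤
        ∑ t ∈ Finset.range T, occDist S (q t) (q (t + 1)) +
          ∑ t ∈ Finset.range T, (utility S (q (t + 1)) (c t) - utility S q'' (c t)) := by
      rw [← Finset.sum_add_distrib]
      refine Finset.sum_le_sum fun t ht => ?_
      have := utility_sub_le_occDist S (q t) (q (t + 1)) (H.c_le t (Finset.mem_range.1 ht))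
      linarith only [this]
    linarith only [h1, hstab', hreg, hd2, hd5, hKD, hD0']
  · have h1 : ∑ t ∈ Finset.range T, (utility S (q t) (g t) - b) ≤
        ∑ t ∈ Finset.range T, occDist S (q t) (q (t + 1)) +
          ∑ t ∈ Finset.range T, (utility S (q (t + 1)) (g t) - b) := by
      rw [← Finset.sum_add_distrib]
      refine Finset.sum_le_sum fun t ht => ?_
      have := utility_sub_le_occDist S (q t) (q (t + 1)) (g := g t) fun x a => by
        rw [abs_of_nonneg (H.g_mem t x a).1]; exact (H.g_mem t x a).2
      linarith
    have h2 := H.sum_violation_succ_le le_rfl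
    have h3 := hlam T le_rfl
    linarith only [h1, h2, h3, hstab', hd4, hKD, hD0']
  · obtain ⟨n, rfl⟩ : ∃ n, T = n + 1 := ⟨T - 1, by omega⟩
    rw [Finset.sum_range_succ']
    have hm0 : IsMarg S (q 0) := H.isMarg hp (Nat.zero_le _)
    have h0 : occDist S (occ S P (policyOf (q 0))) (q 0) ≤ 2 * L := by
      have hsub := isSubPolicy_policyOf hm0
      have h1 := sum_marg_occ_le hPt hsub
      have h2 := hm0.sum_pairs
      have h3 : occDist S (occ S P (policyOf (q 0))) (q 0) ≤
          ∑ i ∈ pairs S A, (marg (occ S P (policyOf (q 0))) i.1 i.2 + marg (q 0) i.1 i.2) := by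
        refine Finset.sum_le_sum fun i _ => (abs_sub _ _).trans ?_
        rw [abs_of_nonneg (marg_occ_nonneg hPt hsub _ _), abs_of_nonneg (hm0.nonneg _ _)]
      rw [Finset.sum_add_distrib] at h3
      linarith
    have h1 : ∑ t ∈ Finset.range n, occDist S (occ S P (policyOf (q (t + 1)))) (q (t + 1)) ≤
        ∑ t ∈ Finset.range (n + 1), occDist S (occ S P (policyOf (q (t + 1)))) (q (t + 1)) := by
      rw [Finset.sum_range_succ]
      exact le_add_of_nonneg_right (occDist_nonneg _ _ _)
    have h2 : (L : ℝ) * (12 * √J * (x * s) + 7 * (L * √((n + 1 : ℕ) : ℝ) * J)) =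
        12 * (L * (√J * (x * s))) + 7 * ((L : ℝ) ^ 2 * √((n + 1 : ℕ) : ℝ) * J) := by ring
    rw [h2] at hest
    linarith only [hest, h1, h0, hd7, hd3, hb1, hD0, hd8, hKD, hD0']

end PlayerPath

/-- The failure probabilities of all events for one player add up to at most `p / 2`. -/
lemma failure_budget {T U p e : ℝ} (hT : 2 ≤ T) (hU : 2 ≤ U) (hp0 : 0 ≤ p) (hp1 : p ≤ 1)
    (he0 : 0 ≤ e) (hep : e ≤ p / 16) (heq : e * (2 * (T ^ 2 * U)) = p) :
    U * ((T + 1) * (T * (2 * e) ^ 2)) + (T + 1) ^ 2 * e ^ 3 + e ^ 3 + e ^ 3 ≤ p / 2 := by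
  have h1 : U * ((T + 1) * (T * (2 * e) ^ 2)) ≤ 3 * (p * e) := by
    have h2 : (T + 1) * T ≤ 3 / 2 * T ^ 2 := by nlinarith
    calc U * ((T + 1) * (T * (2 * e) ^ 2)) = (T + 1) * T * (4 * (U * e ^ 2)) := by ring
      _ ≤ 3 / 2 * T ^ 2 * (4 * (U * e ^ 2)) := mul_le_mul_of_nonneg_right h2 (by positivity)
      _ = 3 * (e * (2 * (T ^ 2 * U)) * e) := by ring
      _ = 3 * (p * e) := by rw [heq]
  have h3 : (T + 1) ^ 2 * e ^ 3 ≤ p * e ^ 2 := by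
    have h2 : (T + 1) ^ 2 ≤ 4 * T ^ 2 := by nlinarith
    have h2' : 4 * T ^ 2 ≤ 2 * (T ^ 2 * U) := by
      have := mul_le_mul_of_nonneg_left hU (sq_nonneg T)
      linarith
    calc (T + 1) ^ 2 * e ^ 3 ≤ 2 * (T ^ 2 * U) * e ^ 3 :=
          mul_le_mul_of_nonneg_right (h2.trans h2') (by positivity)
      _ = e * (2 * (T ^ 2 * U)) * e ^ 2 := by ring
      _ = p * e ^ 2 := by rw [heq]
  have h4 : e ^ 2 ≤ e / 16 := by nlinarith
  have h5 : e ^ 3 ≤ e / 16 := by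
    calc e ^ 3 = e ^ 2 * e := by ring
      _ ≤ e / 16 * e := mul_le_mul_of_nonneg_right h4 he0
      _ ≤ e / 16 := mul_le_of_le_one_right (by positivity) (by linarith)
  have h6 : p * e ≤ e := mul_le_of_le_one_left he0 hp1
  have h7 : p * e ^ 2 ≤ e ^ 2 := mul_le_of_le_one_left (by positivity) hp1
  linarith

namespace PlayerRun

variable {m0 : MeasurableSpace Ω} {μ : Measure Ω} [IsProbabilityMeasure μ] {S : Layering X L}
  {P : X → A → X → ℝ} {g₀ : X → A → ℝ} {b : ℝ} {T κ : ℕ} {δ J : ℝ}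
  {F : ℕ → MeasurableSpace Ω}
  {τ : ℕ → Ω → Traj X A L} {q : ℕ → Ω → X → A → X → ℝ} {lam : ℕ → Ω → ℝ}
  {g c : ℕ → Ω → X → A → ℝ}
  (R : PlayerRun μ S P g₀ b T κ δ F τ q lam g c)

include R

/-- Outside an event of probability at most `p / 2`, all the bounds for one player hold. -/
lemma exists_bounds_event {p : ℝ} (hp : Params X A L T δ J) (hκ : κ ≤ 1)
    (hX : 2 ≤ Fintype.card X * Fintype.card A) (hp0 : 0 < p) (hp1 : p < 1)
    (hexp : Real.exp (-J) = p / (2 * T ^ 2 * (Fintype.card X * Fintype.card A)))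
    {q' q'' : X → A → X → ℝ} (hq' : q' ∈ occSet S P) (hq'' : q'' ∈ occSet S P) {ξ : ℝ}
    (hξ : 0 < ξ) (hfeas : utility S q' g₀ + ξ ≤ b) (hfeas' : utility S q'' g₀ ≤ b)
    {K : ℝ} (hK : K = 2000 * (1 + 1 / ξ) *
      (J ^ 2 * (Fintype.card X * L * √(T * Fintype.card A)))) :
    ∃ E : Set Ω, μ E ≤ ENNReal.ofReal (p / 2) ∧ ∀ ω, ω ∉ E →
      ∑ t ∈ Finset.range T, (utility S (q t ω) (c t ω) - utility S q'' (c t ω)) ≤ K ∧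
      ∑ t ∈ Finset.range T, (utility S (q t ω) (g t ω) - b) ≤ K ∧
      ∑ t ∈ Finset.range T, occDist S (occ S P (policyOf (q t ω))) (q t ω) ≤ K := by
  classical
  have hT2 : (2 : ℝ) ≤ T := by exact_mod_cast hp.T_two
  have hL1 : (1 : ℝ) ≤ L := by exact_mod_cast hp.L_pos
  have hJ := hp.J_one
  have hU : (2 : ℝ) ≤ Fintype.card X * Fintype.card A := by exact_mod_cast hX
  have hsT0 : 0 < √(T : ℝ) := Real.sqrt_pos.2 (by linarith)
  have hsT2 : √(T : ℝ) ^ 2 = T := Real.sq_sqrt (by linarith)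
  set Λ : ℝ := 100 * (1 + 1 / ξ) * ((L : ℝ) ^ 2 * √T * J) with hΛ
  have hΛ0 : 0 < Λ := by positivity
  have hm' := isMarg_of_mem_occSet R.isTransition hq'
  have hm'' := isMarg_of_mem_occSet R.isTransition hq''
  set U : ℝ := Fintype.card X * Fintype.card A with hUdef
  set e : ℝ := Real.exp (-J) with he
  have he0 : 0 < e := Real.exp_pos _
  have he3 : Real.exp (-(3 * J)) = e ^ 3 := by
    rw [he, ← Real.exp_nat_mul]; congr 1; push_cast; ring
  have hT4 : (4 : ℝ) ≤ T ^ 2 := by nlinarith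
  have hTU : (8 : ℝ) ≤ T ^ 2 * U := by nlinarith
  have heq : e * (2 * (T ^ 2 * U)) = p := by
    rw [hexp]; field_simp
  have hep : e ≤ p / 16 := by nlinarith
  obtain ⟨E₁, hE₁, hE₁'⟩ := R.exists_confidence_event hp (by linarith)
  -- the windows on which the dual variable stays above its threshold
  set W : Finset (ℕ × ℕ) := (Finset.range (T + 1) ×ˢ Finset.range (T + 1)).filter
    fun i => 1 ≤ i.1 ∧ i.1 ≤ i.2 with hW
  set E₂ : Set Ω := ⋃ i ∈ W, {ω | ξ * Λ / 4 * ((i.2 : ℝ) - i.1) + 6 * J * Λ * (L : ℝ) ^ 2 / ξ <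
    ∑ u ∈ Finset.Ico i.1 i.2, (if lam u ω ≤ Λ then lam u ω else 0) *
      (utility S q' (g u ω) - utility S q' g₀)} with hE₂
  have hE₂le : μ E₂ ≤ ENNReal.ofReal ((T + 1) ^ 2 * e ^ 3) := by
    have h1 : ∀ i ∈ W, μ {ω | ξ * Λ / 4 * ((i.2 : ℝ) - i.1) + 6 * J * Λ * (L : ℝ) ^ 2 / ξ <
        ∑ u ∈ Finset.Ico i.1 i.2, (if lam u ω ≤ Λ then lam u ω else 0) *
          (utility S q' (g u ω) - utility S q' g₀)} ≤ ENNReal.ofReal (e ^ 3) := by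
      intro i hi
      obtain ⟨h2, h3, h4⟩ := Finset.mem_filter.1 hi
      have h5 := Nat.lt_succ_iff.1 (Finset.mem_range.1 (Finset.mem_product.1 h2).2)
      -- this exponent makes the variance term `ξ Λ / 4` per episode, which the drift absorbs
      have h6 := R.utility_noise hp hm' hΛ0 (ζ := ξ / (2 * Λ * L ^ 2)) (by positivity) (3 * J)
        h3 h4 h5
      rw [he3] at h6
      refine le_trans (le_of_eq ?_) h6
      have e1 : ξ / (2 * Λ * (L : ℝ) ^ 2) * (Λ * L) ^ 2 / 2 = ξ * Λ / 4 := by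
        field_simp; ring
      have e2 : 3 * J / (ξ / (2 * Λ * (L : ℝ) ^ 2)) = 6 * J * Λ * (L : ℝ) ^ 2 / ξ := by
        field_simp; ring
      rw [e1, e2]
    refine (measure_biUnion_finset_le _ _).trans ((Finset.sum_le_sum h1).trans ?_)
    rw [Finset.sum_const, ← ENNReal.ofReal_nsmul, nsmul_eq_mul]
    refine ENNReal.ofReal_le_ofReal (mul_le_mul_of_nonneg_right ?_ (by positivity))
    have h2 : W.card ≤ (T + 1) * (T + 1) :=
      (Finset.card_filter_le _ _).trans (by rw [Finset.card_product, Finset.card_range])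
    calc (W.card : ℝ) ≤ ((T + 1) * (T + 1) : ℕ) := by exact_mod_cast h2
      _ = _ := by push_cast; ring
  set E₃ : Set Ω := {ω | Λ * L * √T * (1 / 2 + 3 * J) < ∑ u ∈ Finset.Ico 1 T,
    (if lam u ω ≤ Λ then lam u ω else 0) * (utility S q'' (g u ω) - utility S q'' g₀)} with hE₃
  have hE₃le : μ E₃ ≤ ENNReal.ofReal (e ^ 3) := by
    have h6 := R.utility_noise hp hm'' hΛ0 (ζ := 1 / (Λ * L * √T)) (by positivity) (3 * J)
      le_rfl (by have := hp.T_two; omega) le_rfl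
    rw [he3] at h6
    refine (measure_mono fun ω hω => ?_).trans h6
    refine lt_of_le_of_lt ?_ (Set.mem_ofPred_eq ▸ hω)
    have e1 : 1 / (Λ * L * √(T : ℝ)) * (Λ * L) ^ 2 / 2 * T = Λ * L * √T * (1 / 2) := by
      nth_rewrite 2 [← hsT2]; field_simp
    have e2 : 3 * J / (1 / (Λ * L * √(T : ℝ))) = Λ * L * √T * (3 * J) := by
      field_simp
    have e3 : 1 / (Λ * L * √(T : ℝ)) * (Λ * L) ^ 2 / 2 * (T - (1 : ℕ)) ≤
        1 / (Λ * L * √(T : ℝ)) * (Λ * L) ^ 2 / 2 * T :=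
      mul_le_mul_of_nonneg_left (by simp) (by positivity)
    rw [e2]
    linarith
  set E₄ : Set Ω := {ω | 2 * L * √T * (1 / 2 + 3 * J) <
    ∑ t ∈ Finset.range T, ∑ i ∈ pairs S A,
      min 2 (2 * (counters κ (fun s => τ s ω) t).radius S T δ i.1 i.2) *
        (marg (occ S P (policyOf (q (t + 1) ω))) i.1 i.2 - visits (τ (t + 1) ω) i.1 i.2)} with hE₄
  have hE₄le : μ E₄ ≤ ENNReal.ofReal (e ^ 3) := by
    have h6 := R.visits_noise hp (ζ := 1 / (2 * L * √T)) (by positivity) (3 * J)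
    rw [he3] at h6
    refine le_trans (le_of_eq ?_) h6
    have e1 : 1 / (2 * L * √(T : ℝ)) * (2 * L) ^ 2 / 2 * T = 2 * L * √T * (1 / 2) := by
      nth_rewrite 2 [← hsT2]; field_simp
    have e2 : 3 * J / (1 / (2 * L * √(T : ℝ))) = 2 * L * √T * (3 * J) := by
      field_simp
    rw [e1, e2, hE₄, mul_add]
  set E₅ : Set Ω := {ω | ¬ PlayerPath S b T κ δ (fun t => τ t ω) (fun t => q t ω)
    (fun t => lam t ω) (fun t => g t ω) (fun t => c t ω)} with hE₅
  have hE₅le : μ E₅ = 0 := R.path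
  refine ⟨E₁ ∪ E₂ ∪ E₃ ∪ E₄ ∪ E₅, ?_, ?_⟩
  · refine (measure_union_le _ _).trans ?_
    rw [hE₅le, add_zero]
    refine (measure_union_le _ _).trans ((add_le_add ((measure_union_le _ _).trans (add_le_add
      ((measure_union_le _ _).trans (add_le_add hE₁ hE₂le)) hE₃le)) hE₄le).trans ?_)
    rw [← ENNReal.ofReal_add (by positivity) (by positivity),
      ← ENNReal.ofReal_add (by positivity) (by positivity),
      ← ENNReal.ofReal_add (by positivity) (by positivity)]
    refine ENNReal.ofReal_le_ofReal ?_
    exact failure_budget hT2 hU hp0.le hp1.le he0.le hep heq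
  · intro ω hω
    simp only [Set.mem_union, not_or] at hω
    obtain ⟨⟨⟨⟨h1, h2⟩, h3⟩, h4⟩, h5⟩ := hω
    have H := not_not.1 h5
    refine H.bounds hp hκ (hE₁' ω h1 H.path) hq' hq'' hξ hfeas hfeas' hΛ ?_ (not_lt.1 h3)
      (not_lt.1 h4) hK
    intro s t hs hst ht
    by_contra hn
    refine h2 ?_
    simp only [hE₂, Set.mem_iUnion]
    exact ⟨(s, t), Finset.mem_filter.2 ⟨Finset.mem_product.2
      ⟨Finset.mem_range.2 (by dsimp only; omega), Finset.mem_range.2 (by dsimp only; omega)⟩, hs, hst⟩, not_le.1 hn⟩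

end PlayerRun

end OnePlayer

/-! ### Separating the two players -/

section Separate

variable {X A Y B : Type*} [Fintype X] [Fintype A] [Fintype Y] [Fintype B] {L : ℕ}
variable {Ω : Type*}

open Classical in
/-- Two players who move independently given the past: since the joint law of their trajectories has
total mass one, so has each of the two factors, and the trajectory of the first player follows the
first factor. -/
lemma marginal_law {F m0 : MeasurableSpace Ω} {μ : Measure Ω} [IsProbabilityMeasure μ] (hF : F ≤ m0)
    {S : Layering X L} {S' : Layering Y L} {P : X → A → X → ℝ} {P' : Y → B → Y → ℝ}
    (hP : IsTransition S P) (hP' : IsTransition S' P') {π : Ω → X → A → ℝ} {π' : Ω → Y → B → ℝ}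
    (hπ : ∀ᵐ ω ∂μ, IsSubPolicy (π ω)) (hπ' : ∀ᵐ ω ∂μ, IsSubPolicy (π' ω))
    {τ : Ω → Traj X A L} {τ' : Ω → Traj Y B L} (hτ : ∀ σ, MeasurableSet {ω | τ ω = σ})
    (hτ' : ∀ σ, MeasurableSet {ω | τ' ω = σ})
    (joint : ∀ σ σ', μ[Set.indicator {ω | τ ω = σ ∧ τ' ω = σ'} (fun _ => (1 : ℝ)) | F] =ᵐ[μ]
      fun ω => trajProb S P (π ω) σ * trajProb S' P' (π' ω) σ') :
    (∀ᵐ ω ∂μ, ∑ σ, trajProb S P (π ω) σ = 1) ∧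
      ∀ σ, μ[fun ω => if τ ω = σ then (1 : ℝ) else 0 | F] =ᵐ[μ] fun ω => trajProb S P (π ω) σ := by
  set I : Traj X A L → Traj Y B L → Ω → ℝ := fun σ σ' =>
    Set.indicator {ω | τ ω = σ ∧ τ' ω = σ'} (fun _ => (1 : ℝ)) with hI
  have hI' : ∀ σ σ' ω, I σ σ' ω = if τ ω = σ ∧ τ' ω = σ' then 1 else 0 := fun σ σ' ω => by
    simp only [hI, Set.indicator_apply, Set.mem_ofPred_eq]
  have hint : ∀ σ σ', Integrable (I σ σ') μ := fun σ σ' =>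
    (integrable_const 1).indicator ((hτ σ).inter (hτ' σ'))
  have hone : ∀ σ, (fun ω => if τ ω = σ then (1 : ℝ) else 0) = ∑ σ', I σ σ' := fun σ => by
    ext ω
    rw [Finset.sum_apply]
    simp only [hI']
    by_cases h : τ ω = σ <;> simp [h]
  have hσ : ∀ σ, μ[fun ω => if τ ω = σ then (1 : ℝ) else 0 | F] =ᵐ[μ] fun ω =>
      trajProb S P (π ω) σ * ∑ σ', trajProb S' P' (π' ω) σ' := fun σ => by
    rw [hone σ]
    refine (condExp_finsetSum (fun σ' _ => hint σ σ') F).trans ?_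
    filter_upwards [ae_all_iff.2 (joint σ)] with ω hω
    rw [Finset.sum_apply, Finset.mul_sum]
    exact Finset.sum_congr rfl fun σ' _ => hω σ'
  have hall : (fun _ => (1 : ℝ)) = ∑ σ, fun ω => if τ ω = σ then (1 : ℝ) else 0 := by
    ext ω
    rw [Finset.sum_apply]
    simp
  have hprod : ∀ᵐ ω ∂μ, (∑ σ, trajProb S P (π ω) σ) * ∑ σ', trajProb S' P' (π' ω) σ' = 1 := by
    have h1 := condExp_const hF (1 : ℝ) (μ := μ)
    rw [hall] at h1
    have h2 := condExp_finsetSum (s := Finset.univ) (μ := μ)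
      (f := fun (σ : Traj X A L) ω => if τ ω = σ then (1 : ℝ) else 0)
      (fun σ _ => by rw [hone σ]; exact integrable_finsetSum' _ fun σ' _ => hint σ σ') F
    rw [h1] at h2
    filter_upwards [h2, ae_all_iff.2 hσ] with ω h3 h4
    rw [Finset.sum_apply, Finset.sum_apply] at h3
    rw [Finset.sum_mul, ← Finset.sum_congr rfl fun σ _ => h4 σ, ← h3]
    simp
  have hmass : ∀ᵐ ω ∂μ, ∑ σ, trajProb S P (π ω) σ = 1 ∧ ∑ σ', trajProb S' P' (π' ω) σ' = 1 := by
    filter_upwards [hprod, hπ, hπ'] with ω h h1 h2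
    have h3 := sum_trajProb_le_one hP h1
    have h4 := sum_trajProb_le_one hP' h2
    have h5 := Finset.sum_nonneg fun σ (_ : σ ∈ Finset.univ) => trajProb_nonneg hP h1 σ
    have h6 := Finset.sum_nonneg fun σ (_ : σ ∈ Finset.univ) => trajProb_nonneg hP' h2 σ
    constructor <;> nlinarith
  refine ⟨hmass.mono fun ω h => h.1, fun σ => (hσ σ).trans ?_⟩
  filter_upwards [hmass] with ω h
  rw [h.2, mul_one]

open Classical in
/-- The run of one player, with the other player represented by the losses `c` and by a trajectory that
is conditionally independent of the own one. -/
lemma PlayerRun.of_joint {m0 : MeasurableSpace Ω} {μ : Measure Ω} [IsProbabilityMeasure μ]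
    {S : Layering X L} {S' : Layering Y L} {P : X → A → X → ℝ} {P' : Y → B → Y → ℝ}
    {g₀ : X → A → ℝ} {b : ℝ} {T κ : ℕ} {δ : ℝ} {F : ℕ → MeasurableSpace Ω}
    {τ : ℕ → Ω → Traj X A L} {q : ℕ → Ω → X → A → X → ℝ} {lam : ℕ → Ω → ℝ}
    {g c : ℕ → Ω → X → A → ℝ} {τ' : ℕ → Ω → Traj Y B L} {q' : ℕ → Ω → Y → B → Y → ℝ}
    (hT : 1 ≤ T) (hF : ∀ t, F t ≤ m0) (hmono : Monotone F) (hP : IsTransition S P)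
    (hP' : IsTransition S' P') (hb : b ∈ Set.Ioc (0 : ℝ) L)
    (hτ : ∀ t σ, MeasurableSet {ω | τ t ω = σ}) (hτ' : ∀ t σ, MeasurableSet {ω | τ' t ω = σ})
    (hτF : ∀ t, MeasurableSpace.comap (τ (t + 1)) ⊤ ≤ F (t + 1))
    (hg : ∀ t, Measurable (g t))
    (hgF : ∀ t, MeasurableSpace.comap (g (t + 1)) inferInstance ≤ F (t + 1))
    (hgmem : ∀ t ω x a, g t ω x a ∈ Set.Icc (0 : ℝ) 1) (hg0 : ∀ ω x a, g 0 ω x a = 0)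
    (hmean : ∀ t, 1 ≤ t → t ≤ T → ∀ x a, ∫ ω, g t ω x a ∂μ = g₀ x a)
    (indep : ∀ t, t < T → Indep (MeasurableSpace.comap (g (t + 1)) inferInstance) (F t) μ)
    (joint : ∀ t, t < T → ∀ σ σ',
      μ[Set.indicator {ω | τ (t + 1) ω = σ ∧ τ' (t + 1) ω = σ'} (fun _ => (1 : ℝ)) | F t] =ᵐ[μ]
        fun ω => trajProb S P (policyOf (q (t + 1) ω)) σ *
          trajProb S' P' (policyOf (q' (t + 1) ω)) σ')
    (hq0 : ∀ ω, q 0 ω = uniformOcc S) (hlam0 : ∀ ω, lam 0 ω = 0)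
    (hq : ∀ t, t < T → Measurable[F t] (q (t + 1)))
    (hmem : ∀ t, t < T → ∀ᵐ ω ∂μ, q (t + 1) ω ∈ (counters κ (fun s => τ s ω) t).domain S T δ)
    (hmem' : ∀ t, t < T → ∀ᵐ ω ∂μ, IsMarg S' (q' (t + 1) ω))
    (hc : ∀ t, t < T → ∀ᵐ ω ∂μ, ∀ x a, |c t ω x a| ≤ 1)
    (opt : ∀ t, t < T → ∀ᵐ ω ∂μ, ∀ p ∈ (counters κ (fun s => τ s ω) t).domain S T δ,
      L * √T * utility S (q (t + 1) ω) (c t ω) + lam t ω * utility S (q (t + 1) ω) (g t ω) +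
          T * L * kl S (marg (q (t + 1) ω)) (mix S (1 / T) (q t ω)) ≤
        L * √T * utility S p (c t ω) + lam t ω * utility S p (g t ω) +
          T * L * kl S (marg p) (mix S (1 / T) (q t ω)))
    (dual : ∀ t, t < T → ∀ ω,
      lam (t + 1) ω = max (lam t ω + (utility S (q (t + 1) ω) (g t ω) - b)) 0) :
    PlayerRun μ S P g₀ b T κ δ F τ q lam g c := by
  have hlaw : ∀ t, t < T → _ := fun t ht => marginal_law (hF t) hP hP'
    ((hmem t ht).mono fun ω h => isSubPolicy_policyOf (Counters.isMarg_of_mem_domain h))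
    ((hmem' t ht).mono fun ω h => isSubPolicy_policyOf h) (hτ (t + 1)) (hτ' (t + 1)) (joint t ht)
  have hτi : ∀ t σ, Integrable (fun ω => if τ t ω = σ then (1 : ℝ) else 0) μ := fun t σ =>
    AEBdd.integrable ⟨1, Filter.Eventually.of_forall fun ω => by dsimp only; split_ifs <;> norm_num⟩
      (Measurable.ite (hτ t σ) measurable_const measurable_const)
  have hlaw' : ∀ t, t < T → ∀ (σ : Traj X A L) (f : Ω → ℝ), Measurable[F t] f → AEBdd μ f →
      ∫ ω, f ω * (if τ (t + 1) ω = σ then 1 else 0) ∂μ =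
        ∫ ω, f ω * trajProb S P (policyOf (q (t + 1) ω)) σ ∂μ := by
    intro t ht σ f hf hfb
    have hfi : Integrable (f * fun ω => if τ (t + 1) ω = σ then (1 : ℝ) else 0) μ := by
      refine AEBdd.integrable (hfb.mul ⟨1, Filter.Eventually.of_forall fun ω => ?_⟩)
        ((hf.mono (hF t) le_rfl).mul (Measurable.ite (hτ (t + 1) σ) measurable_const
          measurable_const))
      dsimp only; split_ifs <;> norm_num
    have h1 := condExp_mul_of_stronglyMeasurable_left hf.stronglyMeasurable hfi (hτi (t + 1) σ)
    have h2 := integral_condExp (hF t) (μ := μ)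
      (f := f * fun ω => if τ (t + 1) ω = σ then (1 : ℝ) else 0)
    change ∫ ω, (f * fun ω => if τ (t + 1) ω = σ then (1 : ℝ) else 0) ω ∂μ = _
    rw [← h2]
    refine integral_congr_ae ?_
    filter_upwards [h1, (hlaw t ht).2 σ] with ω h3 h4
    rw [h3, Pi.mul_apply, h4]
  have hpath : ∀ t, t < T → ∀ᵐ ω ∂μ, IsPath S (τ (t + 1) ω) := by
    intro t ht
    have h1 : ∀ σ, ¬ IsPath S σ → ∀ᵐ ω ∂μ, τ (t + 1) ω ≠ σ := by
      intro σ hσ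
      have h2 := hlaw' t ht σ (fun _ => 1) measurable_const (AEBdd.const 1)
      have h3 : ∀ ω, trajProb S P (policyOf (q (t + 1) ω)) σ = 0 := fun ω =>
        not_not.1 fun h => hσ (isPath_of_trajProb_ne_zero hP h)
      simp only [h3, one_mul, integral_zero] at h2
      rw [integral_eq_zero_iff_of_nonneg (fun ω => by dsimp only; split_ifs <;> simp)
        (hτi (t + 1) σ)] at h2
      filter_upwards [h2] with ω h4 h5
      simp [h5] at h4
    have h2 : ∀ᵐ ω ∂μ, ∀ σ, ¬ IsPath S σ → τ (t + 1) ω ≠ σ :=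
      ae_all_iff.2 fun σ => Filter.eventually_imp_distrib_left.2 fun hσ => h1 σ hσ
    filter_upwards [h2] with ω hω
    by_contra h
    exact hω _ h rfl
  have hτm : ∀ t, Measurable[F (t + 1), ⊤] (τ (t + 1)) := fun t =>
    measurable_iff_comap_le.2 (hτF t)
  have hgm : ∀ t, Measurable[F (t + 1)] (g (t + 1)) := fun t => measurable_iff_comap_le.2 (hgF t)
  refine ⟨hF, hmono, hP, ?_, ?_, fun t _ => hτm t, hq, ?_, fun t _ => hgm t, ?_, hlaw',
    fun t ht => (hlaw t ht).1⟩
  · intro x a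
    rw [← hmean 1 le_rfl hT x a]
    have hm : Measurable fun ω => g 1 ω x a :=
      (measurable_pi_apply a).comp ((measurable_pi_apply x).comp (hg 1))
    refine ⟨integral_nonneg fun ω => (hgmem 1 ω x a).1, ?_⟩
    have h1 : ∫ ω, g 1 ω x a ∂μ ≤ ∫ _, (1 : ℝ) ∂μ := by
      refine integral_mono (AEBdd.integrable ⟨1, Filter.Eventually.of_forall fun ω => ?_⟩ hm)
        (integrable_const 1) fun ω => (hgmem 1 ω x a).2
      rw [abs_of_nonneg (hgmem 1 ω x a).1]; exact (hgmem 1 ω x a).2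
    simpa using h1
  · have h1 : ∀ᵐ ω ∂μ, ∀ t, t < T → _ := ae_all_iff.2 fun t => Filter.eventually_imp_distrib_left.2 fun ht => hpath t ht
    have h2 : ∀ᵐ ω ∂μ, ∀ t, t < T → _ := ae_all_iff.2 fun t => Filter.eventually_imp_distrib_left.2 fun ht => hc t ht
    have h3 : ∀ᵐ ω ∂μ, ∀ t, t < T → _ := ae_all_iff.2 fun t => Filter.eventually_imp_distrib_left.2 fun ht => hmem t ht
    have h4 : ∀ᵐ ω ∂μ, ∀ t, t < T → _ := ae_all_iff.2 fun t => Filter.eventually_imp_distrib_left.2 fun ht => opt t ht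
    filter_upwards [h1, h2, h3, h4] with ω H1 H2 H3 H4
    exact ⟨hb, H1, fun t x a => hgmem t ω x a, H2, hq0 ω, hlam0 ω, H3, H4, fun t ht => dual t ht ω⟩
  · have key : ∀ t, t < T → Measurable[F t] (lam t) → Measurable[F t] (g t) →
        Measurable[F t] (lam (t + 1)) := by
      intro t ht h1 h2
      have h3 : lam (t + 1) = fun ω =>
          max (lam t ω + (utility S (q (t + 1) ω) (g t ω) - b)) 0 := funext fun ω => dual t ht ω
      rw [h3]
      refine Measurable.max (h1.add (Measurable.sub_const ?_ _)) measurable_const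
      simp only [utility_eq]
      refine Finset.measurable_sum _ fun i _ => Measurable.mul ?_ ?_
      · exact @measurable_marg X A _ _ Ω (F t) _ (hq t ht) i.1 i.2
      · exact (measurable_pi_apply i.2).comp ((measurable_pi_apply i.1).comp h2)
    intro t
    induction t with
    | zero =>
      intro ht
      refine key 0 ht ?_ ?_
      · rw [show lam 0 = fun _ => 0 from funext hlam0]; exact measurable_const
      · rw [show g 0 = fun _ _ _ => 0 from funext fun ω => funext fun x => funext (hg0 ω x)]
        exact measurable_const
    | succ t ih =>
      intro ht
      exact key (t + 1) ht ((ih (by omega)).mono (hmono (Nat.le_succ t)) le_rfl) (hgm t)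
  · intro t ht x a f hf hfb
    have hev : Measurable fun u : X → A → ℝ => u x a - g₀ x a :=
      ((measurable_pi_apply a).comp (measurable_pi_apply x)).sub_const _
    have h1 : IndepFun f (fun ω => g (t + 1) ω x a - g₀ x a) μ := by
      rw [IndepFun_iff_Indep]
      refine indep_of_indep_of_le_left (indep_of_indep_of_le_right (indep t ht).symm ?_)
        hf.comap_le
      exact (hev.comp (comap_measurable (g (t + 1)))).comap_le
    have hgi : Integrable (fun ω => g (t + 1) ω x a) μ := by
      refine AEBdd.integrable ⟨1, Filter.Eventually.of_forall fun ω => ?_⟩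
        ((measurable_pi_apply a).comp ((measurable_pi_apply x).comp (hg (t + 1))))
      rw [abs_of_nonneg (hgmem _ ω x a).1]; exact (hgmem _ ω x a).2
    rw [h1.integral_fun_mul_eq_mul_integral (hf.mono (hF t) le_rfl).aestronglyMeasurable
      (hev.comp (hg (t + 1))).aestronglyMeasurable, integral_sub hgi (integrable_const _),
      hmean (t + 1) (by omega) (by omega)]
    simp

/-- The loss of a player in one episode, when the other player uses the occupancy measure `q`: the
reward averaged over the other player's state and action in the same layer. -/
noncomputable def averagedReward (S : Layering X L) (S' : Layering Y L) (q : Y → B → Y → ℝ)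
    (r : X → Y → A → B → ℝ) (x : X) (a : A) : ℝ :=
  if S.layer x < L then ∑ y ∈ S'.level (S.layer x), ∑ b, marg q y b * r x y a b else 0

lemma reward_eq_utility (S : Layering X L) (S' : Layering Y L) (p : X → A → X → ℝ)
    (q : Y → B → Y → ℝ) (r : X → Y → A → B → ℝ) :
    reward S S' p q r = utility S p (averagedReward S S' q r) := by
  refine Finset.sum_congr rfl fun l hl => Finset.sum_congr rfl fun x hx => ?_
  have hx' : S.layer x = l := mem_level.1 hx
  rw [Finset.sum_comm]
  refine Finset.sum_congr rfl fun a _ => ?_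
  rw [averagedReward, if_pos (by rw [hx']; exact Finset.mem_range.1 hl), hx', Finset.mul_sum]
  refine Finset.sum_congr rfl fun y _ => ?_
  rw [Finset.mul_sum]
  exact Finset.sum_congr rfl fun b _ => mul_assoc _ _ _

lemma reward_comm (S : Layering X L) (S' : Layering Y L) (p : X → A → X → ℝ)
    (q : Y → B → Y → ℝ) (r : X → Y → A → B → ℝ) :
    reward S S' p q r = reward S' S q p (fun y x b a => r x y a b) := by
  refine Finset.sum_congr rfl fun l _ => ?_
  rw [Finset.sum_comm]
  refine Finset.sum_congr rfl fun y _ => Finset.sum_congr rfl fun x _ => ?_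
  rw [Finset.sum_comm]
  exact Finset.sum_congr rfl fun b _ => Finset.sum_congr rfl fun a _ => by ring

lemma abs_averagedReward_le {S : Layering X L} {S' : Layering Y L} {q : Y → B → Y → ℝ}
    (hq : IsMarg S' q) {r : X → Y → A → B → ℝ} (hr : ∀ x y a b, r x y a b ∈ Set.Icc (0 : ℝ) 1)
    (x : X) (a : A) : |averagedReward S S' q r x a| ≤ 1 := by
  unfold averagedReward
  split_ifs with h
  · rw [abs_of_nonneg (Finset.sum_nonneg fun y _ => Finset.sum_nonneg fun b _ =>
      mul_nonneg (hq.nonneg y b) (hr x y a b).1), ← hq.level _ h]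
    exact Finset.sum_le_sum fun y _ => Finset.sum_le_sum fun b _ =>
      mul_le_of_le_one_right (hq.nonneg y b) (hr x y a b).2
  · simp

lemma utility_neg (S : Layering X L) (p : X → A → X → ℝ) (c : X → A → ℝ) :
    utility S p (fun x a => -c x a) = -utility S p c := by
  simp only [utility_eq, mul_neg, Finset.sum_neg_distrib]

/-- Replacing the occupancy measure of one player changes the reward by at most the distance. -/
lemma abs_reward_sub_le {S : Layering X L} {S' : Layering Y L} (p p' : X → A → X → ℝ)
    {q : Y → B → Y → ℝ} (hq : IsMarg S' q) {r : X → Y → A → B → ℝ}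
    (hr : ∀ x y a b, r x y a b ∈ Set.Icc (0 : ℝ) 1) :
    |reward S S' p q r - reward S S' p' q r| ≤ occDist S p p' := by
  rw [reward_eq_utility, reward_eq_utility, abs_le]
  have h1 := utility_sub_le_occDist S p p' (abs_averagedReward_le (S := S) hq hr)
  have h2 := utility_sub_le_occDist S p' p (abs_averagedReward_le (S := S) hq hr)
  rw [occDist_comm] at h2
  constructor <;> linarith

end Separate

/-! ### The game -/

section Assembly

variable {X Y A B : Type*} [Fintype X] [Fintype Y] [Fintype A] [Fintype B] {L : ℕ}
variable {G : Game X Y A B L} {T κ : ℕ} {p : ℝ} {Ω : Type*} [m0 : MeasurableSpace Ω]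
  {μ : Measure Ω} [IsProbabilityMeasure μ]

namespace Run

/-- The past of a run. -/
abbrev past {V η θ δ : ℝ} (R : Run G T κ V η θ δ μ) (t : ℕ) : MeasurableSpace Ω :=
  history R.τ₁ R.τ₂ R.g R.h t

variable (R : Run G T κ (L * √T) (1 / (T * L)) (1 / T) (p / (2 * T)) μ)

lemma past_le (t : ℕ) : R.past t ≤ m0 := by
  refine iSup₂_le fun s _ => sup_le (sup_le (sup_le ?_ ?_) ?_) ?_
  · exact measurable_iff_comap_le.1
      (@measurable_to_countable' _ _ ⊤ _ _ _ fun σ => R.τ₁_measurable s σ)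
  · exact measurable_iff_comap_le.1
      (@measurable_to_countable' _ _ ⊤ _ _ _ fun σ => R.τ₂_measurable s σ)
  · exact (R.g_measurable s).comap_le
  · exact (R.h_measurable s).comap_le

lemma past_mono : Monotone R.past := fun _ _ h =>
  biSup_mono fun _ hi => Finset.mem_Icc.2 ⟨(Finset.mem_Icc.1 hi).1, (Finset.mem_Icc.1 hi).2.trans h⟩

lemma le_past (t : ℕ) :
    MeasurableSpace.comap (R.τ₁ (t + 1)) ⊤ ⊔ MeasurableSpace.comap (R.τ₂ (t + 1)) ⊤ ⊔
      MeasurableSpace.comap (R.g (t + 1)) inferInstance ⊔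
        MeasurableSpace.comap (R.h (t + 1)) inferInstance ≤ R.past (t + 1) :=
  le_biSup (f := fun s => MeasurableSpace.comap (R.τ₁ s) ⊤ ⊔ MeasurableSpace.comap (R.τ₂ s) ⊤ ⊔
      MeasurableSpace.comap (R.g s) inferInstance ⊔
        MeasurableSpace.comap (R.h s) inferInstance) (Finset.mem_Icc.2 ⟨by omega, le_rfl⟩)

lemma isMarg₁ [Nonempty A] (hS : ∀ l ≤ L, (G.SX.level l).Nonempty) {t : ℕ} (ht : t ≤ T) :
    ∀ᵐ ω ∂μ, IsMarg G.SX (R.q₁ t ω) := by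
  rcases t with _ | t
  · exact Filter.Eventually.of_forall fun ω => by rw [R.q₁_zero]; exact isMarg_uniformOcc hS
  · exact (R.q₁_mem t ht).mono fun ω h => Counters.isMarg_of_mem_domain h

lemma isMarg₂ [Nonempty B] (hS : ∀ l ≤ L, (G.SY.level l).Nonempty) {t : ℕ} (ht : t ≤ T) :
    ∀ᵐ ω ∂μ, IsMarg G.SY (R.q₂ t ω) := by
  rcases t with _ | t
  · exact Filter.Eventually.of_forall fun ω => by rw [R.q₂_zero]; exact isMarg_uniformOcc hS
  · exact (R.q₂_mem t ht).mono fun ω h => Counters.isMarg_of_mem_domain h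

/-- The loss of the min-player in episode `t`. -/
noncomputable def loss₁ (t : ℕ) (ω : Ω) : X → A → ℝ :=
  averagedReward G.SX G.SY (R.q₂ t ω) (G.r t)

/-- The loss of the max-player in episode `t`, with the opposite sign of the reward. -/
noncomputable def loss₂ (t : ℕ) (ω : Ω) : Y → B → ℝ := fun y b =>
  -averagedReward G.SY G.SX (R.q₁ t ω) (fun y x b a => G.r t x y a b) y b

lemma utility_loss₁ (t : ℕ) (ω : Ω) (q : X → A → X → ℝ) :
    utility G.SX q (R.loss₁ t ω) = reward G.SX G.SY q (R.q₂ t ω) (G.r t) :=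
  (reward_eq_utility _ _ _ _ _).symm

lemma utility_loss₂ (t : ℕ) (ω : Ω) (q : Y → B → Y → ℝ) :
    utility G.SY q (R.loss₂ t ω) = -reward G.SX G.SY (R.q₁ t ω) q (G.r t) := by
  rw [reward_comm, reward_eq_utility, ← utility_neg]
  rfl

/-- The saddle point property at the other player's own choice is the optimality of the
min-player. -/
lemma playerRun₁ [Nonempty B] (hT : 1 ≤ T) (hSY : ∀ l ≤ L, (G.SY.level l).Nonempty) :
    PlayerRun μ G.SX G.P₁ G.g G.b₁ T κ (p / (2 * T)) R.past R.τ₁ R.q₁ R.l₁ R.g R.loss₁ := by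
  refine PlayerRun.of_joint (τ' := R.τ₂) (q' := R.q₂) hT R.past_le R.past_mono G.isTransition₁
    G.isTransition₂ G.b₁_mem R.τ₁_measurable R.τ₂_measurable
    (fun t => (le_sup_left.trans (le_sup_left.trans le_sup_left)).trans (R.le_past t))
    R.g_measurable (fun t => (le_sup_right.trans le_sup_left).trans (R.le_past t)) R.g_mem R.g_zero
    R.g_mean (fun t ht => indep_of_indep_of_le_left (indep_of_indep_of_le_right
      (R.utility_indep t ht) (le_sup_left.trans le_sup_left)) le_sup_left)
    (fun t ht σ σ' => R.trajectory_law t ht σ σ') R.q₁_zero R.l₁_zero R.q₁_adapted R.q₁_mem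
    (fun t ht => R.isMarg₂ hSY ht)
    (fun t ht => (R.isMarg₂ hSY ht.le).mono fun ω h => abs_averagedReward_le h (G.r_mem t)) ?_
    R.dual₁
  intro t ht
  filter_upwards [R.primal t ht, R.q₂_mem t ht] with ω h h2 q hq
  have h3 := h q hq _ h2
  simp only [primalObjective] at h3
  rw [show ((1 : ℝ) / (T * L))⁻¹ = T * L by rw [one_div, inv_inv]] at h3
  rw [R.utility_loss₁, R.utility_loss₁]
  linarith

/-- The saddle point property at the other player's own choice is the optimality of the
max-player. -/
lemma playerRun₂ [Nonempty A] (hT : 1 ≤ T) (hSX : ∀ l ≤ L, (G.SX.level l).Nonempty) :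
    PlayerRun μ G.SY G.P₂ G.h G.b₂ T κ (p / (2 * T)) R.past R.τ₂ R.q₂ R.l₂ R.h R.loss₂ := by
  refine PlayerRun.of_joint (τ' := R.τ₁) (q' := R.q₁) hT R.past_le R.past_mono G.isTransition₂
    G.isTransition₁ G.b₂_mem R.τ₂_measurable R.τ₁_measurable
    (fun t => (le_sup_right.trans (le_sup_left.trans le_sup_left)).trans (R.le_past t))
    R.h_measurable (fun t => le_sup_right.trans (R.le_past t)) R.h_mem R.h_zero
    R.h_mean (fun t ht => indep_of_indep_of_le_left (indep_of_indep_of_le_right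
      (R.utility_indep t ht) (le_sup_left.trans le_sup_left)) le_sup_right)
    ?_ R.q₂_zero R.l₂_zero R.q₂_adapted R.q₂_mem
    (fun t ht => R.isMarg₁ hSX ht)
    (fun t ht => (R.isMarg₁ hSX ht.le).mono fun ω h y b => ?_) ?_
    R.dual₂
  · intro t ht σ σ'
    have h := R.trajectory_law t ht σ' σ
    simp only [and_comm (a := R.τ₂ _ _ = σ), mul_comm (trajProb G.SY _ _ σ)]
    exact h
  · rw [loss₂, abs_neg]
    exact abs_averagedReward_le h (fun y x b a => G.r_mem t x y a b) y b
  intro t ht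
  filter_upwards [R.primal t ht, R.q₁_mem t ht] with ω h h2 q hq
  have h3 := h _ h2 q hq
  simp only [primalObjective] at h3
  rw [show ((1 : ℝ) / (T * L))⁻¹ = T * L by rw [one_div, inv_inv]] at h3
  rw [R.utility_loss₂, R.utility_loss₂]
  linarith

/-- The regret against a pair of occupancy measures splits into the regrets of the iterates of both
players and the errors of their occupancy measures. -/
lemma regret_le (q₁ : X → A → X → ℝ) (q₂ : Y → B → Y → ℝ) (h₁ : IsMarg G.SX q₁)
    (h₂ : IsMarg G.SY q₂) (ω : Ω) :
    R.regret q₁ q₂ ω ≤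
      ∑ t ∈ Finset.range T,
        (utility G.SX (R.q₁ t ω) (R.loss₁ t ω) - utility G.SX q₁ (R.loss₁ t ω)) +
      ∑ t ∈ Finset.range T,
        (utility G.SY (R.q₂ t ω) (R.loss₂ t ω) - utility G.SY q₂ (R.loss₂ t ω)) +
      ∑ t ∈ Finset.range T, occDist G.SX (R.trueOcc₁ t ω) (R.q₁ t ω) +
      ∑ t ∈ Finset.range T, occDist G.SY (R.trueOcc₂ t ω) (R.q₂ t ω) := by
  rw [← Finset.sum_add_distrib, ← Finset.sum_add_distrib, ← Finset.sum_add_distrib]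
  refine Finset.sum_le_sum fun t _ => ?_
  rw [R.utility_loss₁, R.utility_loss₁, R.utility_loss₂, R.utility_loss₂]
  have e1 := (abs_le.1 (abs_reward_sub_le (S := G.SX) (R.trueOcc₁ t ω) (R.q₁ t ω) h₂
    (G.r_mem t))).2
  have e2 := (abs_le.1 (abs_reward_sub_le (S := G.SY) (R.trueOcc₂ t ω) (R.q₂ t ω) h₁
    (r := fun y x b a => G.r t x y a b) (fun y x b a => G.r_mem t x y a b))).1
  rw [← reward_comm G.SX G.SY q₁ (R.trueOcc₂ t ω) (G.r t),
    ← reward_comm G.SX G.SY q₁ (R.q₂ t ω) (G.r t)] at e2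
  linarith

end Run

/-- The violation of the executed policies is at most that of the iterates plus the errors of the
occupancy measures. -/
lemma sum_violation_le {Z C : Type*} [Fintype Z] [Fintype C] (S : Layering Z L) {n : ℕ}
    (Q q : ℕ → Z → C → Z → ℝ) (g : ℕ → Z → C → ℝ) (hg : ∀ t x a, g t x a ∈ Set.Icc (0 : ℝ) 1)
    (b : ℝ) :
    ∑ t ∈ Finset.range n, (utility S (Q t) (g t) - b) ≤
      ∑ t ∈ Finset.range n, (utility S (q t) (g t) - b) +
        ∑ t ∈ Finset.range n, occDist S (Q t) (q t) := by
  rw [← Finset.sum_add_distrib]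
  refine Finset.sum_le_sum fun t _ => ?_
  have := utility_sub_le_occDist S (Q t) (q t) (g := g t) fun x a => by
    rw [abs_of_nonneg (hg t x a).1]; exact (hg t x a).2
  linarith

/-- The rate of one player is at most the rate of the game. -/
lemma rate_le {z J ι x a b l t : ℝ} (hz : 0 ≤ z) (hJ : 0 ≤ J) (hJι : J ≤ 2 * ι) (hx : 0 ≤ x)
    (hl : 0 ≤ l) (ht : 0 ≤ t) (hb : 0 ≤ b) :
    2000 * z * (J ^ 2 * (x * l * √(t * a))) ≤
      8000 * z * ι ^ 2 * (x * l * √(t * (a + b))) := by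
  have h1 : J ^ 2 ≤ 4 * ι ^ 2 := by nlinarith
  have h2 : √(t * a) ≤ √(t * (a + b)) :=
    Real.sqrt_le_sqrt (mul_le_mul_of_nonneg_left (by linarith) ht)
  calc 2000 * z * (J ^ 2 * (x * l * √(t * a)))
      ≤ 2000 * z * (4 * ι ^ 2 * (x * l * √(t * (a + b)))) := by gcongr
    _ = _ := by ring

/-- The logarithmic factor of one player, in terms of that of the game. -/
lemma log_factor_le {t u v p : ℝ} (ht : 2 ≤ t) (hu : 2 ≤ u) (hv : 2 ≤ v) (hp0 : 0 < p)
    (hp1 : p ≤ 1) : Real.log (2 * t ^ 2 * u / p) ≤ 2 * Real.log (t * (u * v) / p) := by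
  have h1 : 2 * Real.log (t * (u * v) / p) = Real.log ((t * (u * v) / p) ^ 2) := by
    rw [Real.log_pow]; norm_num
  rw [h1]
  refine Real.log_le_log (by positivity) ?_
  rw [div_pow, div_le_div_iff₀ hp0 (by positivity)]
  have h2 : 2 * u ≤ (u * v) ^ 2 := by
    have h3 : 2 * u ≤ u * v := by nlinarith
    nlinarith
  have h4 : p ^ 2 ≤ p := by nlinarith
  calc 2 * t ^ 2 * u * p ^ 2 = t ^ 2 * (2 * u) * p ^ 2 := by ring
    _ ≤ t ^ 2 * (u * v) ^ 2 * p := by gcongr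
    _ = (t * (u * v)) ^ 2 * p := by ring

/-- Outside an event of probability at most `p`, the regret and the violations are of the claimed
order. -/
lemma Run.exists_event (R : Run G T κ (L * √T) (1 / (T * L)) (1 / T) (p / (2 * T)) μ) {ξ : ℝ}
    (hξ : 0 < ξ) (hfeas : G.StrictlyFeasible ξ)
    (hT : max (Fintype.card X * Fintype.card A) (Fintype.card B * Fintype.card Y) ≤ T)
    (hp0 : 0 < p) (hp1 : p < 1) (hκ : κ ≤ 1) {q₁ : X → A → X → ℝ} {q₂ : Y → B → Y → ℝ}
    (hN : G.IsNash T q₁ q₂) {bound : ℝ}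
    (hbound : bound = 16000 * (1 + 1 / ξ) *
      Real.log (T * Fintype.card X * Fintype.card Y * Fintype.card A * Fintype.card B / p) ^ 2 *
        ((Fintype.card X + Fintype.card Y) * L * √(T * (Fintype.card A + Fintype.card B)))) :
    ∃ E : Set Ω, μ E ≤ ENNReal.ofReal p ∧ ∀ ω, ω ∉ E →
      R.regret q₁ q₂ ω ≤ bound ∧ R.violation₁ ω ≤ bound ∧ R.violation₂ ω ≤ bound := by
  obtain ⟨π, ν, hπ, hν, hf₁, hf₂⟩ := hfeas
  have hL : 1 ≤ L := by
    have : (0 : ℝ) < L := G.b₁_mem.1.trans_le G.b₁_mem.2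
    exact_mod_cast this
  have ho₁ := occ_mem_occSet G.isTransition₁ hπ
  have ho₂ := occ_mem_occSet G.isTransition₂ hν
  have hm₁ := isMarg_of_mem_occSet G.isTransition₁ ho₁
  have hm₂ := isMarg_of_mem_occSet G.isTransition₂ ho₂
  have hA : Nonempty A := hm₁.nonempty_action hL
  have hB : Nonempty B := hm₂.nonempty_action hL
  have hX : 2 ≤ Fintype.card X := (by omega : 2 ≤ L + 1).trans hm₁.succ_le_card
  have hY : 2 ≤ Fintype.card Y := (by omega : 2 ≤ L + 1).trans hm₂.succ_le_card
  have hT₁ : Fintype.card X * Fintype.card A ≤ T := (le_max_left _ _).trans hT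
  have hT₂ : Fintype.card Y * Fintype.card B ≤ T := by
    rw [mul_comm]; exact (le_max_right _ _).trans hT
  obtain ⟨hpar₁, hexp₁⟩ := Params.of_delta hL hX hT₁ hp0 hp1
  obtain ⟨hpar₂, hexp₂⟩ := Params.of_delta hL hY hT₂ hp0 hp1
  set J₁ : ℝ := Real.log (2 * T ^ 2 * (Fintype.card X * Fintype.card A) / p) with hJ₁
  set J₂ : ℝ := Real.log (2 * T ^ 2 * (Fintype.card Y * Fintype.card B) / p) with hJ₂
  have hU₁ : 2 ≤ Fintype.card X * Fintype.card A :=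
    hX.trans (Nat.le_mul_of_pos_right _ Fintype.card_pos)
  have hU₂ : 2 ≤ Fintype.card Y * Fintype.card B :=
    hY.trans (Nat.le_mul_of_pos_right _ Fintype.card_pos)
  have hT1 : 1 ≤ T := by have := hpar₁.T_two; omega
  have R₁ := R.playerRun₁ hT1 fun l hl => hm₂.level_nonempty hl
  have R₂ := R.playerRun₂ hT1 fun l hl => hm₁.level_nonempty hl
  obtain ⟨E₁, hE₁, H₁⟩ := R₁.exists_bounds_event hpar₁ hκ hU₁ hp0 hp1 hexp₁ ho₁ hN.mem₁ hξ hf₁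
    hN.feasible₁ rfl
  obtain ⟨E₂, hE₂, H₂⟩ := R₂.exists_bounds_event hpar₂ hκ hU₂ hp0 hp1 hexp₂ ho₂ hN.mem₂ hξ hf₂
    hN.feasible₂ rfl
  refine ⟨E₁ ∪ E₂, ?_, fun ω hω => ?_⟩
  · refine (measure_union_le _ _).trans ((add_le_add hE₁ hE₂).trans (le_of_eq ?_))
    rw [← ENNReal.ofReal_add (by positivity) (by positivity), add_halves]
  · obtain ⟨a₁, b₁, c₁⟩ := H₁ ω fun h => hω (Or.inl h)
    obtain ⟨a₂, b₂, c₂⟩ := H₂ ω fun h => hω (Or.inr h)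
    set ι : ℝ := Real.log
      (T * Fintype.card X * Fintype.card Y * Fintype.card A * Fintype.card B / p) with hι
    have hTr : (2 : ℝ) ≤ T := by exact_mod_cast hpar₁.T_two
    have hU₁' : (2 : ℝ) ≤ Fintype.card X * Fintype.card A := by exact_mod_cast hU₁
    have hU₂' : (2 : ℝ) ≤ Fintype.card Y * Fintype.card B := by exact_mod_cast hU₂
    have hι₁ : J₁ ≤ 2 * ι := by
      refine (log_factor_le hTr hU₁' hU₂' hp0 hp1.le).trans (le_of_eq ?_)
      rw [hι]; congr 2; ring
    have hι₂ : J₂ ≤ 2 * ι := by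
      refine (log_factor_le hTr hU₂' hU₁' hp0 hp1.le).trans (le_of_eq ?_)
      rw [hι]; congr 2; ring
    have hz : 0 ≤ 1 + 1 / ξ := by positivity
    have hJ₁0 : 0 ≤ J₁ := zero_le_one.trans hpar₁.J_one
    have hJ₂0 : 0 ≤ J₂ := zero_le_one.trans hpar₂.J_one
    have r₁ := rate_le (x := Fintype.card X) (a := Fintype.card A) (b := Fintype.card B) (l := L)
      (t := T) hz hJ₁0 hι₁ (by positivity) (by positivity) (by positivity) (by positivity)
    have r₂ := rate_le (x := Fintype.card Y) (a := Fintype.card B) (b := Fintype.card A) (l := L)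
      (t := T) hz hJ₂0 hι₂ (by positivity) (by positivity) (by positivity) (by positivity)
    rw [add_comm (Fintype.card B : ℝ)] at r₂
    set s : ℝ := √(T * (Fintype.card A + Fintype.card B)) with hs
    have n₁ : 0 ≤ 8000 * (1 + 1 / ξ) * ι ^ 2 * (Fintype.card X * L * s) := by positivity
    have n₂ : 0 ≤ 8000 * (1 + 1 / ξ) * ι ^ 2 * (Fintype.card Y * L * s) := by positivity
    have hbd : bound = 2 * (8000 * (1 + 1 / ξ) * ι ^ 2 * (Fintype.card X * L * s)) +
        2 * (8000 * (1 + 1 / ξ) * ι ^ 2 * (Fintype.card Y * L * s)) := by rw [hbound]; ring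
    have reg := R.regret_le q₁ q₂ (isMarg_of_mem_occSet G.isTransition₁ hN.mem₁)
      (isMarg_of_mem_occSet G.isTransition₂ hN.mem₂) ω
    have v₁ := sum_violation_le G.SX (n := T) (fun t => R.trueOcc₁ t ω) (fun t => R.q₁ t ω)
      (fun t => R.g t ω) (fun t => R.g_mem t ω) G.b₁
    have v₂ := sum_violation_le G.SY (n := T) (fun t => R.trueOcc₂ t ω) (fun t => R.q₂ t ω)
      (fun t => R.h t ω) (fun t => R.h_mem t ω) G.b₂
    change ∑ t ∈ Finset.range T, occDist G.SX (R.trueOcc₁ t ω) (R.q₁ t ω) ≤ _ at c₁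
    change ∑ t ∈ Finset.range T, occDist G.SY (R.trueOcc₂ t ω) (R.q₂ t ω) ≤ _ at c₂
    refine ⟨?_, max_le ?_ ?_, max_le ?_ ?_⟩
    · linarith only [reg, a₁, a₂, c₁, c₂, r₁, r₂, hbd]
    · linarith only [v₁, b₁, c₁, r₁, n₂, hbd]
    · linarith only [n₁, n₂, hbd]
    · linarith only [v₂, b₂, c₂, r₂, n₁, hbd]
    · linarith only [n₁, n₂, hbd]

end Assembly

end ConstrainedMG

theorem theorem2 :
    ∃ k : ℕ, ∀ ξ : ℝ, 0 < ξ → ∃ C : ℝ, 0 < C ∧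
      ∀ (X Y A B : Type*) [Fintype X] [Fintype Y] [Fintype A] [Fintype B] (L T : ℕ)
        (G : Game X Y A B L), G.StrictlyFeasible ξ →
        max (Fintype.card X * Fintype.card A) (Fintype.card B * Fintype.card Y) ≤ T →
        ∀ p : ℝ, 0 < p → p < 1 → ∀ κ : ℕ, κ ≤ 1 →
        ∀ (Ω : Type*) [MeasurableSpace Ω] (μ : MeasureTheory.Measure Ω)
          [MeasureTheory.IsProbabilityMeasure μ]
          (R : Run G T κ (L * √T) (1 / (T * L)) (1 / T) (p / (2 * T)) μ)
          (q₁ : X → A → X → ℝ) (q₂ : Y → B → Y → ℝ), G.IsNash T q₁ q₂ →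
        let bound : ℝ :=
          C * Real.log (T * Fintype.card X * Fintype.card Y * Fintype.card A * Fintype.card B / p) ^ k *
            ((Fintype.card X + Fintype.card Y) * L * √(T * (Fintype.card A + Fintype.card B)))
        ENNReal.ofReal (1 - p) ≤
          μ {ω | R.regret q₁ q₂ ω ≤ bound ∧ R.violation₁ ω ≤ bound ∧ R.violation₂ ω ≤ bound} := by
  refine ⟨2, fun ξ hξ => ⟨16000 * (1 + 1 / ξ), by positivity, ?_⟩⟩
  intro X Y A B _ _ _ _ L T G hfeas hT p hp0 hp1 κ hκ Ω _ μ _ R q₁ q₂ hN bound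
  obtain ⟨E, hE, H⟩ := R.exists_event hξ hfeas hT hp0 hp1 hκ hN (bound := bound) rfl
  rw [ENNReal.ofReal_sub _ hp0.le, ENNReal.ofReal_one, tsub_le_iff_right, ← measure_univ (μ := μ)]
  -- the three quantities need not be measurable: only subadditivity of the outer measure is used
  refine (measure_mono fun ω _ => ?_).trans ((measure_union_le _ E).trans (add_le_add le_rfl hE))
  by_cases hω : ω ∈ E
  · exact Or.inr hω
  · exact Or.inl (H ω hω)
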